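/- Let $k$ be an algebraically closed field of characteristic zero and let $i\in k$ with $i^2=-1$. Let $H_4$ be Sweedler's Hopf algebra over $k$: generated by $G,X$ with $G^2=1$, $X^2=0$, $XG=-GX$, and $\Delta(G)=G\otimes G$, $\varepsilon(G)=1$, $S(G)=G$, $\Delta(X)=X\otimes G+1\otimes X$, $\varepsilon(X)=0$, $S(X)=GX$. Let $H_8$ be the Kac–Paljutkin Hopf algebra over $k$: generated by $g,h,z$ with $$g^2=h^2=1,\quad gh=hg,\quad z^2=\tfrac12(1+g+h-gh),\quad gz=zh,\quad hz=zg,$$ where $g,h$ are group-like, $\Delta(z)=J(z\otimes z)$ with $J=\tfrac12(1\otimes1+g\otimes1+1\otimes h-g\otimes h)$, $\varepsilon(z)=1$, and $S(g)=g$, $S(h)=h$, $S(z)=z$. Let $H_{32,1},H_{32,2},H_{32,3}$ be the Hopf algebras generated by $g,h,z,G,X$ with the relations of $H_8$ for $g,h,z$, the relations of $H_4$ for $G,X$, the values of $\Delta,\varepsilon,S$ on the generators being those given above, and with the following further relations: - for $H_{32,1}$: $gG=Gg$, $hG=Gh$, $zG=Gz$, $gX=Xg$, $hX=Xh$, $zX=-Xz$;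 - for $H_{32,2}$: $gG=Gg$, $hG=Gh$, $gzG=Ghz$, $gX=-Xg$, $hX=-Xh$, $zX=i\,Xgz$; - for $H_{32,3}$: $gG=Gg$, $hG=Gh$, $gzG=Ghz$, $gX=-Xg$, $hX=-Xh$, $zX=-i\,Xgz$. A Hopf algebra $E$ *factorizes through* Hopf algebras $A$ and $H$ if there are injective Hopf algebra maps $\iota:A\to E$ and $\jmath:H\to E$ such that $A\otimes H\to E$, $a\otimes h\mapsto \iota(a)\jmath(h)$, is bijective. A *matched pair* $(A,H,\triangleright,\triangleleft)$ consists of Hopf algebras $A,H$ and coalgebra maps $\triangleright:H\otimes A\to A$, $\triangleleft:H\otimes A\to H$ making $A$ a left $H$-module coalgebra and $H$ a right $A$-module coalgebra, such that for all $a,b\in A$ and $x,y\in H$ (with Sweedler's notation $\Delta(c)=c_1\otimes c_2$, sums understood) $$x\triangleright 1=\varepsilon(x)1,\qquad 1\triangleleft a=\varepsilon(a)1,\qquad x\triangleright(ab)=(x_1\triangleright a_1)\big((x_2\triangleleft a_2)\triangleright b\big),$$ $$(yx)\triangleleft a=\big(y\triangleleft(x_1\triangleright a_1)\big)(x_2\triangleleft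 a_2),\qquad x_1\triangleleft a_1\otimes x_2\triangleright a_2=x_2\triangleleft a_2\otimes x_1\triangleright a_1 .$$ The corresponding *bicrossed product* $A\bowtie H$ is the tensor product coalgebra $A\otimes H$ with unit $1\otimes 1$ and product $(a\otimes x)(b\otimes y)=a(x_1\triangleright b_1)\otimes(x_2\triangleleft b_2)y$. **Theorem.** For a Hopf algebra $E$ over $k$ the following are equivalent: 1. $E$ factorizes through $H_8$ and $H_4$; 2. $E$ factorizes through $H_4$ and $H_8$ (in this order); 3. $E$ is isomorphic to a bicrossed product $H_8\bowtie H_4$, for some matched pair; 4. $E$ is isomorphic to a bicrossed product $H_4\bowtie H_8$, for some matched pair; 5. $E$ is isomorphic, as a Hopf algebra, to one of $H_8\otimes H_4$, $H_{32,1}$, $H_{32,2}$, $H_{32,3}$. -/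

import Mathlib

open scoped TensorProduct

set_option linter.unusedSimpArgs false
set_option linter.unnecessarySeqFocus false

noncomputable section

/-! ## Hopf algebra structures on an algebra with given generators -/

namespace HopfGen

section

variable {k : Type*} [Field k] {P : Type*} [Ring P] [Algebra k P]

/-- An algebra map `P → Pᵐᵒᵖ`, seen as a linear endomorphism of `P`. -/
def anti (S : P →ₐ[k] Pᵐᵒᵖ) : P →ₗ[k] P :=
  (MulOpposite.opLinearEquiv k).symm.toLinearMap ∘ₗ S.toLinearMap

@[simp] theorem anti_apply (S : P →ₐ[k] Pᵐᵒᵖ) (x : P) : anti S x = (S x).unop := rfl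

/-- If `S` is an anti-homomorphism, the antipode identity `m (S ⊗ id) Δ = ε` is compatible with
multiplication. -/
theorem left_mul (S : P →ₐ[k] Pᵐᵒᵖ) (u t : P ⊗[k] P) (c : k)
    (hu : LinearMap.mul' k P
      (((anti S).rTensor P) u)
        = algebraMap k P c) :
    LinearMap.mul' k P
      (((anti S).rTensor P) (u * t))
      = c • LinearMap.mul' k P
      (((anti S).rTensor P) t) := by
  induction t with
  | zero => simp
  | add x y hx hy => rw [mul_add, map_add, map_add, hx, hy, map_add, map_add, smul_add]
  | tmul a b =>
    have key : ∀ v : P ⊗[k] P, LinearMap.mul' k P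
        (((anti S).rTensor P)
          (v * (a ⊗ₜ[k] b)))
        = (S a).unop * LinearMap.mul' k P
        (((anti S).rTensor P) v) * b := by
      intro v
      induction v with
      | zero => simp
      | add x y hx hy =>
        rw [add_mul, map_add, map_add, hx, hy, map_add, map_add, mul_add, add_mul]
      | tmul x y => simp [mul_assoc]
    rw [key, hu]
    simp [Algebra.algebraMap_eq_smul_one]

/-- If `S` is an anti-homomorphism, the antipode identity `m (id ⊗ S) Δ = ε` is compatible with
multiplication. -/
theorem right_mul (S : P →ₐ[k] Pᵐᵒᵖ) (u t : P ⊗[k] P) (c : k)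
    (ht : LinearMap.mul' k P
      (((anti S).lTensor P) t)
        = algebraMap k P c) :
    LinearMap.mul' k P
      (((anti S).lTensor P) (u * t))
      = c • LinearMap.mul' k P
      (((anti S).lTensor P) u) := by
  induction u with
  | zero => simp
  | add x y hx hy => rw [add_mul, map_add, map_add, hx, hy, map_add, map_add, smul_add]
  | tmul a b =>
    have key : ∀ v : P ⊗[k] P, LinearMap.mul' k P
        (((anti S).lTensor P)
          ((a ⊗ₜ[k] b) * v))
        = a * LinearMap.mul' k P
        (((anti S).lTensor P) v)
          * (S b).unop := by
      intro v
      induction v with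
      | zero => simp
      | add x y hx hy =>
        rw [mul_add, map_add, map_add, hx, hy, map_add, map_add, mul_add, add_mul]
      | tmul x y => simp [mul_assoc]
    rw [key, ht]
    simp [Algebra.algebraMap_eq_smul_one]

/-- Two algebra maps that agree on generators are equal. -/
theorem ext_gen {B : Type*} [Ring B] [Algebra k B] {s : Set P} (hs : Algebra.adjoin k s = ⊤)
    {φ ψ : P →ₐ[k] B} (h : ∀ x ∈ s, φ x = ψ x) : φ = ψ :=
  AlgHom.ext_of_adjoin_eq_top hs h

/-- The Hopf algebra structure on an algebra `P` generated by `s` whose comultiplication `Δ` and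
counit `ε` are algebra maps and whose antipode `S` is an anti-homomorphism; the axioms need to be
checked on the generators only. -/
@[reducible] def mk (s : Set P) (hs : Algebra.adjoin k s = ⊤)
    (Δ : P →ₐ[k] P ⊗[k] P) (ε : P →ₐ[k] k) (S : P →ₐ[k] Pᵐᵒᵖ)
    (coassoc : ∀ x ∈ s, Algebra.TensorProduct.assoc k k k P P P
      (Algebra.TensorProduct.map Δ (.id k P) (Δ x))
        = Algebra.TensorProduct.map (.id k P) Δ (Δ x))
    (rT : ∀ x ∈ s, Algebra.TensorProduct.map ε (.id k P) (Δ x) = 1 ⊗ₜ x)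
    (lT : ∀ x ∈ s, Algebra.TensorProduct.map (.id k P) ε (Δ x) = x ⊗ₜ 1)
    (rS : ∀ x ∈ s, LinearMap.mul' k P
      (((anti S).rTensor P) (Δ x))
        = algebraMap k P (ε x))
    (lS : ∀ x ∈ s, LinearMap.mul' k P
      (((anti S).lTensor P) (Δ x))
        = algebraMap k P (ε x)) :
    HopfAlgebra k P :=
  letI B : Bialgebra k P := Bialgebra.ofAlgHom Δ ε
    (ext_gen hs coassoc) (ext_gen hs rT) (ext_gen hs lT)
  { B with
    antipode := anti S
    mul_antipode_rTensor_comul := by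
      ext x
      change LinearMap.mul' k P (((anti S).rTensor P) (Δ x)) = algebraMap k P (ε x)
      have hx : x ∈ Algebra.adjoin k s := hs ▸ Algebra.mem_top
      induction hx using Algebra.adjoin_induction with
      | mem x hx => exact rS x hx
      | algebraMap r => simp [Algebra.TensorProduct.one_def, Algebra.algebraMap_eq_smul_one]
      | add x y _ _ hx hy => rw [map_add, map_add, map_add, hx, hy, map_add, map_add]
      | mul x y _ _ hx hy =>
        rw [map_mul, left_mul S _ _ _ hx, hy, map_mul, map_mul, Algebra.smul_def]
    mul_antipode_lTensor_comul := by
      ext x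
      change LinearMap.mul' k P (((anti S).lTensor P) (Δ x)) = algebraMap k P (ε x)
      have hx : x ∈ Algebra.adjoin k s := hs ▸ Algebra.mem_top
      induction hx using Algebra.adjoin_induction with
      | mem x hx => exact lS x hx
      | algebraMap r => simp [Algebra.TensorProduct.one_def, Algebra.algebraMap_eq_smul_one]
      | add x y _ _ hx hy => rw [map_add, map_add, map_add, hx, hy, map_add, map_add]
      | mul x y _ _ hx hy =>
        rw [map_mul, right_mul S _ _ _ hy, hx, map_mul, map_mul, Algebra.smul_def, Algebra.commutes] }

/-- The generators of an algebra given by generators and relations generate it. -/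
theorem adjoin_ringQuot {gen : Type*} (r : FreeAlgebra k gen → FreeAlgebra k gen → Prop) :
    Algebra.adjoin k (Set.range fun x => RingQuot.mkAlgHom k r (FreeAlgebra.ι k x)) = ⊤ := by
  have h : (Set.range fun x => RingQuot.mkAlgHom k r (FreeAlgebra.ι k x))
      = RingQuot.mkAlgHom k r '' Set.range (FreeAlgebra.ι k (X := gen)) := by
    rw [← Set.range_comp]; rfl
  rw [h, ← AlgHom.map_adjoin, FreeAlgebra.adjoin_range_ι, Algebra.map_top,
    AlgHom.range_eq_top]
  exact RingQuot.mkAlgHom_surjective k r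

end

end HopfGen

namespace HopfGen

section

variable (k : Type*) [Field k] {B : Type*} [Ring B] [Algebra k B]

/-- The defining relations of the Sweedler algebra. -/
structure Rel4 (G X : B) : Prop where
  GG : G * G = 1
  XX : X * X = 0
  XG : X * G = -(G * X)

/-- The defining relations of the Kac-Paljutkin algebra. -/
structure Rel8 (g h z : B) : Prop where
  gg : g * g = 1
  hh : h * h = 1
  gh : g * h = h * g
  zz : z * z = (1 / 2 : k) • (1 + g + h - g * h)
  gz : g * z = z * h
  hz : h * z = z * g

/-- The element `J (z ⊗ z)` with `J = (1/2) (1 ⊗ 1 + g ⊗ 1 + 1 ⊗ h - g ⊗ h)`. -/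
def comulZ (g h z : B) : B ⊗[k] B :=
  ((1 / 2 : k) • ((1 : B) ⊗ₜ[k] (1 : B) + g ⊗ₜ[k] (1 : B) + (1 : B) ⊗ₜ[k] h - g ⊗ₜ[k] h))
    * (z ⊗ₜ[k] z)

/-- The element `X ⊗ G + 1 ⊗ X`. -/
def comulX (G X : B) : B ⊗[k] B := X ⊗ₜ[k] G + (1 : B) ⊗ₜ[k] X

variable {k}

theorem Rel4.comul {G X : B} (R : Rel4 G X) :
    Rel4 (G ⊗ₜ[k] G : B ⊗[k] B) (comulX k G X) := by
  obtain ⟨GG, XX, XG⟩ := R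
  constructor <;>
  (simp [comulX, mul_add, add_mul, GG, XX, XG, Algebra.TensorProduct.one_def,
    TensorProduct.neg_tmul, TensorProduct.tmul_neg]; try abel)

theorem Rel4.op {G X : B} (R : Rel4 G X) :
    Rel4 (MulOpposite.op G) (MulOpposite.op (G * X)) := by
  obtain ⟨GG, XX, XG⟩ := R
  constructor <;> simp only [← MulOpposite.op_mul, ← MulOpposite.op_one, ← MulOpposite.op_neg,
    ← MulOpposite.op_zero, MulOpposite.op_inj]
  · exact GG
  · rw [mul_assoc, ← mul_assoc X, XG, neg_mul, mul_assoc, XX]; simp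
  · rw [mul_assoc, XG]; simp

theorem Rel8.comul [CharZero k] {g h z : B} (R : Rel8 k g h z) :
    Rel8 k (g ⊗ₜ[k] g : B ⊗[k] B) (h ⊗ₜ[k] h) (comulZ k g h z) := by
  obtain ⟨gg, hh, gh, zz, gz, hz⟩ := R
  have gg2 : ∀ a, g * (g * a) = a := fun a => by rw [← mul_assoc, gg, one_mul]
  have hh2 : ∀ a, h * (h * a) = a := fun a => by rw [← mul_assoc, hh, one_mul]
  have hg2 : ∀ a, h * (g * a) = g * (h * a) := fun a => by rw [← mul_assoc, ← gh, mul_assoc]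
  have zg2 : ∀ a, z * (g * a) = h * (z * a) := fun a => by rw [← mul_assoc, ← hz, mul_assoc]
  have zh2 : ∀ a, z * (h * a) = g * (z * a) := fun a => by rw [← mul_assoc, ← gz, mul_assoc]
  constructor <;>
  simp [comulZ, mul_add, add_mul, mul_sub, sub_mul, gg, hh, ← gh, zz, ← gz, ← hz,
    gg2, hh2, hg2, zg2, zh2, mul_assoc, Algebra.TensorProduct.one_def,
    TensorProduct.add_tmul, TensorProduct.tmul_add,
    TensorProduct.sub_tmul, TensorProduct.tmul_sub, smul_add, smul_sub,
    ← TensorProduct.smul_tmul'] <;>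
  module

theorem Rel8.op {g h z : B} (R : Rel8 k g h z) :
    Rel8 k (MulOpposite.op g) (MulOpposite.op h) (MulOpposite.op z) := by
  obtain ⟨gg, hh, gh, zz, gz, hz⟩ := R
  constructor <;> simp only [← MulOpposite.op_mul, ← MulOpposite.op_one, ← MulOpposite.op_add,
    ← MulOpposite.op_sub, ← MulOpposite.op_smul, MulOpposite.op_inj]
  · exact gg
  · exact hh
  · exact gh.symm
  · rw [zz, gh]
  · exact hz.symm
  · exact gz.symm

end

end HopfGen

namespace HopfGen

section

variable (k : Type*) [Field k] {B : Type*} [Ring B] [Algebra k B]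

/-- The cross relations of the first 32-dimensional algebra. -/
structure RelA (g h z G X : B) : Prop where
  gG : g * G = G * g
  hG : h * G = G * h
  zG : z * G = G * z
  gX : g * X = X * g
  hX : h * X = X * h
  zX : z * X = -(X * z)

/-- The cross relations of the other two 32-dimensional algebras. -/
structure RelB (q : k) (g h z G X : B) : Prop where
  gG : g * G = G * g
  hG : h * G = G * h
  gzG : g * z * G = G * h * z
  gX : g * X = -(X * g)
  hX : h * X = -(X * h)
  zX : z * X = q • (X * g * z)

variable {k}

theorem RelA.comul {g h z G X : B} (R : RelA g h z G X) :
    RelA (g ⊗ₜ[k] g : B ⊗[k] B) (h ⊗ₜ[k] h) (comulZ k g h z) (G ⊗ₜ[k] G) (comulX k G X) := by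
  obtain ⟨gG, hG, zG, gX, hX, zX⟩ := R
  have gG2 : ∀ a, g * (G * a) = G * (g * a) := fun a => by rw [← mul_assoc, gG, mul_assoc]
  have hG2 : ∀ a, h * (G * a) = G * (h * a) := fun a => by rw [← mul_assoc, hG, mul_assoc]
  have zG2 : ∀ a, z * (G * a) = G * (z * a) := fun a => by rw [← mul_assoc, zG, mul_assoc]
  have gX2 : ∀ a, g * (X * a) = X * (g * a) := fun a => by rw [← mul_assoc, gX, mul_assoc]
  have hX2 : ∀ a, h * (X * a) = X * (h * a) := fun a => by rw [← mul_assoc, hX, mul_assoc]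
  have zX2 : ∀ a, z * (X * a) = -(X * (z * a)) :=
    fun a => by rw [← mul_assoc, zX, neg_mul, mul_assoc]
  constructor <;>
  simp [comulZ, comulX, mul_add, add_mul, mul_sub, sub_mul, gG, hG, zG, gX, hX, zX,
    gG2, hG2, zG2, gX2, hX2, zX2, mul_assoc, smul_add, smul_sub, TensorProduct.neg_tmul,
    TensorProduct.tmul_neg, ← TensorProduct.smul_tmul'] <;>
  module

theorem RelA.op {g h z G X : B} (R : RelA g h z G X) :
    RelA (MulOpposite.op g) (MulOpposite.op h) (MulOpposite.op z) (MulOpposite.op G)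
      (MulOpposite.op (G * X)) := by
  obtain ⟨gG, hG, zG, gX, hX, zX⟩ := R
  constructor <;> simp only [← MulOpposite.op_mul, ← MulOpposite.op_neg, MulOpposite.op_inj]
  · exact gG.symm
  · exact hG.symm
  · exact zG.symm
  · rw [mul_assoc, ← gX, ← mul_assoc, ← gG, mul_assoc]
  · rw [mul_assoc, ← hX, ← mul_assoc, ← hG, mul_assoc]
  · rw [← mul_assoc, zG, mul_assoc G z X, zX, mul_neg, neg_neg, mul_assoc]

theorem RelB.zG {q : k} {g h z G X : B} (R8 : Rel8 k g h z) (R : RelB k q g h z G X) :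
    z * G = G * (g * (h * z)) := by
  have := congrArg (g * ·) R.gzG
  simp only [mul_assoc] at this
  rw [← mul_assoc g g, R8.gg, one_mul, ← mul_assoc g G, R.gG] at this
  rw [this, mul_assoc]

theorem RelB.comul [CharZero k] {q : k} {g h z G X : B} (R8 : Rel8 k g h z)
    (R : RelB k q g h z G X) :
    RelB k q (g ⊗ₜ[k] g : B ⊗[k] B) (h ⊗ₜ[k] h) (comulZ k g h z) (G ⊗ₜ[k] G)
      (comulX k G X) := by
  have zG := R.zG R8
  obtain ⟨gg, hh, gh, zz, gz, hz⟩ := R8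
  obtain ⟨gG, hG, -, gX, hX, zX⟩ := R
  have gg2 : ∀ a, g * (g * a) = a := fun a => by rw [← mul_assoc, gg, one_mul]
  have hh2 : ∀ a, h * (h * a) = a := fun a => by rw [← mul_assoc, hh, one_mul]
  have hg2 : ∀ a, h * (g * a) = g * (h * a) := fun a => by rw [← mul_assoc, ← gh, mul_assoc]
  have zg2 : ∀ a, z * (g * a) = h * (z * a) := fun a => by rw [← mul_assoc, ← hz, mul_assoc]
  have zh2 : ∀ a, z * (h * a) = g * (z * a) := fun a => by rw [← mul_assoc, ← gz, mul_assoc]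
  have gG2 : ∀ a, g * (G * a) = G * (g * a) := fun a => by rw [← mul_assoc, gG, mul_assoc]
  have hG2 : ∀ a, h * (G * a) = G * (h * a) := fun a => by rw [← mul_assoc, hG, mul_assoc]
  have gX2 : ∀ a, g * (X * a) = -(X * (g * a)) :=
    fun a => by rw [← mul_assoc, gX, neg_mul, mul_assoc]
  have hX2 : ∀ a, h * (X * a) = -(X * (h * a)) :=
    fun a => by rw [← mul_assoc, hX, neg_mul, mul_assoc]
  rw [mul_assoc] at zX
  have zG2 : ∀ a, z * (G * a) = G * (g * (h * (z * a))) :=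
    fun a => by rw [← mul_assoc, zG]; simp only [mul_assoc]
  have zX2 : ∀ a, z * (X * a) = q • (X * (g * (z * a))) :=
    fun a => by rw [← mul_assoc, zX]; simp only [mul_assoc, smul_mul_assoc]
  constructor <;>
  simp [comulZ, comulX, mul_add, add_mul, mul_sub, sub_mul, gG, hG, zG, gX, hX, zX,
    gG2, hG2, zG2, gX2, hX2, zX2, gg, hh, ← gh, ← gz, ← hz,
    gg2, hh2, hg2, zg2, zh2, mul_assoc, smul_add, smul_sub,
    TensorProduct.neg_tmul, TensorProduct.tmul_neg, ← TensorProduct.smul_tmul'] <;>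
  module

/-- If `q ^ 2 ≠ -1`, the relations force `X = 0`. -/
theorem RelB.sq_smul [CharZero k] {q : k} {g h z G X : B} (R8 : Rel8 k g h z)
    (R : RelB k q g h z G X) : (1 + q ^ 2) • X = 0 := by
  obtain ⟨gg, hh, gh, zz, gz, hz⟩ := R8
  obtain ⟨gG, hG, -, gX, hX, zX⟩ := R
  have gg2 : ∀ a, g * (g * a) = a := fun a => by rw [← mul_assoc, gg, one_mul]
  have hh2 : ∀ a, h * (h * a) = a := fun a => by rw [← mul_assoc, hh, one_mul]
  have hg2 : ∀ a, h * (g * a) = g * (h * a) := fun a => by rw [← mul_assoc, ← gh, mul_assoc]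
  have zg2 : ∀ a, z * (g * a) = h * (z * a) := fun a => by rw [← mul_assoc, ← hz, mul_assoc]
  have gX2 : ∀ a, g * (X * a) = -(X * (g * a)) :=
    fun a => by rw [← mul_assoc, gX, neg_mul, mul_assoc]
  rw [mul_assoc] at zX
  have zX2 : ∀ a, z * (X * a) = q • (X * (g * (z * a))) :=
    fun a => by rw [← mul_assoc, zX]; simp only [mul_assoc, smul_mul_assoc]
  have e : z * (z * X) = (z * z) * X := (mul_assoc _ _ _).symm
  rw [zz, zX] at e
  simp [mul_add, add_mul, mul_sub, sub_mul, gX, hX, zX2, gX2, zg2, hg2, zz, gg, hh, ← gh,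
    gg2, hh2, mul_assoc] at e
  have e2 := congrArg (· * (1 - g - h - g * h)) e
  simp [mul_add, add_mul, mul_sub, sub_mul, gg2, hh2, hg2, gg, hh, ← gh, mul_assoc] at e2
  have e3 := congrArg ((-1 / 2 : k) • ·) (sub_eq_zero.mpr e2)
  simp only [smul_zero] at e3
  rw [← e3]
  module

theorem RelB.op [CharZero k] {q : k} {g h z G X : B} (R8 : Rel8 k g h z)
    (R : RelB k q g h z G X) :
    RelB k q (MulOpposite.op g) (MulOpposite.op h) (MulOpposite.op z) (MulOpposite.op G)
      (MulOpposite.op (G * X)) := by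
  have hq := R.sq_smul R8
  have zG := R.zG R8
  obtain ⟨gg, hh, gh, zz, gz, hz⟩ := R8
  obtain ⟨gG, hG, gzG, gX, hX, zX⟩ := R
  constructor <;> simp only [← MulOpposite.op_mul, ← MulOpposite.op_neg, ← MulOpposite.op_smul,
    MulOpposite.op_inj]
  · exact gG.symm
  · exact hG.symm
  · rw [← hz, ← mul_assoc z h, ← gz, gzG, mul_assoc]
  · rw [← mul_assoc, gG, mul_assoc G g X, gX, mul_neg, neg_neg, mul_assoc]
  · rw [← mul_assoc, hG, mul_assoc G h X, hX, mul_neg, neg_neg, mul_assoc]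
  · have gg2 : ∀ a, g * (g * a) = a := fun a => by rw [← mul_assoc, gg, one_mul]
    have hh2 : ∀ a, h * (h * a) = a := fun a => by rw [← mul_assoc, hh, one_mul]
    have hg2 : ∀ a, h * (g * a) = g * (h * a) := fun a => by rw [← mul_assoc, ← gh, mul_assoc]
    have hX2 : ∀ a, h * (X * a) = -(X * (h * a)) :=
      fun a => by rw [← mul_assoc, hX, neg_mul, mul_assoc]
    have gX2 : ∀ a, g * (X * a) = -(X * (g * a)) :=
      fun a => by rw [← mul_assoc, gX, neg_mul, mul_assoc]
    have hG2 : ∀ a, h * (G * a) = G * (h * a) := fun a => by rw [← mul_assoc, hG, mul_assoc]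
    have e : z * (g * (G * X)) = -(q • (G * (X * z))) := by
      rw [← mul_assoc z g, ← hz, mul_assoc h z, ← mul_assoc z G, zG]
      simp only [mul_assoc]
      rw [zX]
      simp [mul_assoc, hG2, hX2, gX2, gg2, hh2, hg2]
    rw [e]
    have hX' : X = -(q ^ 2 • X) := by
      rw [add_smul, one_smul] at hq
      exact eq_neg_of_add_eq_zero_left hq
    conv_lhs => rw [hX']
    simp [pow_two, mul_smul, mul_assoc]

end

end HopfGen

namespace HopfGen

section

variable {k : Type*} [Field k] {P : Type*} [Ring P] [Algebra k P]

/-- The Hopf algebra axioms on one generator `x`, for given algebra maps `Δ`, `ε` and a given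
anti-homomorphism `S`. -/
structure Ax (Δ : P →ₐ[k] P ⊗[k] P) (ε : P →ₐ[k] k) (S : P →ₐ[k] Pᵐᵒᵖ) (x : P) : Prop where
  coassoc : Algebra.TensorProduct.assoc k k k P P P
      (Algebra.TensorProduct.map Δ (.id k P) (Δ x)) = Algebra.TensorProduct.map (.id k P) Δ (Δ x)
  rT : Algebra.TensorProduct.map ε (.id k P) (Δ x) = 1 ⊗ₜ x
  lT : Algebra.TensorProduct.map (.id k P) ε (Δ x) = x ⊗ₜ 1
  rS : LinearMap.mul' k P
      (((anti S).rTensor P) (Δ x))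
        = algebraMap k P (ε x)
  lS : LinearMap.mul' k P
      (((anti S).lTensor P) (Δ x))
        = algebraMap k P (ε x)

theorem ax_groupLike {Δ : P →ₐ[k] P ⊗[k] P} {ε : P →ₐ[k] k} {S : P →ₐ[k] Pᵐᵒᵖ} {x : P}
    (hΔ : Δ x = x ⊗ₜ x) (hε : ε x = 1) (hS : S x = MulOpposite.op x) (hx : x * x = 1) :
    Ax Δ ε S x := by
  constructor <;> simp [hΔ, hε, hS, hx]

theorem ax_X {Δ : P →ₐ[k] P ⊗[k] P} {ε : P →ₐ[k] k} {S : P →ₐ[k] Pᵐᵒᵖ} {G X : P}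
    (R : Rel4 G X) (hG : Δ G = G ⊗ₜ G) (hGε : ε G = 1) (hGS : S G = MulOpposite.op G)
    (hX : Δ X = comulX k G X) (hXε : ε X = 0) (hXS : S X = MulOpposite.op (G * X)) :
    Ax Δ ε S X := by
  obtain ⟨GG, XX, XG⟩ := R
  have GG2 : ∀ a, G * (G * a) = a := fun a => by rw [← mul_assoc, GG, one_mul]
  constructor <;>
  simp [hX, comulX, hG, hGε, hGS, hXε, hXS, XG, GG, GG2, mul_assoc, TensorProduct.add_tmul,
    TensorProduct.tmul_add, add_assoc, Algebra.TensorProduct.one_def]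

theorem ax_z [CharZero k] {Δ : P →ₐ[k] P ⊗[k] P} {ε : P →ₐ[k] k} {S : P →ₐ[k] Pᵐᵒᵖ} {g h z : P}
    (R : Rel8 k g h z) (hg : Δ g = g ⊗ₜ g) (hgε : ε g = 1) (hgS : S g = MulOpposite.op g)
    (hh : Δ h = h ⊗ₜ h) (hhε : ε h = 1) (hhS : S h = MulOpposite.op h)
    (hz : Δ z = comulZ k g h z) (hzε : ε z = 1) (hzS : S z = MulOpposite.op z) :
    Ax Δ ε S z := by
  obtain ⟨gg, hh', gh, zz, gz, hz'⟩ := R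
  have gg2 : ∀ a, g * (g * a) = a := fun a => by rw [← mul_assoc, gg, one_mul]
  have hh2 : ∀ a, h * (h * a) = a := fun a => by rw [← mul_assoc, hh', one_mul]
  have hg2 : ∀ a, h * (g * a) = g * (h * a) := fun a => by rw [← mul_assoc, ← gh, mul_assoc]
  have zg2 : ∀ a, z * (g * a) = h * (z * a) := fun a => by rw [← mul_assoc, ← hz', mul_assoc]
  have zh2 : ∀ a, z * (h * a) = g * (z * a) := fun a => by rw [← mul_assoc, ← gz, mul_assoc]
  constructor <;>
  simp [hz, comulZ, hg, hh, hgε, hgS, hhε, hhS, hzε, hzS, mul_add, add_mul, mul_sub, sub_mul,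
    gg, hh', ← gh, zz, ← gz, ← hz', gg2, hh2, hg2, zg2, zh2, mul_assoc,
    Algebra.TensorProduct.one_def, TensorProduct.add_tmul, TensorProduct.tmul_add,
    TensorProduct.sub_tmul, TensorProduct.tmul_sub, smul_add, smul_sub,
    ← TensorProduct.smul_tmul', Algebra.algebraMap_eq_smul_one] <;>
  module

/-- The Hopf algebra structure determined by its values on a generating family. -/
@[reducible] def mkGen {gen : Type*} (r : FreeAlgebra k gen → FreeAlgebra k gen → Prop)
    (Δ : RingQuot r →ₐ[k] RingQuot r ⊗[k] RingQuot r) (ε : RingQuot r →ₐ[k] k)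
    (S : RingQuot r →ₐ[k] (RingQuot r)ᵐᵒᵖ)
    (h : ∀ x, Ax Δ ε S (RingQuot.mkAlgHom k r (FreeAlgebra.ι k x))) :
    HopfAlgebra k (RingQuot r) :=
  mk _ (adjoin_ringQuot r) Δ ε S
    (by rintro _ ⟨x, rfl⟩; exact (h x).coassoc) (by rintro _ ⟨x, rfl⟩; exact (h x).rT)
    (by rintro _ ⟨x, rfl⟩; exact (h x).lT) (by rintro _ ⟨x, rfl⟩; exact (h x).rS)
    (by rintro _ ⟨x, rfl⟩; exact (h x).lS)

end

end HopfGen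

/-! ## Sweedler's Hopf algebra -/

namespace H4

/-- The generators of Sweedler's Hopf algebra. -/
inductive Gen : Type
  | G
  | X

open FreeAlgebra Gen in
/-- `G ^ 2 = 1`, `X ^ 2 = 0`, `X G = - G X`. -/
inductive Rel (k : Type*) [Field k] : FreeAlgebra k Gen → FreeAlgebra k Gen → Prop
  | GG : Rel k (ι k G * ι k G) 1
  | XX : Rel k (ι k X * ι k X) 0
  | XG : Rel k (ι k X * ι k G) (-(ι k G * ι k X))

/-- The canonical generators of the quotient of the free algebra. -/
def gen (k : Type*) [Field k] (x : Gen) : RingQuot (Rel k) :=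
  RingQuot.mkAlgHom k (Rel k) (FreeAlgebra.ι k x)

theorem rel4 (k : Type*) [Field k] : HopfGen.Rel4 (gen k .G) (gen k .X) := by
  constructor
  · simpa [gen] using RingQuot.mkAlgHom_rel k (Rel.GG (k := k))
  · simpa [gen] using RingQuot.mkAlgHom_rel k (Rel.XX (k := k))
  · simpa [gen] using RingQuot.mkAlgHom_rel k (Rel.XG (k := k))

/-- The algebra map out of the algebra given by generators and relations. -/
def lift (k : Type*) [Field k] {B : Type*} [Ring B] [Algebra k B] (f : Gen → B)
    (R4 : HopfGen.Rel4 (f .G) (f .X)) : RingQuot (Rel k) →ₐ[k] B :=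
  RingQuot.liftAlgHom k ⟨FreeAlgebra.lift k f, by
    intro a b hab
    cases hab
    · simpa using R4.GG
    · simpa using R4.XX
    · simpa using R4.XG⟩

theorem lift_gen (k : Type*) [Field k] {B : Type*} [Ring B] [Algebra k B] (f : Gen → B)
    (R4 : HopfGen.Rel4 (f .G) (f .X)) (x : Gen) : lift k f R4 (gen k x) = f x := by
  simp [lift, gen, RingQuot.liftAlgHom_mkAlgHom_apply]

/-- `Δ(G) = G ⊗ G`, `Δ(X) = X ⊗ G + 1 ⊗ X`. -/
def comulGen (k : Type*) [Field k] : Gen → RingQuot (Rel k) ⊗[k] RingQuot (Rel k)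
  | .G => gen k .G ⊗ₜ gen k .G
  | .X => gen k .X ⊗ₜ gen k .G + 1 ⊗ₜ gen k .X

/-- `ε(G) = 1`, `ε(X) = 0`. -/
def counitGen (k : Type*) [Field k] : Gen → k
  | .G => 1
  | .X => 0

/-- `S(G) = G`, `S(X) = G X`. -/
def antipodeGen (k : Type*) [Field k] : Gen → (RingQuot (Rel k))ᵐᵒᵖ
  | .G => MulOpposite.op (gen k .G)
  | .X => MulOpposite.op (gen k .G * gen k .X)

theorem rel4_counit (k : Type*) [Field k] :
    HopfGen.Rel4 (counitGen k .G) (counitGen k .X) := by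
  constructor <;> simp [counitGen]

/-- The Hopf algebra structure of Sweedler's Hopf algebra. -/
@[reducible] def hopf (k : Type*) [Field k] : HopfAlgebra k (RingQuot (Rel k)) :=
  HopfGen.mkGen (Rel k)
    (lift k (comulGen k) (rel4 k).comul)
    (lift k (counitGen k) (rel4_counit k))
    (lift k (antipodeGen k) (rel4 k).op)
    (by
      rintro (_ | _)
      · exact HopfGen.ax_groupLike (lift_gen ..) (lift_gen ..) (lift_gen ..) (rel4 k).GG
      · apply HopfGen.ax_X (rel4 k) <;> apply lift_gen)

end H4

/-- Sweedler's Hopf algebra: generated by `G`, `X` with `G ^ 2 = 1`, `X ^ 2 = 0`, `X G = - G X`;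
`Δ(G) = G ⊗ G`, `Δ(X) = X ⊗ G + 1 ⊗ X`, `ε(G) = 1`, `ε(X) = 0`, `S(G) = G`, `S(X) = G X`. -/
def H4 (k : Type*) [Field k] : Type _ := RingQuot (H4.Rel k)

instance (k : Type*) [Field k] : Ring (H4 k) := inferInstanceAs (Ring (RingQuot (H4.Rel k)))

instance (k : Type*) [Field k] : HopfAlgebra k (H4 k) := H4.hopf k

namespace H4

/-- The generator `G`. -/
def G (k : Type*) [Field k] : H4 k := gen k .G

/-- The generator `X`. -/
def X (k : Type*) [Field k] : H4 k := gen k .X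

theorem comul_G (k : Type*) [Field k] : Coalgebra.comul (R := k) (G k) = G k ⊗ₜ G k :=
  lift_gen _ _ _ _

theorem comul_X (k : Type*) [Field k] :
    Coalgebra.comul (R := k) (X k) = X k ⊗ₜ G k + 1 ⊗ₜ X k :=
  lift_gen _ _ _ _

theorem antipode_X (k : Type*) [Field k] : HopfAlgebra.antipode k (X k) = G k * X k :=
  congrArg MulOpposite.unop (lift_gen k (antipodeGen k) (rel4 k).op .X)

end H4

/-! ## The Kac-Paljutkin Hopf algebra -/

namespace H8

/-- The generators. -/
inductive Gen : Type
  | g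
  | h
  | z

open FreeAlgebra Gen in
/-- The defining relations. -/
inductive Rel (k : Type*) [Field k] : FreeAlgebra k Gen → FreeAlgebra k Gen → Prop
  | gg : Rel k (ι k g * ι k g) (1)
  | hh : Rel k (ι k h * ι k h) (1)
  | gh : Rel k (ι k g * ι k h) (ι k h * ι k g)
  | zz : Rel k (ι k z * ι k z) ((1 / 2 : k) • (1 + ι k g + ι k h - ι k g * ι k h))
  | gz : Rel k (ι k g * ι k z) (ι k z * ι k h)
  | hz : Rel k (ι k h * ι k z) (ι k z * ι k g)

/-- The canonical generators of the quotient of the free algebra. -/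
def gen (k : Type*) [Field k] (x : Gen) : RingQuot (Rel k) :=
  RingQuot.mkAlgHom k (Rel k) (FreeAlgebra.ι k x)

theorem rel8 (k : Type*) [Field k] :
    HopfGen.Rel8 k (gen k .g) (gen k .h) (gen k .z) := by
  constructor
  · simpa [gen] using RingQuot.mkAlgHom_rel k (Rel.gg (k := k))
  · simpa [gen] using RingQuot.mkAlgHom_rel k (Rel.hh (k := k))
  · simpa [gen] using RingQuot.mkAlgHom_rel k (Rel.gh (k := k))
  · simpa [gen] using RingQuot.mkAlgHom_rel k (Rel.zz (k := k))
  · simpa [gen] using RingQuot.mkAlgHom_rel k (Rel.gz (k := k))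
  · simpa [gen] using RingQuot.mkAlgHom_rel k (Rel.hz (k := k))

/-- The algebra map out of the algebra given by generators and relations. -/
def lift (k : Type*) [Field k] {B : Type*} [Ring B] [Algebra k B] (f : Gen → B)
    (R8 : HopfGen.Rel8 k (f .g) (f .h) (f .z)) :
    RingQuot (Rel k) →ₐ[k] B :=
  RingQuot.liftAlgHom k ⟨FreeAlgebra.lift k f, by
    intro a b hab
    cases hab
    · simpa using R8.gg
    · simpa using R8.hh
    · simpa using R8.gh
    · simpa using R8.zz
    · simpa using R8.gz
    · simpa using R8.hz⟩

theorem lift_gen (k : Type*) [Field k] {B : Type*} [Ring B] [Algebra k B] (f : Gen → B)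
    (R8 : HopfGen.Rel8 k (f .g) (f .h) (f .z)) (x : Gen) :
    lift k f R8 (gen k x) = f x := by
  simp [lift, gen, RingQuot.liftAlgHom_mkAlgHom_apply]

/-- `Δ(g) = g ⊗ g`, `Δ(h) = h ⊗ h`, `Δ(z) = J (z ⊗ z)` with
`J = (1/2) (1 ⊗ 1 + g ⊗ 1 + 1 ⊗ h - g ⊗ h)`. -/
def comulGen (k : Type*) [Field k] :
    Gen → RingQuot (Rel k) ⊗[k] RingQuot (Rel k)
  | .g => gen k .g ⊗ₜ gen k .g
  | .h => gen k .h ⊗ₜ gen k .h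
  | .z => ((1 / 2 : k) • (1 ⊗ₜ 1 + gen k .g ⊗ₜ 1 + 1 ⊗ₜ gen k .h - gen k .g ⊗ₜ gen k .h))
      * (gen k .z ⊗ₜ gen k .z)

/-- `ε(g) = ε(h) = ε(z) = 1`. -/
def counitGen (k : Type*) [Field k] : Gen → k
  | .g => 1
  | .h => 1
  | .z => 1

/-- `S(g) = g`, `S(h) = h`, `S(z) = z`. -/
def antipodeGen (k : Type*) [Field k] : Gen → (RingQuot (Rel k))ᵐᵒᵖ
  | .g => MulOpposite.op (gen k .g)
  | .h => MulOpposite.op (gen k .h)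
  | .z => MulOpposite.op (gen k .z)

theorem rel8_counit (k : Type*) [Field k] [CharZero k] :
    HopfGen.Rel8 k (counitGen k .g) (counitGen k .h) (counitGen k .z) := by
  constructor <;> simp [counitGen] <;> norm_num

/-- The Hopf algebra structure. -/
@[reducible] def hopf (k : Type*) [Field k] [CharZero k] : HopfAlgebra k (RingQuot (Rel k)) :=
  HopfGen.mkGen (Rel k)
    (lift k (comulGen k) (rel8 k).comul)
    (lift k (counitGen k) (rel8_counit k))
    (lift k (antipodeGen k) (rel8 k).op)
    (by
      rintro (_ | _ | _)
      · exact HopfGen.ax_groupLike (lift_gen ..) (lift_gen ..) (lift_gen ..) (rel8 k).gg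
      · exact HopfGen.ax_groupLike (lift_gen ..) (lift_gen ..) (lift_gen ..) (rel8 k).hh
      · apply HopfGen.ax_z (rel8 k) <;> apply lift_gen)

end H8

/-- The Kac-Paljutkin Hopf algebra: generated by `g`, `h`, `z` with `g ^ 2 = h ^ 2 = 1`, `g h = h g`,
`z ^ 2 = (1/2) (1 + g + h - g h)`, `g z = z h`, `h z = z g`; `g` and `h` are group-like,
`Δ(z) = J (z ⊗ z)` with `J = (1/2) (1 ⊗ 1 + g ⊗ 1 + 1 ⊗ h - g ⊗ h)`, `ε(z) = 1`, and the antipode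
fixes `g`, `h` and `z`. -/
def H8 (k : Type*) [Field k] : Type _ := RingQuot (H8.Rel k)

instance (k : Type*) [Field k] : Ring (H8 k) :=
  inferInstanceAs (Ring (RingQuot (H8.Rel k)))

instance (k : Type*) [Field k] [CharZero k] : HopfAlgebra k (H8 k) := H8.hopf k

namespace H8

/-- The generator `g`. -/
def g (k : Type*) [Field k] : H8 k := gen k .g

/-- The generator `h`. -/
def h (k : Type*) [Field k] : H8 k := gen k .h

/-- The generator `z`. -/
def z (k : Type*) [Field k] : H8 k := gen k .z

theorem comul_z (k : Type*) [Field k] [CharZero k] :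
    Coalgebra.comul (R := k) (z k)
      = ((1 / 2 : k) • ((1 : H8 k) ⊗ₜ[k] (1 : H8 k) + g k ⊗ₜ 1 + 1 ⊗ₜ h k
          - g k ⊗ₜ h k)) * (z k ⊗ₜ z k) :=
  lift_gen _ _ _ _

end H8

/-! ## The first 32-dimensional Hopf algebra -/

namespace H32A

/-- The generators. -/
inductive Gen : Type
  | g
  | h
  | z
  | G
  | X

open FreeAlgebra Gen in
/-- The relations of `H8`, those of `H4`, and the cross relations. -/
inductive Rel (k : Type*) [Field k] : FreeAlgebra k Gen → FreeAlgebra k Gen → Prop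
  | gg : Rel k (ι k g * ι k g) (1)
  | hh : Rel k (ι k h * ι k h) (1)
  | gh : Rel k (ι k g * ι k h) (ι k h * ι k g)
  | zz : Rel k (ι k z * ι k z) ((1 / 2 : k) • (1 + ι k g + ι k h - ι k g * ι k h))
  | gz : Rel k (ι k g * ι k z) (ι k z * ι k h)
  | hz : Rel k (ι k h * ι k z) (ι k z * ι k g)
  | GG : Rel k (ι k G * ι k G) (1)
  | XX : Rel k (ι k X * ι k X) (0)
  | XG : Rel k (ι k G * ι k X) (-(ι k X * ι k G))
  | gG : Rel k (ι k g * ι k G) (ι k G * ι k g)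
  | hG : Rel k (ι k h * ι k G) (ι k G * ι k h)
  | zG : Rel k (ι k z * ι k G) (ι k G * ι k z)
  | gX : Rel k (ι k g * ι k X) (ι k X * ι k g)
  | hX : Rel k (ι k h * ι k X) (ι k X * ι k h)
  | zX : Rel k (ι k z * ι k X) (-(ι k X * ι k z))

/-- The canonical generators of the quotient of the free algebra. -/
def gen (k : Type*) [Field k] (x : Gen) : RingQuot (Rel k) :=
  RingQuot.mkAlgHom k (Rel k) (FreeAlgebra.ι k x)

theorem rel8 (k : Type*) [Field k] :
    HopfGen.Rel8 k (gen k .g) (gen k .h) (gen k .z) := by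
  constructor
  · simpa [gen] using RingQuot.mkAlgHom_rel k (Rel.gg (k := k))
  · simpa [gen] using RingQuot.mkAlgHom_rel k (Rel.hh (k := k))
  · simpa [gen] using RingQuot.mkAlgHom_rel k (Rel.gh (k := k))
  · simpa [gen] using RingQuot.mkAlgHom_rel k (Rel.zz (k := k))
  · simpa [gen] using RingQuot.mkAlgHom_rel k (Rel.gz (k := k))
  · simpa [gen] using RingQuot.mkAlgHom_rel k (Rel.hz (k := k))

theorem rel4 (k : Type*) [Field k] :
    HopfGen.Rel4 (gen k .G) (gen k .X) := by
  constructor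
  · simpa [gen] using RingQuot.mkAlgHom_rel k (Rel.GG (k := k))
  · simpa [gen] using RingQuot.mkAlgHom_rel k (Rel.XX (k := k))
  · have := RingQuot.mkAlgHom_rel k (Rel.XG (k := k))
    simp only [map_mul, map_neg] at this
    exact (neg_eq_iff_eq_neg.mpr this).symm

theorem relC (k : Type*) [Field k] :
    HopfGen.RelA (gen k .g) (gen k .h) (gen k .z) (gen k .G) (gen k .X) := by
  constructor
  · simpa [gen] using RingQuot.mkAlgHom_rel k (Rel.gG (k := k))
  · simpa [gen] using RingQuot.mkAlgHom_rel k (Rel.hG (k := k))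
  · simpa [gen] using RingQuot.mkAlgHom_rel k (Rel.zG (k := k))
  · simpa [gen] using RingQuot.mkAlgHom_rel k (Rel.gX (k := k))
  · simpa [gen] using RingQuot.mkAlgHom_rel k (Rel.hX (k := k))
  · simpa [gen] using RingQuot.mkAlgHom_rel k (Rel.zX (k := k))

/-- The algebra map out of the algebra given by generators and relations. -/
def lift (k : Type*) [Field k] {B : Type*} [Ring B] [Algebra k B] (f : Gen → B)
    (R8 : HopfGen.Rel8 k (f .g) (f .h) (f .z))
    (R4 : HopfGen.Rel4 (f .G) (f .X))
    (RC : HopfGen.RelA (f .g) (f .h) (f .z) (f .G) (f .X)) :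
    RingQuot (Rel k) →ₐ[k] B :=
  RingQuot.liftAlgHom k ⟨FreeAlgebra.lift k f, by
    intro a b hab
    cases hab
    · simpa using R8.gg
    · simpa using R8.hh
    · simpa using R8.gh
    · simpa using R8.zz
    · simpa using R8.gz
    · simpa using R8.hz
    · simpa using R4.GG
    · simpa using R4.XX
    · simpa using (neg_eq_iff_eq_neg.mpr R4.XG).symm
    · simpa using RC.gG
    · simpa using RC.hG
    · simpa using RC.zG
    · simpa using RC.gX
    · simpa using RC.hX
    · simpa using RC.zX⟩

theorem lift_gen (k : Type*) [Field k] {B : Type*} [Ring B] [Algebra k B] (f : Gen → B)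
    (R8 : HopfGen.Rel8 k (f .g) (f .h) (f .z))
    (R4 : HopfGen.Rel4 (f .G) (f .X))
    (RC : HopfGen.RelA (f .g) (f .h) (f .z) (f .G) (f .X)) (x : Gen) :
    lift k f R8 R4 RC (gen k x) = f x := by
  simp [lift, gen, RingQuot.liftAlgHom_mkAlgHom_apply]

/-- `Δ(g) = g ⊗ g`, `Δ(h) = h ⊗ h`, `Δ(z) = J (z ⊗ z)` with
`J = (1/2) (1 ⊗ 1 + g ⊗ 1 + 1 ⊗ h - g ⊗ h)`, `Δ(G) = G ⊗ G`, `Δ(X) = X ⊗ G + 1 ⊗ X`. -/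
def comulGen (k : Type*) [Field k] :
    Gen → RingQuot (Rel k) ⊗[k] RingQuot (Rel k)
  | .g => gen k .g ⊗ₜ gen k .g
  | .h => gen k .h ⊗ₜ gen k .h
  | .z => ((1 / 2 : k) • (1 ⊗ₜ 1 + gen k .g ⊗ₜ 1 + 1 ⊗ₜ gen k .h - gen k .g ⊗ₜ gen k .h))
      * (gen k .z ⊗ₜ gen k .z)
  | .G => gen k .G ⊗ₜ gen k .G
  | .X => gen k .X ⊗ₜ gen k .G + 1 ⊗ₜ gen k .X

/-- `ε(g) = ε(h) = ε(z) = 1`, `ε(G) = 1`, `ε(X) = 0`. -/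
def counitGen (k : Type*) [Field k] : Gen → k
  | .g => 1
  | .h => 1
  | .z => 1
  | .G => 1
  | .X => 0

/-- `S(g) = g`, `S(h) = h`, `S(z) = z`, `S(G) = G`, `S(X) = G X`. -/
def antipodeGen (k : Type*) [Field k] : Gen → (RingQuot (Rel k))ᵐᵒᵖ
  | .g => MulOpposite.op (gen k .g)
  | .h => MulOpposite.op (gen k .h)
  | .z => MulOpposite.op (gen k .z)
  | .G => MulOpposite.op (gen k .G)
  | .X => MulOpposite.op (gen k .G * gen k .X)

theorem rel8_counit (k : Type*) [Field k] [CharZero k] :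
    HopfGen.Rel8 k (counitGen k .g) (counitGen k .h) (counitGen k .z) := by
  constructor <;> simp [counitGen] <;> norm_num

theorem rel4_counit (k : Type*) [Field k] :
    HopfGen.Rel4 (counitGen k .G) (counitGen k .X) := by
  constructor <;> simp [counitGen]

theorem relC_counit (k : Type*) [Field k] :
    HopfGen.RelA (counitGen k .g) (counitGen k .h) (counitGen k .z) (counitGen k .G) (counitGen k .X) := by
  constructor <;> simp [counitGen]

/-- The Hopf algebra structure. -/
@[reducible] def hopf (k : Type*) [Field k] [CharZero k] : HopfAlgebra k (RingQuot (Rel k)) :=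
  HopfGen.mkGen (Rel k)
    (lift k (comulGen k) (rel8 k).comul (rel4 k).comul (relC k).comul)
    (lift k (counitGen k) (rel8_counit k) (rel4_counit k) (relC_counit k))
    (lift k (antipodeGen k) (rel8 k).op (rel4 k).op (relC k).op)
    (by
      rintro (_ | _ | _ | _ | _)
      · exact HopfGen.ax_groupLike (lift_gen ..) (lift_gen ..) (lift_gen ..) (rel8 k).gg
      · exact HopfGen.ax_groupLike (lift_gen ..) (lift_gen ..) (lift_gen ..) (rel8 k).hh
      · apply HopfGen.ax_z (rel8 k) <;> apply lift_gen
      · exact HopfGen.ax_groupLike (lift_gen ..) (lift_gen ..) (lift_gen ..) (rel4 k).GG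
      · apply HopfGen.ax_X (rel4 k) <;> apply lift_gen)

end H32A

/-- The Hopf algebra `H_{32,1}`: generated by `g`, `h`, `z`, `G`, `X` with the relations of `H8`
and of `H4` and `g G = G g`, `h G = G h`, `z G = G z`, `g X = X g`, `h X = X h`, `z X = - X z`;
the comultiplication, counit and antipode are those of `H8` and `H4` on the generators. -/
def H32A (k : Type*) [Field k] : Type _ := RingQuot (H32A.Rel k)

instance (k : Type*) [Field k] : Ring (H32A k) :=
  inferInstanceAs (Ring (RingQuot (H32A.Rel k)))

instance (k : Type*) [Field k] [CharZero k] : HopfAlgebra k (H32A k) := H32A.hopf k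

namespace H32A

/-- The generator `g`. -/
def g (k : Type*) [Field k] : H32A k := gen k .g

/-- The generator `h`. -/
def h (k : Type*) [Field k] : H32A k := gen k .h

/-- The generator `z`. -/
def z (k : Type*) [Field k] : H32A k := gen k .z

/-- The generator `G`. -/
def G (k : Type*) [Field k] : H32A k := gen k .G

/-- The generator `X`. -/
def X (k : Type*) [Field k] : H32A k := gen k .X

theorem comul_z (k : Type*) [Field k] [CharZero k] :
    Coalgebra.comul (R := k) (z k)
      = ((1 / 2 : k) • ((1 : H32A k) ⊗ₜ[k] (1 : H32A k) + g k ⊗ₜ 1 + 1 ⊗ₜ h k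
          - g k ⊗ₜ h k)) * (z k ⊗ₜ z k) :=
  lift_gen _ _ _ _ _ _

end H32A

/-! ## The other two 32-dimensional Hopf algebras -/

namespace H32B

/-- The generators. -/
inductive Gen : Type
  | g
  | h
  | z
  | G
  | X

open FreeAlgebra Gen in
/-- The relations of `H8`, those of `H4`, and the cross relations with the parameter `q`. -/
inductive Rel (k : Type*) [Field k] (q : k) : FreeAlgebra k Gen → FreeAlgebra k Gen → Prop
  | gg : Rel k q (ι k g * ι k g) (1)
  | hh : Rel k q (ι k h * ι k h) (1)
  | gh : Rel k q (ι k g * ι k h) (ι k h * ι k g)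
  | zz : Rel k q (ι k z * ι k z) ((1 / 2 : k) • (1 + ι k g + ι k h - ι k g * ι k h))
  | gz : Rel k q (ι k g * ι k z) (ι k z * ι k h)
  | hz : Rel k q (ι k h * ι k z) (ι k z * ι k g)
  | GG : Rel k q (ι k G * ι k G) (1)
  | XX : Rel k q (ι k X * ι k X) (0)
  | XG : Rel k q (ι k G * ι k X) (-(ι k X * ι k G))
  | gG : Rel k q (ι k g * ι k G) (ι k G * ι k g)
  | hG : Rel k q (ι k h * ι k G) (ι k G * ι k h)
  | gzG : Rel k q (ι k g * ι k z * ι k G) (ι k G * ι k h * ι k z)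
  | gX : Rel k q (ι k g * ι k X) (-(ι k X * ι k g))
  | hX : Rel k q (ι k h * ι k X) (-(ι k X * ι k h))
  | zX : Rel k q (ι k z * ι k X) (q • (ι k X * ι k g * ι k z))

/-- The canonical generators of the quotient of the free algebra. -/
def gen (k : Type*) [Field k] (q : k) (x : Gen) : RingQuot (Rel k q) :=
  RingQuot.mkAlgHom k (Rel k q) (FreeAlgebra.ι k x)

theorem rel8 (k : Type*) [Field k] (q : k) :
    HopfGen.Rel8 k (gen k q .g) (gen k q .h) (gen k q .z) := by
  constructor
  · simpa [gen] using RingQuot.mkAlgHom_rel k (Rel.gg (k := k) (q := q))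
  · simpa [gen] using RingQuot.mkAlgHom_rel k (Rel.hh (k := k) (q := q))
  · simpa [gen] using RingQuot.mkAlgHom_rel k (Rel.gh (k := k) (q := q))
  · simpa [gen] using RingQuot.mkAlgHom_rel k (Rel.zz (k := k) (q := q))
  · simpa [gen] using RingQuot.mkAlgHom_rel k (Rel.gz (k := k) (q := q))
  · simpa [gen] using RingQuot.mkAlgHom_rel k (Rel.hz (k := k) (q := q))

theorem rel4 (k : Type*) [Field k] (q : k) :
    HopfGen.Rel4 (gen k q .G) (gen k q .X) := by
  constructor
  · simpa [gen] using RingQuot.mkAlgHom_rel k (Rel.GG (k := k) (q := q))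
  · simpa [gen] using RingQuot.mkAlgHom_rel k (Rel.XX (k := k) (q := q))
  · have := RingQuot.mkAlgHom_rel k (Rel.XG (k := k) (q := q))
    simp only [map_mul, map_neg] at this
    exact (neg_eq_iff_eq_neg.mpr this).symm

theorem relC (k : Type*) [Field k] (q : k) :
    HopfGen.RelB k q (gen k q .g) (gen k q .h) (gen k q .z) (gen k q .G) (gen k q .X) := by
  constructor
  · simpa [gen] using RingQuot.mkAlgHom_rel k (Rel.gG (k := k) (q := q))
  · simpa [gen] using RingQuot.mkAlgHom_rel k (Rel.hG (k := k) (q := q))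
  · simpa [gen] using RingQuot.mkAlgHom_rel k (Rel.gzG (k := k) (q := q))
  · simpa [gen] using RingQuot.mkAlgHom_rel k (Rel.gX (k := k) (q := q))
  · simpa [gen] using RingQuot.mkAlgHom_rel k (Rel.hX (k := k) (q := q))
  · simpa [gen] using RingQuot.mkAlgHom_rel k (Rel.zX (k := k) (q := q))

/-- The algebra map out of the algebra given by generators and relations. -/
def lift (k : Type*) [Field k] (q : k) {B : Type*} [Ring B] [Algebra k B] (f : Gen → B)
    (R8 : HopfGen.Rel8 k (f .g) (f .h) (f .z))
    (R4 : HopfGen.Rel4 (f .G) (f .X))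
    (RC : HopfGen.RelB k q (f .g) (f .h) (f .z) (f .G) (f .X)) :
    RingQuot (Rel k q) →ₐ[k] B :=
  RingQuot.liftAlgHom k ⟨FreeAlgebra.lift k f, by
    intro a b hab
    cases hab
    · simpa using R8.gg
    · simpa using R8.hh
    · simpa using R8.gh
    · simpa using R8.zz
    · simpa using R8.gz
    · simpa using R8.hz
    · simpa using R4.GG
    · simpa using R4.XX
    · simpa using (neg_eq_iff_eq_neg.mpr R4.XG).symm
    · simpa using RC.gG
    · simpa using RC.hG
    · simpa using RC.gzG
    · simpa using RC.gX
    · simpa using RC.hX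
    · simpa using RC.zX⟩

theorem lift_gen (k : Type*) [Field k] (q : k) {B : Type*} [Ring B] [Algebra k B] (f : Gen → B)
    (R8 : HopfGen.Rel8 k (f .g) (f .h) (f .z))
    (R4 : HopfGen.Rel4 (f .G) (f .X))
    (RC : HopfGen.RelB k q (f .g) (f .h) (f .z) (f .G) (f .X)) (x : Gen) :
    lift k q f R8 R4 RC (gen k q x) = f x := by
  simp [lift, gen, RingQuot.liftAlgHom_mkAlgHom_apply]

/-- `Δ(g) = g ⊗ g`, `Δ(h) = h ⊗ h`, `Δ(z) = J (z ⊗ z)` with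
`J = (1/2) (1 ⊗ 1 + g ⊗ 1 + 1 ⊗ h - g ⊗ h)`, `Δ(G) = G ⊗ G`, `Δ(X) = X ⊗ G + 1 ⊗ X`. -/
def comulGen (k : Type*) [Field k] (q : k) :
    Gen → RingQuot (Rel k q) ⊗[k] RingQuot (Rel k q)
  | .g => gen k q .g ⊗ₜ gen k q .g
  | .h => gen k q .h ⊗ₜ gen k q .h
  | .z => ((1 / 2 : k) • (1 ⊗ₜ 1 + gen k q .g ⊗ₜ 1 + 1 ⊗ₜ gen k q .h - gen k q .g ⊗ₜ gen k q .h))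
      * (gen k q .z ⊗ₜ gen k q .z)
  | .G => gen k q .G ⊗ₜ gen k q .G
  | .X => gen k q .X ⊗ₜ gen k q .G + 1 ⊗ₜ gen k q .X

/-- `ε(g) = ε(h) = ε(z) = 1`, `ε(G) = 1`, `ε(X) = 0`. -/
def counitGen (k : Type*) [Field k] : Gen → k
  | .g => 1
  | .h => 1
  | .z => 1
  | .G => 1
  | .X => 0

/-- `S(g) = g`, `S(h) = h`, `S(z) = z`, `S(G) = G`, `S(X) = G X`. -/
def antipodeGen (k : Type*) [Field k] (q : k) : Gen → (RingQuot (Rel k q))ᵐᵒᵖ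
  | .g => MulOpposite.op (gen k q .g)
  | .h => MulOpposite.op (gen k q .h)
  | .z => MulOpposite.op (gen k q .z)
  | .G => MulOpposite.op (gen k q .G)
  | .X => MulOpposite.op (gen k q .G * gen k q .X)

theorem rel8_counit (k : Type*) [Field k] [CharZero k] :
    HopfGen.Rel8 k (counitGen k .g) (counitGen k .h) (counitGen k .z) := by
  constructor <;> simp [counitGen] <;> norm_num

theorem rel4_counit (k : Type*) [Field k] :
    HopfGen.Rel4 (counitGen k .G) (counitGen k .X) := by
  constructor <;> simp [counitGen]

theorem relC_counit (k : Type*) [Field k] (q : k) :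
    HopfGen.RelB k q (counitGen k .g) (counitGen k .h) (counitGen k .z) (counitGen k .G) (counitGen k .X) := by
  constructor <;> simp [counitGen]

/-- The Hopf algebra structure. -/
@[reducible] def hopf (k : Type*) [Field k] [CharZero k] (q : k) : HopfAlgebra k (RingQuot (Rel k q)) :=
  HopfGen.mkGen (Rel k q)
    (lift k q (comulGen k q) (rel8 k q).comul (rel4 k q).comul ((relC k q).comul (rel8 k q)))
    (lift k q (counitGen k) (rel8_counit k) (rel4_counit k) (relC_counit k q))
    (lift k q (antipodeGen k q) (rel8 k q).op (rel4 k q).op ((relC k q).op (rel8 k q)))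
    (by
      rintro (_ | _ | _ | _ | _)
      · exact HopfGen.ax_groupLike (lift_gen ..) (lift_gen ..) (lift_gen ..) (rel8 k q).gg
      · exact HopfGen.ax_groupLike (lift_gen ..) (lift_gen ..) (lift_gen ..) (rel8 k q).hh
      · apply HopfGen.ax_z (rel8 k q) <;> apply lift_gen
      · exact HopfGen.ax_groupLike (lift_gen ..) (lift_gen ..) (lift_gen ..) (rel4 k q).GG
      · apply HopfGen.ax_X (rel4 k q) <;> apply lift_gen)

end H32B

/-- The Hopf algebras `H_{32,2}` and `H_{32,3}`, obtained for `q = i` and `q = -i` where `i` is a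
square root of `-1`: generated by `g`, `h`, `z`, `G`, `X` with the relations of `H8` and of `H4` and
`g G = G g`, `h G = G h`, `g z G = G h z`, `g X = - X g`, `h X = - X h`, `z X = q X g z`;
the comultiplication, counit and antipode are those of `H8` and `H4` on the generators. -/
def H32B (k : Type*) [Field k] (q : k) : Type _ := RingQuot (H32B.Rel k q)

instance (k : Type*) [Field k] (q : k) : Ring (H32B k q) :=
  inferInstanceAs (Ring (RingQuot (H32B.Rel k q)))

instance (k : Type*) [Field k] [CharZero k] (q : k) : HopfAlgebra k (H32B k q) := H32B.hopf k q

namespace H32B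

/-- The generator `g`. -/
def g (k : Type*) [Field k] (q : k) : H32B k q := gen k q .g

/-- The generator `h`. -/
def h (k : Type*) [Field k] (q : k) : H32B k q := gen k q .h

/-- The generator `z`. -/
def z (k : Type*) [Field k] (q : k) : H32B k q := gen k q .z

/-- The generator `G`. -/
def G (k : Type*) [Field k] (q : k) : H32B k q := gen k q .G

/-- The generator `X`. -/
def X (k : Type*) [Field k] (q : k) : H32B k q := gen k q .X

theorem comul_z (k : Type*) [Field k] [CharZero k] (q : k) :
    Coalgebra.comul (R := k) (z k q)
      = ((1 / 2 : k) • ((1 : H32B k q) ⊗ₜ[k] (1 : H32B k q) + g k q ⊗ₜ 1 + 1 ⊗ₜ h k q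
          - g k q ⊗ₜ h k q)) * (z k q ⊗ₜ z k q) :=
  lift_gen _ _ _ _ _ _ _

end H32B

/-! ## Factorizations and bicrossed products -/

section

open TensorProduct

universe u v w x

/-- The Hopf algebra `E` factorizes through the Hopf algebras `A` and `H`: there are injective
morphisms of Hopf algebras `i : A → E` and `j : H → E` such that `A ⊗ H → E`, `a ⊗ h ↦ i(a) j(h)`,
is bijective. (A bialgebra morphism of Hopf algebras automatically commutes with the antipodes.) -/
def FactorizesThrough (k : Type u) [Field k] (A : Type v) (H : Type w) (E : Type x)
    [Ring A] [HopfAlgebra k A] [Ring H] [HopfAlgebra k H] [Ring E] [HopfAlgebra k E] : Prop :=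
  ∃ (i : A →ₐc[k] E) (j : H →ₐc[k] E), Function.Injective i ∧ Function.Injective j ∧
    Function.Bijective (TensorProduct.lift
      ((LinearMap.mul k E).compl₁₂ (i : A →ₗ[k] E) (j : H →ₗ[k] E)))

/-- A matched pair of Hopf algebras `(A, H, ▷, ◁)`: coalgebra maps `▷ : H ⊗ A → A` (`act`) and
`◁ : H ⊗ A → H` (`coact`) making `A` a left `H`-module coalgebra and `H` a right `A`-module
coalgebra, with the compatibility conditions. In the conditions, `comul (h ⊗ₜ a)` is
`∑ (h₁ ⊗ a₁) ⊗ (h₂ ⊗ a₂)`, the comultiplication of the coalgebra `H ⊗ A`. -/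
structure MatchedPair (k : Type u) [Field k] (A : Type v) (H : Type w)
    [Ring A] [HopfAlgebra k A] [Ring H] [HopfAlgebra k H] where
  /-- The left action `▷`. -/
  act : H ⊗[k] A →ₗc[k] A
  /-- The right action `◁`. -/
  coact : H ⊗[k] A →ₗc[k] H
  one_act : ∀ a : A, act (1 ⊗ₜ a) = a
  mul_act : ∀ (g h : H) (a : A), act ((g * h) ⊗ₜ a) = act (g ⊗ₜ act (h ⊗ₜ a))
  coact_one : ∀ h : H, coact (h ⊗ₜ 1) = h
  coact_mul : ∀ (h : H) (a b : A), coact (h ⊗ₜ (a * b)) = coact (coact (h ⊗ₜ a) ⊗ₜ b)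
  /-- `h ▷ 1 = ε(h) 1`. -/
  act_one : ∀ h : H, act (h ⊗ₜ 1) = Coalgebra.counit (R := k) h • (1 : A)
  /-- `1 ◁ a = ε(a) 1`. -/
  one_coact : ∀ a : A, coact (1 ⊗ₜ a) = Coalgebra.counit (R := k) a • (1 : H)
  /-- `h ▷ (a b) = ∑ (h₁ ▷ a₁) ((h₂ ◁ a₂) ▷ b)`. -/
  act_mul : ∀ (h : H) (a b : A), act (h ⊗ₜ (a * b)) =
    LinearMap.mul' k A (TensorProduct.map (act : H ⊗[k] A →ₗ[k] A)
      ((act : H ⊗[k] A →ₗ[k] A) ∘ₗ (TensorProduct.mk k H A).flip b ∘ₗ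
        (coact : H ⊗[k] A →ₗ[k] H))
      (Coalgebra.comul (R := k) (h ⊗ₜ[k] a)))
  /-- `(g h) ◁ a = ∑ (g ◁ (h₁ ▷ a₁)) (h₂ ◁ a₂)`. -/
  mul_coact : ∀ (g h : H) (a : A), coact ((g * h) ⊗ₜ a) =
    LinearMap.mul' k H (TensorProduct.map
      ((coact : H ⊗[k] A →ₗ[k] H) ∘ₗ TensorProduct.mk k H A g ∘ₗ (act : H ⊗[k] A →ₗ[k] A))
      (coact : H ⊗[k] A →ₗ[k] H)
      (Coalgebra.comul (R := k) (h ⊗ₜ[k] a)))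
  /-- `∑ (h₁ ◁ a₁) ⊗ (h₂ ▷ a₂) = ∑ (h₂ ◁ a₂) ⊗ (h₁ ▷ a₁)`. -/
  compat : ∀ (h : H) (a : A),
    TensorProduct.map (coact : H ⊗[k] A →ₗ[k] H) (act : H ⊗[k] A →ₗ[k] A)
      (Coalgebra.comul (R := k) (h ⊗ₜ[k] a)) =
    TensorProduct.comm k A H (TensorProduct.map (act : H ⊗[k] A →ₗ[k] A)
      (coact : H ⊗[k] A →ₗ[k] H) (Coalgebra.comul (R := k) (h ⊗ₜ[k] a)))

/-- The product of the bicrossed product `A ⋈ H` on `A ⊗ H`: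
`(a ⋈ h) (b ⋈ g) = ∑ a (h₁ ▷ b₁) ⋈ (h₂ ◁ b₂) g`. -/
def MatchedPair.prod {k : Type u} [Field k] {A : Type v} {H : Type w}
    [Ring A] [HopfAlgebra k A] [Ring H] [HopfAlgebra k H] (M : MatchedPair k A H)
    (a : A) (h : H) (b : A) (g : H) : A ⊗[k] H :=
  TensorProduct.map (LinearMap.mulLeft k a ∘ₗ (M.act : H ⊗[k] A →ₗ[k] A))
    (LinearMap.mulRight k g ∘ₗ (M.coact : H ⊗[k] A →ₗ[k] H))
    (Coalgebra.comul (R := k) (h ⊗ₜ[k] b))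

/-- The Hopf algebra `E` is (isomorphic to) a bicrossed product `A ⋈ H`: for some matched pair, `E`
is identified, as a coalgebra, with the tensor product coalgebra `A ⊗ H` in such a way that the
unit is `1 ⊗ 1` and the product is that of `A ⋈ H`. (The antipode is determined by this.) -/
def IsBicrossedProduct (k : Type u) [Field k] (A : Type v) (H : Type w) (E : Type x)
    [Ring A] [HopfAlgebra k A] [Ring H] [HopfAlgebra k H] [Ring E] [HopfAlgebra k E] : Prop :=
  ∃ (M : MatchedPair k A H) (φ : (A ⊗[k] H) ≃ₗc[k] E), φ (1 ⊗ₜ 1) = 1 ∧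
    ∀ (a : A) (h : H) (b : A) (g : H), φ (a ⊗ₜ h) * φ (b ⊗ₜ g) = φ (M.prod a h b g)

end

end

set_option linter.unusedSectionVars false

/-! In a factorization `E = A H` the multiplication `A ⊗ H → E` is an isomorphism of coalgebras. Its
inverse followed by a counit gives coalgebra maps `p : E → A` and `q : E → H`, and `x ▷ a = p(x a)`,
`x ◁ a = q(x a)` is a matched pair. Its compatibility condition says that `(p ⊗ q) Δ` and the flip
of `(q ⊗ p) Δ` both equal that inverse. Hence bicrossed products are the same as factorizations
(`isBicrossedProduct_iff`). The order of the factors is irrelevant: the fourth power of the antipode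
is the identity on `H4` and on `H8`, hence on `E`, so the antipode of `E` is a bijection that
reverses products (`FactorizesThrough.swap`).

For the classification, let `E = H8 H4`. The compatibility condition makes `a ↦ G ◁ a` cocentral.
Together with the form of `Δ(z)` this makes `G ◁ z` group-like, as `G ◁ g` and `G ◁ h` are; the
group-likes of `H4` are `1` and `G`, and `1` would put `G` inside `H8`. So `G a = σ(a) G` for a
multiplicative involution `σ` of `H8` (`G_mul`). Then `X ◁ a` is `(1, G)`-primitive, so `X ◁ a =
χ(a) X + ψ(a) (1 - G)` for functionals `χ`, `ψ` on `H8`, and `X a` has an explicit normal form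
(`X_mul`).

Associativity makes `χ` a character and `ψ` a twisted derivation, and `X² = 0` forces `ψ` to vanish
on `g`, `h`, `z`. The relations of `H8` leave `χ(g) = χ(h) = χ(z)²` with `χ(g)² = 1`, so `χ(z)` is
one of `1`, `-1`, `i`, `-i`. Cocentrality of `X ◁ a` expresses `σ` through `χ` (`convR_chi`), so
`χ(z)` determines all cross relations. The four values give `H8 ⊗ H4`, `H_{32,1}`, `H_{32,2}` and
`H_{32,3}`.

Conversely, each presented algebra has the right size because it acts on `H8 ⊗ H4` by twisted left
multiplications (`bijective_mulHom`). An algebra map respecting two factorizations is then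
automatically an isomorphism (`nonempty_bialgEquiv`). -/

noncomputable section

/-! ### Factorizations, matched pairs and bicrossed products of general Hopf algebras. -/

namespace Factorization

open Coalgebra TensorProduct

section

variable {k A H E : Type*} [Field k] [Ring A] [HopfAlgebra k A] [Ring H] [HopfAlgebra k H]
  [Ring E] [HopfAlgebra k E]

/-- The coalgebra map `A ⊗ H → E`, `a ⊗ h ↦ i(a) j(h)`. -/
def mulHom (i : A →ₐc[k] E) (j : H →ₐc[k] E) : A ⊗[k] H →ₗc[k] E :=
  (Bialgebra.mulCoalgHom k E).comp (Coalgebra.TensorProduct.map (i : A →ₗc[k] E) (j : H →ₗc[k] E))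

@[simp] theorem mulHom_tmul (i : A →ₐc[k] E) (j : H →ₐc[k] E) (a : A) (h : H) :
    mulHom i j (a ⊗ₜ h) = i a * j h := rfl

theorem coe_mulHom (i : A →ₐc[k] E) (j : H →ₐc[k] E) :
    (mulHom i j : A ⊗[k] H →ₗ[k] E) = TensorProduct.lift
      ((LinearMap.mul k E).compl₁₂ (i : A →ₗ[k] E) (j : H →ₗ[k] E)) := by
  ext; rfl

/-- `a ⊗ h ↦ ε(h) a`. -/
def fstHom (k A H : Type*) [Field k] [Ring A] [HopfAlgebra k A] [Ring H] [HopfAlgebra k H] :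
    A ⊗[k] H →ₗc[k] A :=
  (Coalgebra.TensorProduct.rid k k A : A ⊗[k] k →ₗc[k] A).comp
    (Coalgebra.TensorProduct.map (.id k A) (counitCoalgHom k H))

/-- `a ⊗ h ↦ ε(a) h`. -/
def sndHom (k A H : Type*) [Field k] [Ring A] [HopfAlgebra k A] [Ring H] [HopfAlgebra k H] :
    A ⊗[k] H →ₗc[k] H :=
  (Coalgebra.TensorProduct.lid k H : k ⊗[k] H →ₗc[k] H).comp
    (Coalgebra.TensorProduct.map (counitCoalgHom k A) (.id k H))

@[simp] theorem fstHom_tmul (a : A) (h : H) : fstHom k A H (a ⊗ₜ h) = counit (R := k) h • a := rfl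

@[simp] theorem sndHom_tmul (a : A) (h : H) : sndHom k A H (a ⊗ₜ h) = counit (R := k) a • h := rfl

/-- By the counit axioms, `∑ ε(h₁) a₁ ⊗ ε(a₂) h₂ = a ⊗ h`. -/
theorem map_fst_snd_comul (t : A ⊗[k] H) :
    map (fstHom k A H : A ⊗[k] H →ₗ[k] A) (sndHom k A H : A ⊗[k] H →ₗ[k] H) (comul t) = t := by
  induction t with
  | zero => simp
  | add x y hx hy => rw [map_add, map_add, hx, hy]
  | tmul a h =>
    have key : ∀ (x : A ⊗[k] A) (y : H ⊗[k] H),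
        map (fstHom k A H : A ⊗[k] H →ₗ[k] A) (sndHom k A H : A ⊗[k] H →ₗ[k] H)
          (AlgebraTensorModule.tensorTensorTensorComm k k k k A A H H (x ⊗ₜ y))
        = (TensorProduct.rid k A (counit.lTensor A x)) ⊗ₜ
          (TensorProduct.lid k H (counit.rTensor H y)) := by
      intro x y
      induction x with
      | zero => simp
      | add x x' hx hx' => simp only [add_tmul, map_add, hx, hx']
      | tmul a a' =>
        induction y with
        | zero => simp
        | add y y' hy hy' => simp only [tmul_add, map_add, hy, hy']
        | tmul b b' => simp [smul_tmul', tmul_smul, smul_smul, mul_comm]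
    rw [comul_tmul, key]
    simp

theorem map_snd_fst_comul (t : A ⊗[k] H) :
    map (sndHom k A H : A ⊗[k] H →ₗ[k] H) (fstHom k A H : A ⊗[k] H →ₗ[k] A) (comul t)
      = TensorProduct.comm k A H t := by
  induction t with
  | zero => simp
  | add x y hx hy => rw [map_add, map_add, hx, hy, map_add]
  | tmul a h =>
    have key : ∀ (x : A ⊗[k] A) (y : H ⊗[k] H),
        map (sndHom k A H : A ⊗[k] H →ₗ[k] H) (fstHom k A H : A ⊗[k] H →ₗ[k] A)
          (AlgebraTensorModule.tensorTensorTensorComm k k k k A A H H (x ⊗ₜ y))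
        = (TensorProduct.rid k H (counit.lTensor H y)) ⊗ₜ
          (TensorProduct.lid k A (counit.rTensor A x)) := by
      intro x y
      induction x with
      | zero => simp
      | add x x' hx hx' => simp only [add_tmul, tmul_add, map_add, hx, hx']
      | tmul a a' =>
        induction y with
        | zero => simp
        | add y y' hy hy' => simp only [add_tmul, tmul_add, map_add, hy, hy']
        | tmul b b' => simp [smul_tmul', tmul_smul, smul_smul, mul_comm]
    rw [comul_tmul, key]
    simp

variable {i : A →ₐc[k] E} {j : H →ₐc[k] E}

/-- Injectivity of `i` and `j` is automatic: `a` is recovered from `a ⊗ 1`, and `h` from `1 ⊗ h`, by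
a counit. -/
theorem factorizesThrough (hm : Function.Bijective (mulHom i j)) :
    FactorizesThrough k A H E := by
  refine ⟨i, j, fun a b hab => ?_, fun a b hab => ?_, ?_⟩
  · have : mulHom i j (a ⊗ₜ 1) = mulHom i j (b ⊗ₜ 1) := by simp [hab]
    simpa using congrArg (fstHom k A H) (hm.1 this)
  · have : mulHom i j (1 ⊗ₜ a) = mulHom i j (1 ⊗ₜ b) := by simp [hab]
    simpa using congrArg (sndHom k A H) (hm.1 this)
  · rw [← coe_mulHom]; exact hm

theorem factorizesThrough_iff : FactorizesThrough k A H E ↔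
    ∃ (i : A →ₐc[k] E) (j : H →ₐc[k] E), Function.Bijective (mulHom i j) := by
  refine ⟨fun ⟨i, j, _, _, hm⟩ => ⟨i, j, ?_⟩, fun ⟨i, j, hm⟩ => factorizesThrough hm⟩
  rw [← coe_mulHom] at hm; exact hm

theorem linearMap_ext (hm : Function.Bijective (mulHom i j))
    {V : Type*} [AddCommMonoid V] [Module k V] {f g : E →ₗ[k] V}
    (hfg : ∀ a h, f (i a * j h) = g (i a * j h)) : f = g := by
  ext e
  obtain ⟨t, rfl⟩ := hm.2 e
  have : f ∘ₗ (mulHom i j : A ⊗[k] H →ₗ[k] E) = g ∘ₗ (mulHom i j : A ⊗[k] H →ₗ[k] E) := by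
    ext a h; exact hfg a h
  exact LinearMap.congr_fun this t

variable (hm : Function.Bijective (mulHom i j))

/-- The multiplication map as an isomorphism of coalgebras. -/
def mulEquiv : A ⊗[k] H ≃ₗc[k] E := CoalgEquiv.ofBijective hm

theorem mulEquiv_apply (t : A ⊗[k] H) : mulEquiv hm t = mulHom i j t := rfl

@[simp] theorem mulEquiv_symm_mul (a : A) (h : H) : (mulEquiv hm).symm (i a * j h) = a ⊗ₜ h :=
  (mulEquiv hm).symm_apply_apply (a ⊗ₜ h)

/-- The projection `E → A`, `i(a) j(h) ↦ ε(h) a`. -/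
def projL : E →ₗc[k] A := (fstHom k A H).comp ((mulEquiv hm).symm : E →ₗc[k] A ⊗[k] H)

/-- The projection `E → H`, `i(a) j(h) ↦ ε(a) h`. -/
def projR : E →ₗc[k] H := (sndHom k A H).comp ((mulEquiv hm).symm : E →ₗc[k] A ⊗[k] H)

theorem projL_def (e : E) : projL hm e = fstHom k A H ((mulEquiv hm).symm e) := rfl

theorem projR_def (e : E) : projR hm e = sndHom k A H ((mulEquiv hm).symm e) := rfl

@[simp] theorem projL_mul (a : A) (h : H) : projL hm (i a * j h) = counit (R := k) h • a := by
  rw [projL_def, mulEquiv_symm_mul, fstHom_tmul]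

@[simp] theorem projR_mul (a : A) (h : H) : projR hm (i a * j h) = counit (R := k) a • h := by
  rw [projR_def, mulEquiv_symm_mul, sndHom_tmul]

@[simp] theorem projL_left (a : A) : projL hm (i a) = a := by simpa using projL_mul hm a 1

@[simp] theorem projR_left (a : A) : projR hm (i a) = counit (R := k) a • (1 : H) := by
  simpa using projR_mul hm a 1

@[simp] theorem projL_right (h : H) : projL hm (j h) = counit (R := k) h • (1 : A) := by
  simpa using projL_mul hm 1 h

@[simp] theorem projR_right (h : H) : projR hm (j h) = h := by simpa using projR_mul hm 1 h

theorem projL_left_mul (a : A) (e : E) : projL hm (i a * e) = a * projL hm e := by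
  refine LinearMap.congr_fun (linearMap_ext hm
    (f := (projL hm : E →ₗ[k] A) ∘ₗ LinearMap.mulLeft k (i a))
    (g := LinearMap.mulLeft k a ∘ₗ (projL hm : E →ₗ[k] A)) fun b h => ?_) e
  simp [← mul_assoc, ← map_mul]

theorem projL_mul_right (e : E) (h : H) : projL hm (e * j h) = counit (R := k) h • projL hm e := by
  refine LinearMap.congr_fun (linearMap_ext hm
    (f := (projL hm : E →ₗ[k] A) ∘ₗ LinearMap.mulRight k (j h))
    (g := counit (R := k) h • (projL hm : E →ₗ[k] A)) fun b h' => ?_) e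
  simp [mul_assoc, ← map_mul, smul_smul, mul_comm (counit (R := k) h)]

theorem projR_mul_right (e : E) (h : H) : projR hm (e * j h) = projR hm e * h := by
  refine LinearMap.congr_fun (linearMap_ext hm
    (f := (projR hm : E →ₗ[k] H) ∘ₗ LinearMap.mulRight k (j h))
    (g := LinearMap.mulRight k h ∘ₗ (projR hm : E →ₗ[k] H)) fun b h' => ?_) e
  simp [mul_assoc, ← map_mul]

theorem projR_left_mul (a : A) (e : E) : projR hm (i a * e) = counit (R := k) a • projR hm e := by
  refine LinearMap.congr_fun (linearMap_ext hm
    (f := (projR hm : E →ₗ[k] H) ∘ₗ LinearMap.mulLeft k (i a))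
    (g := counit (R := k) a • (projR hm : E →ₗ[k] H)) fun b h' => ?_) e
  simp [← mul_assoc, ← map_mul, smul_smul]

/-- For `f = i(a) j(h)` both sides equal `ε(h)` times the projection of `e i(a)`. This and its
mirror image `projR_mul_eq` yield the module axioms of the matched pair. -/
theorem projL_mul_eq (e f : E) : projL hm (e * f) = projL hm (e * i (projL hm f)) := by
  refine LinearMap.congr_fun (linearMap_ext hm
    (f := (projL hm : E →ₗ[k] A) ∘ₗ LinearMap.mulLeft k e)
    (g := (projL hm : E →ₗ[k] A) ∘ₗ LinearMap.mulLeft k e ∘ₗ (i : A →ₗ[k] E) ∘ₗ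
      (projL hm : E →ₗ[k] A)) fun b h => ?_) f
  simp [← mul_assoc, projL_mul_right]

theorem projR_mul_eq (e f : E) : projR hm (e * f) = projR hm (j (projR hm e) * f) := by
  refine LinearMap.congr_fun (linearMap_ext hm
    (f := (projR hm : E →ₗ[k] H) ∘ₗ LinearMap.mulRight k f)
    (g := (projR hm : E →ₗ[k] H) ∘ₗ LinearMap.mulRight k f ∘ₗ (j : H →ₗ[k] E) ∘ₗ
      (projR hm : E →ₗ[k] H)) fun b h => ?_) e
  simp [mul_assoc, projR_left_mul]

/-- The comultiplication of `E` determines the decomposition `E = A ⊗ H`. -/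
theorem map_projL_projR_comul (e : E) :
    map (projL hm : E →ₗ[k] A) (projR hm : E →ₗ[k] H) (comul e) = (mulEquiv hm).symm e := by
  obtain ⟨t, rfl⟩ := (mulEquiv hm).toEquiv.surjective e
  change map (projL hm : E →ₗ[k] A) (projR hm : E →ₗ[k] H) (comul (mulEquiv hm t))
    = (mulEquiv hm).symm (mulEquiv hm t)
  rw [CoalgEquiv.symm_apply_apply, ← CoalgHomClass.map_comp_comul_apply (mulEquiv hm) t,
    ← LinearMap.comp_apply, ← map_comp]
  convert map_fst_snd_comul t using 3 <;> ext <;> simp [mulEquiv_apply]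

/-- Combined with `map_projL_projR_comul`, this is the compatibility condition of the matched pair.
It is also the source of the cocentrality used in the classification. -/
theorem map_projR_projL_comul (e : E) :
    map (projR hm : E →ₗ[k] H) (projL hm : E →ₗ[k] A) (comul e)
      = TensorProduct.comm k A H ((mulEquiv hm).symm e) := by
  obtain ⟨t, rfl⟩ := (mulEquiv hm).toEquiv.surjective e
  change map (projR hm : E →ₗ[k] H) (projL hm : E →ₗ[k] A) (comul (mulEquiv hm t))
    = TensorProduct.comm k A H ((mulEquiv hm).symm (mulEquiv hm t))
  rw [CoalgEquiv.symm_apply_apply, ← CoalgHomClass.map_comp_comul_apply (mulEquiv hm) t,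
    ← LinearMap.comp_apply, ← map_comp]
  convert map_snd_fst_comul t using 3 <;> ext <;> simp [mulEquiv_apply]

/-- The matched pair of a factorization. -/
def matchedPair : MatchedPair k A H where
  act := (projL hm).comp (mulHom j i)
  coact := (projR hm).comp (mulHom j i)
  one_act a := by simp
  mul_act g h a := by
    simp only [CoalgHom.comp_apply, mulHom_tmul, map_mul, mul_assoc]
    exact projL_mul_eq hm (j g) (j h * i a)
  coact_one h := by simp
  coact_mul h a b := by
    simp only [CoalgHom.comp_apply, mulHom_tmul, map_mul, ← mul_assoc]
    exact projR_mul_eq hm (j h * i a) (i b)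
  act_one h := by simp
  one_coact a := by simp
  act_mul h a b := by
    -- For every `e`, `p(e b) = ∑ p(e₁) p(q(e₂) b)`, where `p`, `q` are the projections to `A`, `H`.
    -- It suffices to take `e` in product form, where the sum collapses; it is then applied to `e =
    -- j(h) i(a)`.
    have key := LinearMap.congr_fun (linearMap_ext hm
      (f := (projL hm : E →ₗ[k] A) ∘ₗ LinearMap.mulRight k (i b))
      (g := LinearMap.mul' k A ∘ₗ map LinearMap.id ((projL hm : E →ₗ[k] A) ∘ₗ
        LinearMap.mulRight k (i b) ∘ₗ (j : H →ₗ[k] E)) ∘ₗ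
        map (projL hm : E →ₗ[k] A) (projR hm : E →ₗ[k] H) ∘ₗ comul) fun a' h' => by
          simp only [LinearMap.comp_apply, map_projL_projR_comul]
          simp [mul_assoc, projL_left_mul]) (j h * i a)
    simp only [LinearMap.comp_apply, LinearMap.coe_coe] at key
    rw [← mulHom_tmul,
      ← CoalgHomClass.map_comp_comul_apply (mulHom j i), ← LinearMap.comp_apply (map _ _),
      ← map_comp, ← LinearMap.comp_apply (map _ _), ← map_comp] at key
    simp only [CoalgHom.comp_apply, mulHom_tmul, map_mul]
    rw [← mul_assoc]
    exact key
  mul_coact g h a := by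
    -- The mirror identity `q(g e) = ∑ q(g p(e₁)) q(e₂)`, again at `e = j(h) i(a)`.
    have key := LinearMap.congr_fun (linearMap_ext hm
      (f := (projR hm : E →ₗ[k] H) ∘ₗ LinearMap.mulLeft k (j g))
      (g := LinearMap.mul' k H ∘ₗ map ((projR hm : E →ₗ[k] H) ∘ₗ
        LinearMap.mulLeft k (j g) ∘ₗ (i : A →ₗ[k] E)) LinearMap.id ∘ₗ
        map (projL hm : E →ₗ[k] A) (projR hm : E →ₗ[k] H) ∘ₗ comul) fun a' h' => by
          simp only [LinearMap.comp_apply, map_projL_projR_comul]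
          simp [← mul_assoc, projR_mul_right]) (j h * i a)
    simp only [LinearMap.comp_apply, LinearMap.coe_coe] at key
    rw [← mulHom_tmul,
      ← CoalgHomClass.map_comp_comul_apply (mulHom j i), ← LinearMap.comp_apply (map _ _),
      ← map_comp, ← LinearMap.comp_apply (map _ _), ← map_comp] at key
    simp only [CoalgHom.comp_apply, mulHom_tmul, map_mul]
    rw [mul_assoc]
    exact key
  compat h a := by
    rw [CoalgHom.comp_toLinearMap, CoalgHom.comp_toLinearMap, map_comp, map_comp,
      LinearMap.comp_apply, LinearMap.comp_apply, CoalgHomClass.map_comp_comul_apply,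
      map_projL_projR_comul, map_projR_projL_comul]

/-- Every `e` equals `∑ p(e₁) q(e₂)` with `p`, `q` the two projections. Taking `e = j(h) i(b)` and
multiplying by `i(a)` and `j(g)` on the two sides gives the product formula. -/
theorem isBicrossedProduct (hm : Function.Bijective (mulHom i j)) :
    IsBicrossedProduct k A H E := by
  refine ⟨matchedPair hm, mulEquiv hm, by simp [mulEquiv_apply], fun a h b g => ?_⟩
  have key := LinearMap.congr_fun (linearMap_ext hm
    (f := LinearMap.mulLeft k (i a) ∘ₗ LinearMap.mulRight k (j g))
    (g := (mulHom i j : A ⊗[k] H →ₗ[k] E) ∘ₗ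
      map (LinearMap.mulLeft k a) (LinearMap.mulRight k g) ∘ₗ
        map (projL hm : E →ₗ[k] A) (projR hm : E →ₗ[k] H) ∘ₗ comul) fun a' h' => by
          simp only [LinearMap.comp_apply, map_projL_projR_comul]
          simp [← mul_assoc]) (j h * i b)
  simp only [LinearMap.comp_apply, LinearMap.coe_coe] at key
  rw [← mulHom_tmul,
    ← CoalgHomClass.map_comp_comul_apply (mulHom j i), ← LinearMap.comp_apply (map _ _), ← map_comp,
    ← LinearMap.comp_apply (map _ _), ← map_comp] at key
  simp only [mulEquiv_apply, mulHom_tmul]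
  refine Eq.trans ?_ key
  simp [mul_assoc]

/-- The coalgebra map `a ↦ a ⊗ 1`. -/
def inlHom (k A H : Type*) [Field k] [Ring A] [HopfAlgebra k A] [Ring H] [HopfAlgebra k H] :
    A →ₗc[k] A ⊗[k] H :=
  (Coalgebra.TensorProduct.map (.id k A) (Bialgebra.unitBialgHom k H : k →ₗc[k] H)).comp
    ((Coalgebra.TensorProduct.rid k k A).symm : A →ₗc[k] A ⊗[k] k)

/-- The coalgebra map `h ↦ 1 ⊗ h`. -/
def inrHom (k A H : Type*) [Field k] [Ring A] [HopfAlgebra k A] [Ring H] [HopfAlgebra k H] :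
    H →ₗc[k] A ⊗[k] H :=
  (Coalgebra.TensorProduct.map (Bialgebra.unitBialgHom k A : k →ₗc[k] A) (.id k H)).comp
    ((Coalgebra.TensorProduct.lid k H).symm : H →ₗc[k] k ⊗[k] H)

@[simp] theorem inlHom_apply (a : A) : inlHom k A H a = a ⊗ₜ 1 := by
  change a ⊗ₜ[k] (Bialgebra.unitBialgHom k H 1) = _
  rw [map_one]

@[simp] theorem inrHom_apply (h : H) : inrHom k A H h = 1 ⊗ₜ h := by
  change (Bialgebra.unitBialgHom k A 1) ⊗ₜ[k] h = _
  rw [map_one]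

/-- Since `1 ▷ b = b` and `1 ◁ b = ε(b) 1`, the counit axiom collapses the sum. This and
`prod_one_right` make the two inclusions into a bicrossed product multiplicative. -/
theorem prod_one_left (M : MatchedPair k A H) (a b : A) (g : H) :
    M.prod a 1 b g = (a * b) ⊗ₜ g := by
  have key : ∀ t : A ⊗[k] A, map (LinearMap.mulLeft k a ∘ₗ (M.act : H ⊗[k] A →ₗ[k] A))
      (LinearMap.mulRight k g ∘ₗ (M.coact : H ⊗[k] A →ₗ[k] H))
      (AlgebraTensorModule.tensorTensorTensorComm k k k k H H A A ((1 ⊗ₜ 1) ⊗ₜ t))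
      = (a * TensorProduct.rid k A (counit.lTensor A t)) ⊗ₜ g := by
    intro t
    induction t with
    | zero => simp
    | add x y hx hy => simp only [tmul_add, map_add, hx, hy, mul_add, add_tmul]
    | tmul x y => simp [M.one_act, M.one_coact, smul_tmul]
  rw [MatchedPair.prod, comul_tmul, Bialgebra.comul_one, Algebra.TensorProduct.one_def, key]
  simp

theorem prod_one_right (M : MatchedPair k A H) (a : A) (h g : H) :
    M.prod a h 1 g = a ⊗ₜ (h * g) := by
  have key : ∀ t : H ⊗[k] H, map (LinearMap.mulLeft k a ∘ₗ (M.act : H ⊗[k] A →ₗ[k] A))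
      (LinearMap.mulRight k g ∘ₗ (M.coact : H ⊗[k] A →ₗ[k] H))
      (AlgebraTensorModule.tensorTensorTensorComm k k k k H H A A (t ⊗ₜ (1 ⊗ₜ 1)))
      = a ⊗ₜ (TensorProduct.lid k H (counit.rTensor H t) * g) := by
    intro t
    induction t with
    | zero => simp
    | add x y hx hy => simp only [add_tmul, map_add, hx, hy, add_mul, tmul_add]
    | tmul x y => simp [M.act_one, M.coact_one, smul_tmul]
  rw [MatchedPair.prod, comul_tmul, Bialgebra.comul_one, Algebra.TensorProduct.one_def, key]
  simp

/-- From a bicrossed product, `a ↦ φ(a ⊗ 1)` and `h ↦ φ(1 ⊗ h)` are bialgebra maps whose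
multiplication map is `φ` itself. -/
theorem isBicrossedProduct_iff : IsBicrossedProduct k A H E ↔ FactorizesThrough k A H E := by
  constructor
  · rintro ⟨M, φ, hone, hmul⟩
    let i : A →ₐc[k] E :=
      { (φ : A ⊗[k] H →ₗc[k] E).comp (inlHom k A H) with
        map_one' := by simpa using hone
        map_mul' := fun a b => by
          have := hmul a 1 b 1
          rw [prod_one_left] at this
          simpa using this.symm }
    let j : H →ₐc[k] E :=
      { (φ : A ⊗[k] H →ₗc[k] E).comp (inrHom k A H) with
        map_one' := by simpa using hone
        map_mul' := fun a b => by
          have := hmul 1 a 1 b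
          rw [prod_one_right] at this
          simpa using this.symm }
    have hi (a : A) : i a = φ (a ⊗ₜ 1) := congrArg φ (inlHom_apply a)
    have hj (h : H) : j h = φ (1 ⊗ₜ h) := congrArg φ (inrHom_apply h)
    have hφ : (mulHom i j : A ⊗[k] H →ₗ[k] E) = (φ : A ⊗[k] H →ₗ[k] E) := by
      ext a h
      have := hmul a 1 1 h
      rw [prod_one_left, mul_one] at this
      simpa [hi, hj] using this
    refine factorizesThrough (i := i) (j := j) ?_
    have h2 : ⇑(mulHom i j) = ⇑φ := funext fun t => LinearMap.congr_fun hφ t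
    rw [h2]
    exact φ.toEquiv.bijective
  · rw [factorizesThrough_iff]
    rintro ⟨i, j, hm⟩
    exact isBicrossedProduct hm

/-- An algebra map compatible with two factorizations through `A` and `H` is an isomorphism. -/
theorem nonempty_bialgEquiv {E' : Type*} [Ring E'] [HopfAlgebra k E']
    -- No bijectivity of `Φ` is needed: it equals the composite of the two multiplication
    -- isomorphisms, which is already an isomorphism of coalgebras.
    (hm : Function.Bijective (mulHom i j)) {i' : A →ₐc[k] E'} {j' : H →ₐc[k] E'}
    (hm' : Function.Bijective (mulHom i' j')) (Φ : E' →ₐ[k] E) (hi : ∀ a, Φ (i' a) = i a)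
    (hj : ∀ h, Φ (j' h) = j h) : Nonempty (E ≃ₐc[k] E') := by
  have key (e : E') : Φ e = mulEquiv hm ((mulEquiv hm').symm e) :=
    LinearMap.congr_fun (linearMap_ext hm' (f := Φ.toLinearMap)
      (g := (mulEquiv hm : A ⊗[k] H →ₗ[k] E) ∘ₗ ((mulEquiv hm').symm : E' →ₗ[k] A ⊗[k] H))
      fun a h => by simp [hi, hj, mulEquiv_apply]) e
  refine ⟨BialgEquiv.symm { (mulEquiv hm').symm.trans (mulEquiv hm) with map_mul' := ?_ }⟩
  intro x y
  change mulEquiv hm ((mulEquiv hm').symm (x * y))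
    = mulEquiv hm ((mulEquiv hm').symm x) * mulEquiv hm ((mulEquiv hm').symm y)
  rw [← key, ← key, ← key, map_mul]

theorem FactorizesThrough.of_bialgEquiv {E' : Type*} [Ring E'] [HopfAlgebra k E']
    (hE : FactorizesThrough k A H E') (e : E ≃ₐc[k] E') : FactorizesThrough k A H E := by
  rw [factorizesThrough_iff] at hE ⊢
  obtain ⟨i, j, hm⟩ := hE
  refine ⟨(e.symm : E' →ₐc[k] E).comp i, (e.symm : E' →ₐc[k] E).comp j, ?_⟩
  have : (mulHom ((e.symm : E' →ₐc[k] E).comp i) ((e.symm : E' →ₐc[k] E).comp j) :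
      A ⊗[k] H →ₗ[k] E) = (e.symm : E' →ₗ[k] E) ∘ₗ (mulHom i j : A ⊗[k] H →ₗ[k] E') := by
    ext a h; simp
  have h2 : ⇑(mulHom ((e.symm : E' →ₐc[k] E).comp i) ((e.symm : E' →ₐc[k] E).comp j))
      = e.symm ∘ mulHom i j := funext fun t => LinearMap.congr_fun this t
  rw [h2]
  exact e.symm.toEquiv.bijective.comp hm

/-- Bialgebra maps commute with antipodes. -/
theorem map_antipode (f : A →ₐc[k] E) (a : A) :
    f (HopfAlgebra.antipode k a) = HopfAlgebra.antipode k (f a) := by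
  -- In the convolution algebra, `f ∘ S` is a left inverse and `S ∘ f` a right inverse of `f`, so
  -- they agree.
  let F : WithConv (A →ₗ[k] E) := WithConv.toConv (f : A →ₗ[k] E)
  let L : WithConv (A →ₗ[k] E) := WithConv.toConv ((f : A →ₗ[k] E) ∘ₗ HopfAlgebra.antipode k)
  let R : WithConv (A →ₗ[k] E) := WithConv.toConv (HopfAlgebra.antipode k ∘ₗ (f : A →ₗ[k] E))
  have h1 : L * F = 1 := by
    ext c
    rw [(ℛ k c).convMul_apply]
    simp [F, L, ← map_mul, ← map_sum, HopfAlgebra.sum_antipode_mul_eq_algebraMap_counit]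
    exact AlgHomClass.commutes f _
  have h2 : F * R = 1 := by
    ext c
    rw [(ℛ k c).convMul_apply]
    simpa [F, R] using
      HopfAlgebra.sum_mul_antipode_eq_algebraMap_counit ((ℛ k c).induced (f : A →ₗc[k] E))
  have := left_inv_eq_right_inv h1 h2
  exact LinearMap.congr_fun (congrArg WithConv.ofConv this) a

/-- If the fourth power of the antipode is trivial on both factors, then the factors can be
interchanged. -/
theorem FactorizesThrough.swap
    (hA : ∀ a : A, (HopfAlgebra.antipode k)^[4] a = a)
    (hH : ∀ h : H, (HopfAlgebra.antipode k)^[4] h = h)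
    (hE : FactorizesThrough k A H E) : FactorizesThrough k H A E := by
  rw [factorizesThrough_iff] at hE ⊢
  obtain ⟨i, j, hm⟩ := hE
  refine ⟨j, i, ?_⟩
  simp only [Function.iterate_succ, Function.iterate_zero, Function.comp_apply, id_eq] at hA hH
  -- An even power of the antipode preserves products, so `S⁴ = 1` passes from the factors to `i(a)
  -- j(h)`. Then `S` is invertible with inverse `S³`.
  have hE : ∀ e : E, (HopfAlgebra.antipode k)^[4] e = e := fun e =>
    LinearMap.congr_fun (linearMap_ext hm (f := (HopfAlgebra.antipode k) ∘ₗ HopfAlgebra.antipode k ∘ₗ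
      HopfAlgebra.antipode k ∘ₗ HopfAlgebra.antipode k) (g := LinearMap.id) fun a h => by
        simp [HopfAlgebra.antipode_mul_antidistrib, ← map_antipode, hA, hH]) e
  simp only [Function.iterate_succ, Function.iterate_zero, Function.comp_apply, id_eq] at hE
  let eA : A ≃ₗ[k] A := LinearEquiv.ofLinearMap
    ((HopfAlgebra.antipode k) ∘ₗ HopfAlgebra.antipode k ∘ₗ HopfAlgebra.antipode k)
    (HopfAlgebra.antipode k) (by ext; simp [hA]) (by ext; simp [hA])
  let eH : H ≃ₗ[k] H := LinearEquiv.ofLinearMap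
    ((HopfAlgebra.antipode k) ∘ₗ HopfAlgebra.antipode k ∘ₗ HopfAlgebra.antipode k)
    (HopfAlgebra.antipode k) (by ext; simp [hH]) (by ext; simp [hH])
  let eE : E ≃ₗ[k] E := LinearEquiv.ofLinearMap (HopfAlgebra.antipode k)
    ((HopfAlgebra.antipode k) ∘ₗ HopfAlgebra.antipode k ∘ₗ HopfAlgebra.antipode k)
    (by ext; simp [hE]) (by ext; simp [hE])
  -- This composite of bijections is the swapped multiplication: `j(h) i(a) = S(i(S³ a) j(S³ h))`.
  let e : H ⊗[k] A ≃ₗ[k] E := (TensorProduct.congr eH eA).trans ((TensorProduct.comm k H A).trans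
    ((mulEquiv hm : A ⊗[k] H ≃ₗ[k] E).trans eE))
  have : (mulHom j i : H ⊗[k] A →ₗ[k] E) = e := by
    ext h a
    simp [e, eA, eH, eE, mulEquiv_apply, HopfAlgebra.antipode_mul_antidistrib, ← map_antipode, hA, hH]
  have h2 : ⇑(mulHom j i) = ⇑e := funext fun t => LinearMap.congr_fun this t
  rw [h2]
  exact e.bijective

end

end Factorization

/-- A subspace containing `1` and stable under left multiplication by generators is everything. -/
theorem Submodule.eq_top_of_mul_mem {k P : Type*} [Field k] [Ring P] [Algebra k P] {s : Set P}
    (hs : Algebra.adjoin k s = ⊤) (W : Submodule k P) (hone : (1 : P) ∈ W)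
    (hmul : ∀ x ∈ s, ∀ w ∈ W, x * w ∈ W) : W = ⊤ := by
  have key : ∀ x ∈ Algebra.adjoin k s, ∀ w ∈ W, x * w ∈ W := by
    intro x hx
    induction hx using Algebra.adjoin_induction with
    | mem x hx => exact hmul x hx
    | algebraMap r => intro w hw; rw [← Algebra.smul_def]; exact W.smul_mem r hw
    | add x y _ _ hx hy => intro w hw; rw [add_mul]; exact W.add_mem (hx w hw) (hy w hw)
    | mul x y _ _ hx hy => intro w hw; rw [mul_assoc]; exact hx _ (hy w hw)
  rw [eq_top_iff]
  intro x _
  simpa using key x (hs ▸ Algebra.mem_top) 1 hone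

/-! ### Basis, group-likes and skew-primitives of Sweedler's Hopf algebra. -/

namespace H4

open Coalgebra

variable {k : Type*} [Field k] {B : Type*} [Ring B] [Algebra k B]

theorem rel (k : Type*) [Field k] : HopfGen.Rel4 (G k) (X k) := rel4 k

/-- The values of a map on the generators. -/
def genMap {B : Type*} (a b : B) : Gen → B
  | .G => a
  | .X => b

/-- The algebra map out of Sweedler's algebra given by a pair satisfying its relations. -/
def liftHom {a b : B} (R : HopfGen.Rel4 a b) : H4 k →ₐ[k] B :=
  lift k (genMap a b) R

@[simp] theorem liftHom_G {a b : B} (R : HopfGen.Rel4 a b) : liftHom R (G k) = a :=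
  lift_gen k (genMap a b) R .G

@[simp] theorem liftHom_X {a b : B} (R : HopfGen.Rel4 a b) : liftHom R (X k) = b :=
  lift_gen k (genMap a b) R .X

theorem adjoin_eq_top : Algebra.adjoin k {G k, X k} = ⊤ := by
  have := HopfGen.adjoin_ringQuot (Rel k)
  refine top_le_iff.mp (this.symm.le.trans (Algebra.adjoin_mono ?_))
  rintro _ ⟨(_ | _), rfl⟩
  · exact Or.inl rfl
  · exact Or.inr rfl

theorem hom_ext {φ ψ : H4 k →ₐ[k] B} (hG : φ (G k) = ψ (G k)) (hX : φ (X k) = ψ (X k)) :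
    φ = ψ := by
  refine AlgHom.ext_of_adjoin_eq_top adjoin_eq_top ?_
  rintro _ (rfl | rfl)
  · exact hG
  · exact hX

@[simp] theorem counit_G : counit (R := k) (G k) = 1 := lift_gen k (counitGen k) (rel4_counit k) .G

@[simp] theorem counit_X : counit (R := k) (X k) = 0 := lift_gen k (counitGen k) (rel4_counit k) .X

theorem antipode_G : HopfAlgebra.antipode k (G k) = G k :=
  congrArg MulOpposite.unop (lift_gen k (antipodeGen k) (rel4 k).op .G)

/-- `S(G X) = S(X) S(G) = G X G = -X`. The sign is why the fourth power of the antipode is needed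
and not the square. -/
theorem antipode_antipode_X : HopfAlgebra.antipode k (HopfAlgebra.antipode k (X k)) = -X k := by
  rw [antipode_X, HopfAlgebra.antipode_mul_antidistrib, antipode_X, antipode_G, mul_assoc,
    (rel k).XG, mul_neg, ← mul_assoc, (rel k).GG, one_mul]

theorem antipode_iterate (y : H4 k) : (HopfAlgebra.antipode k)^[4] y = y := by
  -- An even power of the antipode is an algebra map, so it can be compared with the identity on
  -- generators.
  let T : H4 k →ₐ[k] H4 k := AlgHom.ofLinearMap
    ((HopfAlgebra.antipode k) ∘ₗ (HopfAlgebra.antipode k) ∘ₗ (HopfAlgebra.antipode k) ∘ₗ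
      (HopfAlgebra.antipode k)) (by simp)
    (fun x y => by simp [HopfAlgebra.antipode_mul_antidistrib])
  have hT : T = AlgHom.id k _ := by
    apply hom_ext
    · simp [T, antipode_G]
    · simp [T, antipode_antipode_X]
  exact DFunLike.congr_fun hT y

/-- The two-dimensional representation of Sweedler's algebra where `G` acts by `diag(s, -s)`. -/
def rep (s : k) (hs : s * s = 1) : H4 k →ₐ[k] Matrix (Fin 2) (Fin 2) k :=
  liftHom (a := !![s, 0; 0, -s]) (b := !![0, 1; 0, 0]) (by
    constructor <;> ext i j <;> fin_cases i <;> fin_cases j <;> simp [hs])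

theorem rep_one_apply (s : k) (hs : s * s = 1) : rep s hs (1 : H4 k) = !![1, 0; 0, 1] := by
  rw [map_one, Matrix.one_fin_two]

theorem rep_G (s : k) (hs : s * s = 1) : rep s hs (G k) = !![s, 0; 0, -s] := liftHom_G _

theorem rep_X (s : k) (hs : s * s = 1) : rep s hs (X k) = !![0, 1; 0, 0] := liftHom_X _

/-- The entries of a matrix as linear functionals. -/
def entry (i j : Fin 2) : Matrix (Fin 2) (Fin 2) k →ₗ[k] k := Matrix.entryLinearMap k k i j

/-- The coefficient of `1`. -/
def coeffOne (k : Type*) [Field k] : H4 k →ₗ[k] k :=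
  -- On `a + b G + c X + d G X` the representation with sign `s` has diagonal entries `a + s b`, `a
  -- - s b` and corner entry `c + s d`. Half-sums and half-differences of these isolate each
  -- coefficient, here and in the next three functionals.
  (1 / 2 : k) • (entry 0 0 + entry 1 1) ∘ₗ (rep 1 (one_mul 1)).toLinearMap

/-- The coefficient of `G`. -/
def coeffG (k : Type*) [Field k] : H4 k →ₗ[k] k :=
  (1 / 2 : k) • (entry 0 0 - entry 1 1) ∘ₗ (rep 1 (one_mul 1)).toLinearMap

/-- The coefficient of `X`. -/
def coeffX (k : Type*) [Field k] : H4 k →ₗ[k] k :=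
  (1 / 2 : k) • (entry 0 1 ∘ₗ (rep 1 (one_mul 1)).toLinearMap
    + entry 0 1 ∘ₗ (rep (-1) (by simp)).toLinearMap)

/-- The coefficient of `G X`. -/
def coeffGX (k : Type*) [Field k] : H4 k →ₗ[k] k :=
  (1 / 2 : k) • (entry 0 1 ∘ₗ (rep 1 (one_mul 1)).toLinearMap
    - entry 0 1 ∘ₗ (rep (-1) (by simp)).toLinearMap)

section

variable [CharZero k]

@[simp] theorem coeffOne_one : coeffOne k 1 = 1 := by
  simp [coeffOne, entry, -map_one, rep_one_apply]; norm_num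
@[simp] theorem coeffOne_G : coeffOne k (G k) = 0 := by simp [coeffOne, entry, rep_G]
@[simp] theorem coeffOne_X : coeffOne k (X k) = 0 := by simp [coeffOne, entry, rep_X]
@[simp] theorem coeffOne_GX : coeffOne k (G k * X k) = 0 := by
  simp [coeffOne, entry, rep_G, rep_X]
@[simp] theorem coeffG_one : coeffG k 1 = 0 := by
  simp [coeffG, entry, -map_one, rep_one_apply]
@[simp] theorem coeffG_G : coeffG k (G k) = 1 := by simp [coeffG, entry, rep_G]; norm_num
@[simp] theorem coeffG_X : coeffG k (X k) = 0 := by simp [coeffG, entry, rep_X]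
@[simp] theorem coeffG_GX : coeffG k (G k * X k) = 0 := by simp [coeffG, entry, rep_G, rep_X]
@[simp] theorem coeffX_one : coeffX k 1 = 0 := by simp [coeffX, entry, -map_one, rep_one_apply]
@[simp] theorem coeffX_G : coeffX k (G k) = 0 := by simp [coeffX, entry, rep_G]
@[simp] theorem coeffX_X : coeffX k (X k) = 1 := by simp [coeffX, entry, rep_X]; norm_num
@[simp] theorem coeffX_GX : coeffX k (G k * X k) = 0 := by simp [coeffX, entry, rep_G, rep_X]
@[simp] theorem coeffGX_one : coeffGX k 1 = 0 := by simp [coeffGX, entry, -map_one, rep_one_apply]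
@[simp] theorem coeffGX_G : coeffGX k (G k) = 0 := by simp [coeffGX, entry, rep_G]
@[simp] theorem coeffGX_X : coeffGX k (X k) = 0 := by simp [coeffGX, entry, rep_X]
@[simp] theorem coeffGX_GX : coeffGX k (G k * X k) = 1 := by
  simp [coeffGX, entry, rep_G, rep_X]; norm_num

/-- The span of `1`, `G`, `X`, `G X` is stable under left multiplication by the generators, hence
everything; the four functionals are dual to this spanning family. -/
theorem eq_coeff (y : H4 k) : y = coeffOne k y • (1 : H4 k) + coeffG k y • G k + coeffX k y • X k
    + coeffGX k y • (G k * X k) := by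
  let W : Submodule k (H4 k) := Submodule.span k {1, G k, X k, G k * X k}
  have hW : W = ⊤ := by
    refine Submodule.eq_top_of_mul_mem adjoin_eq_top W (Submodule.subset_span (by simp)) ?_
    intro x hx w hw
    have h1 : (1 : H4 k) ∈ W := Submodule.subset_span (by simp)
    have hG : G k ∈ W := Submodule.subset_span (by simp)
    have hX : X k ∈ W := Submodule.subset_span (by simp)
    have hGX : G k * X k ∈ W := Submodule.subset_span (by simp)
    induction hw using Submodule.span_induction with
    | zero => simp
    | add a b _ _ ha hb => rw [mul_add]; exact W.add_mem ha hb
    | smul r a _ ha => rw [mul_smul_comm]; exact W.smul_mem r ha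
    | mem w hw =>
      rcases hx with (rfl | rfl) <;> rcases hw with (rfl | rfl | rfl | rfl)
      · simpa
      · simpa [(rel k).GG]
      · exact hGX
      · simpa [← mul_assoc, (rel k).GG]
      · simpa
      · simpa [(rel k).XG]
      · simp [(rel k).XX]
      · simp [← mul_assoc, (rel k).XG, mul_assoc (G k), (rel k).XX]
  have hy : y ∈ W := hW ▸ Submodule.mem_top
  induction hy using Submodule.span_induction with
  | zero => simp
  | add a b _ _ ha hb => conv_lhs => rw [ha, hb]
                         simp only [map_add]; module
  | smul r a _ ha => conv_lhs => rw [ha]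
                     simp only [map_smul]; module
  | mem w hw => rcases hw with (rfl | rfl | rfl | rfl) <;> simp

theorem comul_GX : comul (R := k) (G k * X k)
    = (G k * X k) ⊗ₜ[k] (1 : H4 k) + G k ⊗ₜ (G k * X k) := by
  rw [Bialgebra.comul_mul, comul_G, comul_X]
  simp [mul_add, (rel k).GG]

theorem comul_eq (a b c d : k) : comul (R := k) (a • (1 : H4 k) + b • G k + c • X k
    + d • (G k * X k)) = a • ((1 : H4 k) ⊗ₜ[k] (1 : H4 k)) + b • (G k ⊗ₜ[k] G k)
      + c • (X k ⊗ₜ[k] G k + 1 ⊗ₜ[k] X k) + d • ((G k * X k) ⊗ₜ[k] (1 : H4 k)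
      + G k ⊗ₜ (G k * X k)) := by
  simp only [map_add, map_smul, comul_GX, comul_G, comul_X, Bialgebra.comul_one,
    Algebra.TensorProduct.one_def]

/-- The group-like elements of Sweedler's Hopf algebra are `1` and `G`. -/
theorem eq_one_or_eq_G {y : H4 k} (hε : counit (R := k) y = 1) (hy : comul (R := k) y = y ⊗ₜ y) :
    y = 1 ∨ y = G k := by
  obtain ⟨a, b, c, d, rfl⟩ : ∃ a b c d : k, y = a • (1 : H4 k) + b • G k + c • X k
    + d • (G k * X k) := ⟨_, _, _, _, eq_coeff y⟩
  rw [comul_eq] at hy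
  -- The coefficients of `X ⊗ X`, `G X ⊗ G X` and `1 ⊗ G` are zero on the left, so `c² = 0`, `d² =
  -- 0` and `a b = 0`.
  have hcc := congrArg (LinearMap.mul' k k ∘ TensorProduct.map (coeffX k) (coeffX k)) hy
  have hdd := congrArg (LinearMap.mul' k k ∘ TensorProduct.map (coeffGX k) (coeffGX k)) hy
  have hab := congrArg (LinearMap.mul' k k ∘ TensorProduct.map (coeffOne k) (coeffG k)) hy
  simp at hcc hdd hab hε
  obtain rfl : c = 0 := hcc
  obtain rfl : d = 0 := hdd
  rcases hab with rfl | rfl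
  · right; simp_all
  · left; simp_all

/-- The `(1, G)`-primitive elements of Sweedler's Hopf algebra are spanned by `X` and `1 - G`. -/
theorem eq_of_skewPrimitive {y : H4 k} (hy : comul (R := k) y = y ⊗ₜ G k + 1 ⊗ₜ y) :
    y = coeffX k y • X k + coeffOne k y • (1 - G k) := by
  obtain ⟨a, b, c, d, rfl⟩ : ∃ a b c d : k, y = a • (1 : H4 k) + b • G k + c • X k
    + d • (G k * X k) := ⟨_, _, _, _, eq_coeff y⟩
  rw [comul_eq] at hy
  -- The coefficient of `G X ⊗ 1` gives `d = 0`, that of `1 ⊗ G` gives `a + b = 0`.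
  have hd := congrArg (LinearMap.mul' k k ∘ TensorProduct.map (coeffGX k) (coeffOne k)) hy
  have hab := congrArg (LinearMap.mul' k k ∘ TensorProduct.map (coeffOne k) (coeffG k)) hy
  simp at hd hab
  subst hd
  have hb : b = -a := by linear_combination -hab
  subst hb
  simp
  module

end

end H4

/-! ### Universal property and test functionals of the Kac–Paljutkin algebra. -/

namespace H8

open Coalgebra

variable {k : Type*} [Field k] [CharZero k] {B : Type*} [Ring B] [Algebra k B]

theorem rel (k : Type*) [Field k] [CharZero k] : HopfGen.Rel8 k (g k) (h k) (z k) := rel8 k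

/-- The values of a map on the generators. -/
def genMap {B : Type*} (a b c : B) : Gen → B
  | .g => a
  | .h => b
  | .z => c

/-- The algebra map out of the Kac-Paljutkin algebra given by a triple satisfying its relations. -/
def liftHom {a b c : B} (R : HopfGen.Rel8 k a b c) : H8 k →ₐ[k] B :=
  lift k (genMap a b c) R

@[simp] theorem liftHom_g {a b c : B} (R : HopfGen.Rel8 k a b c) : liftHom R (g k) = a :=
  lift_gen k (genMap a b c) R .g

@[simp] theorem liftHom_h {a b c : B} (R : HopfGen.Rel8 k a b c) : liftHom R (h k) = b :=
  lift_gen k (genMap a b c) R .h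

@[simp] theorem liftHom_z {a b c : B} (R : HopfGen.Rel8 k a b c) : liftHom R (z k) = c :=
  lift_gen k (genMap a b c) R .z

theorem adjoin_eq_top : Algebra.adjoin k {g k, h k, z k} = ⊤ := by
  have := HopfGen.adjoin_ringQuot (Rel k)
  refine top_le_iff.mp (this.symm.le.trans (Algebra.adjoin_mono ?_))
  rintro _ ⟨(_ | _ | _), rfl⟩
  · exact Or.inl rfl
  · exact Or.inr (Or.inl rfl)
  · exact Or.inr (Or.inr rfl)

theorem hom_ext {φ ψ : H8 k →ₐ[k] B} (hg : φ (g k) = ψ (g k)) (hh : φ (h k) = ψ (h k))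
    (hz : φ (z k) = ψ (z k)) : φ = ψ := by
  refine AlgHom.ext_of_adjoin_eq_top adjoin_eq_top ?_
  rintro _ (rfl | rfl | rfl)
  · exact hg
  · exact hh
  · exact hz

@[simp] theorem counit_g : counit (R := k) (g k) = 1 :=
  lift_gen k (counitGen k) (rel8_counit k) .g

@[simp] theorem counit_h : counit (R := k) (h k) = 1 :=
  lift_gen k (counitGen k) (rel8_counit k) .h

@[simp] theorem counit_z : counit (R := k) (z k) = 1 :=
  lift_gen k (counitGen k) (rel8_counit k) .z

theorem comul_g : comul (R := k) (g k) = g k ⊗ₜ g k :=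
  lift_gen k (comulGen k) (rel8 k).comul .g

theorem comul_h : comul (R := k) (h k) = h k ⊗ₜ h k :=
  lift_gen k (comulGen k) (rel8 k).comul .h

theorem comul_z' : comul (R := k) (z k) = HopfGen.comulZ k (g k) (h k) (z k) := comul_z k

theorem comul_z_eq : comul (R := k) (z k) = (1 / 2 : k) • (z k ⊗ₜ[k] z k + (g k * z k) ⊗ₜ z k
    + z k ⊗ₜ (h k * z k) - (g k * z k) ⊗ₜ (h k * z k)) := by
  rw [comul_z]
  simp [add_mul, sub_mul]

theorem antipode_g : HopfAlgebra.antipode k (g k) = g k :=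
  congrArg MulOpposite.unop (lift_gen k (antipodeGen k) (rel8 k).op .g)

theorem antipode_h : HopfAlgebra.antipode k (h k) = h k :=
  congrArg MulOpposite.unop (lift_gen k (antipodeGen k) (rel8 k).op .h)

theorem antipode_z : HopfAlgebra.antipode k (z k) = z k :=
  congrArg MulOpposite.unop (lift_gen k (antipodeGen k) (rel8 k).op .z)

theorem antipode_iterate (y : H8 k) : (HopfAlgebra.antipode k)^[4] y = y := by
  let T : H8 k →ₐ[k] H8 k := AlgHom.ofLinearMap
    ((HopfAlgebra.antipode k) ∘ₗ (HopfAlgebra.antipode k) ∘ₗ (HopfAlgebra.antipode k) ∘ₗ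
      (HopfAlgebra.antipode k)) (by simp)
    (fun x y => by simp [HopfAlgebra.antipode_mul_antidistrib])
  have hT : T = AlgHom.id k _ := by
    apply hom_ext <;> simp [T, antipode_g, antipode_h, antipode_z]
  exact DFunLike.congr_fun hT y

/-- The two-dimensional irreducible representation of the Kac-Paljutkin algebra. -/
def rep (k : Type*) [Field k] [CharZero k] : H8 k →ₐ[k] Matrix (Fin 2) (Fin 2) k :=
  liftHom (a := !![1, 0; 0, -1]) (b := !![-1, 0; 0, 1]) (c := !![0, 1; 1, 0]) (by
    constructor <;> ext i j <;> fin_cases i <;> fin_cases j <;> simp [Matrix.one_fin_two] <;>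
      norm_num)

/-- A functional with values `0`, `1`, `0` on `z`, `g z`, `h z`. -/
def coeffGZ (k : Type*) [Field k] [CharZero k] : H8 k →ₗ[k] k :=
  -- The counit is `1` on `z`, `g z`, `h z`, while the lower left entries of their matrices are `1`,
  -- `-1`, `1`.
  (1 / 2 : k) • (counit - Matrix.entryLinearMap k k 1 0 ∘ₗ (rep k).toLinearMap)

/-- A functional with values `0`, `0`, `1` on `z`, `g z`, `h z`. -/
def coeffHZ (k : Type*) [Field k] [CharZero k] : H8 k →ₗ[k] k :=
  (1 / 2 : k) • (counit - Matrix.entryLinearMap k k 0 1 ∘ₗ (rep k).toLinearMap)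

@[simp] theorem coeffGZ_z : coeffGZ k (z k) = 0 := by simp [coeffGZ, rep]
@[simp] theorem coeffGZ_gz : coeffGZ k (g k * z k) = 1 := by simp [coeffGZ, rep]; norm_num
@[simp] theorem coeffGZ_hz : coeffGZ k (h k * z k) = 0 := by simp [coeffGZ, rep]
@[simp] theorem coeffHZ_z : coeffHZ k (z k) = 0 := by simp [coeffHZ, rep]
@[simp] theorem coeffHZ_gz : coeffHZ k (g k * z k) = 0 := by simp [coeffHZ, rep]
@[simp] theorem coeffHZ_hz : coeffHZ k (h k * z k) = 1 := by simp [coeffHZ, rep]; norm_num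

/-- The square of `z` is invertible. -/
theorem z_mul_inv : z k * (z k * ((1 / 2 : k) • (1 + g k + h k - g k * h k))) = 1 := by
  obtain ⟨gg, hh, gh, zz, gz, hz⟩ := rel k
  have gg2 : ∀ a, g k * (g k * a) = a := fun a => by rw [← mul_assoc, gg, one_mul]
  have hh2 : ∀ a, h k * (h k * a) = a := fun a => by rw [← mul_assoc, hh, one_mul]
  have hg2 : ∀ a, h k * (g k * a) = g k * (h k * a) :=
    fun a => by rw [← mul_assoc, ← gh, mul_assoc]
  -- The element `(1/2) (1 + g + h - g h)` is its own inverse, as `g` and `h` are commuting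
  -- involutions; so `z⁴ = 1`.
  rw [← mul_assoc, zz]
  simp [mul_add, add_mul, mul_sub, sub_mul, gg, hh, ← gh, gg2, hg2, mul_assoc, smul_add,
    smul_sub]
  module

/-- An algebra map that is a map of coalgebras on the generators. -/
def liftBialgHom {E : Type*} [Ring E] [HopfAlgebra k E] {a b c : E} (R : HopfGen.Rel8 k a b c)
    (ha : comul (R := k) a = a ⊗ₜ a) (hb : comul (R := k) b = b ⊗ₜ b)
    (hc : comul (R := k) c = HopfGen.comulZ k a b c) (ha' : counit (R := k) a = 1)
    (hb' : counit (R := k) b = 1) (hc' : counit (R := k) c = 1) : H8 k →ₐc[k] E :=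
  BialgHom.ofAlgHom (liftHom R)
    (hom_ext (by simp [ha']) (by simp [hb']) (by simp [hc']))
    (hom_ext (by simp [ha, comul_g]) (by simp [hb, comul_h])
      (by simp [hc, comul_z', HopfGen.comulZ]))

end H8

namespace H4

open Coalgebra

/-- An algebra map that is a map of coalgebras on the generators. -/
def liftBialgHom {k : Type*} [Field k] {E : Type*} [Ring E] [HopfAlgebra k E] {a b : E}
    (R : HopfGen.Rel4 a b)
    (ha : comul (R := k) a = a ⊗ₜ a) (hb : comul (R := k) b = HopfGen.comulX k a b)
    (ha' : counit (R := k) a = 1) (hb' : counit (R := k) b = 0) : H4 k →ₐc[k] E :=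
  BialgHom.ofAlgHom (liftHom R)
    (hom_ext (by simp [ha']) (by simp [hb']))
    (hom_ext (by simp [ha, comul_G]) (by simp [hb, comul_X, HopfGen.comulX]))

end H4

open Coalgebra Factorization

section

variable {k : Type*} [Field k] [CharZero k]

theorem HopfGen.Rel8.map {B C : Type*} [Ring B] [Algebra k B] [Ring C] [Algebra k C] {a b c : B}
    (R : HopfGen.Rel8 k a b c) (f : B →ₐ[k] C) : HopfGen.Rel8 k (f a) (f b) (f c) := by
  obtain ⟨gg, hh, gh, zz, gz, hz⟩ := R
  constructor <;> simp only [← map_mul, ← map_one f, ← map_add, ← map_sub, ← map_smul, gg, hh, gh,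
    zz, gz, hz]

theorem HopfGen.Rel4.map {B C : Type*} [Ring B] [Algebra k B] [Ring C] [Algebra k C] {a b : B}
    (R : HopfGen.Rel4 a b) (f : B →ₐ[k] C) : HopfGen.Rel4 (f a) (f b) := by
  obtain ⟨GG, XX, XG⟩ := R
  constructor <;> simp only [← map_mul, ← map_one f, ← map_neg, GG, XX, XG, map_zero]

/-! ### Twisted tensor products of `H8` and `H4`. -/

namespace Factorization

/-- Left multiplication on the first factor of `H8 ⊗ H4`. -/
def actL (k : Type*) [Field k] [CharZero k] : H8 k →ₐ[k] Module.End k (H8 k ⊗[k] H4 k) :=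
  (Module.End.rTensorAlgHom k (H8 k) (H4 k)).comp (Algebra.lmul k (H8 k))

@[simp] theorem actL_apply (x a : H8 k) (b : H4 k) : actL k x (a ⊗ₜ b) = (x * a) ⊗ₜ b := rfl

/-- The action of an element of `H4` twisted by an endomorphism of `H8`. -/
def actR (σ : H8 k →ₐ[k] H8 k) (y : H4 k) : Module.End k (H8 k ⊗[k] H4 k) :=
  TensorProduct.map σ.toLinearMap (LinearMap.mulLeft k y)

@[simp] theorem actR_apply (σ : H8 k →ₐ[k] H8 k) (y : H4 k) (a : H8 k) (b : H4 k) :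
    actR σ y (a ⊗ₜ b) = σ a ⊗ₜ (y * b) := rfl

/-- `G² = 1` needs `σ² = 1` and `X G = -G X` needs `σ`, `τ` to commute. Nothing is needed for `X² =
0`, which already holds on the second factor. -/
theorem rel4_actR {σ τ : H8 k →ₐ[k] H8 k} (hσ : ∀ a, σ (σ a) = a) (hστ : ∀ a, τ (σ a) = σ (τ a)) :
    HopfGen.Rel4 (actR σ (H4.G k)) (actR τ (H4.X k)) := by
  obtain ⟨GG, XX, XG⟩ := H4.rel k
  constructor <;> ext a b <;>
    simp [← mul_assoc, hσ, hστ, GG, XX, XG, TensorProduct.tmul_neg]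

variable {E : Type*} [Ring E] [HopfAlgebra k E] {i : H8 k →ₐc[k] E} {j : H4 k →ₐc[k] E}

/-- Because `σ` is multiplicative, the elements that `y` passes with twist `σ` form a subalgebra. -/
theorem comm_of_gen {σ : H8 k →ₐ[k] H8 k} {y : E} (hg : y * i (H8.g k) = i (σ (H8.g k)) * y)
    (hh : y * i (H8.h k) = i (σ (H8.h k)) * y) (hz : y * i (H8.z k) = i (σ (H8.z k)) * y)
    (a : H8 k) : y * i a = i (σ a) * y := by
  have ha : a ∈ Algebra.adjoin k {H8.g k, H8.h k, H8.z k} := by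
    rw [H8.adjoin_eq_top]; exact Algebra.mem_top
  induction ha using Algebra.adjoin_induction with
  | mem x hx => rcases hx with (rfl | rfl | rfl) <;> assumption
  | algebraMap r =>
    rw [AlgHomClass.commutes, AlgHomClass.commutes, AlgHomClass.commutes]
    exact (Algebra.commutes r y).symm
  | add x x' _ _ hx hx' => simp only [map_add, mul_add, add_mul, hx, hx']
  | mul x x' _ _ hx hx' => rw [map_mul, ← mul_assoc, hx, mul_assoc, hx', ← mul_assoc, map_mul, map_mul]

/-- A criterion for an algebra to be a twisted tensor product of `H8` and `H4`. -/
theorem bijective_mulHom {σ τ : H8 k →ₐ[k] H8 k}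
    (hgen : Algebra.adjoin k {i (H8.g k), i (H8.h k), i (H8.z k), j (H4.G k), j (H4.X k)} = ⊤)
    (hG : ∀ a, j (H4.G k) * i a = i (σ a) * j (H4.G k))
    (hX : ∀ a, j (H4.X k) * i a = i (τ a) * j (H4.X k))
    (Ψ : E →ₐ[k] Module.End k (H8 k ⊗[k] H4 k))
    (hΨ : ∀ a, Ψ (i a) = actL k a) (hΨG : Ψ (j (H4.G k)) = actR σ (H4.G k))
    (hΨX : Ψ (j (H4.X k)) = actR τ (H4.X k)) : Function.Bijective (mulHom i j) := by
  constructor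
  · have key : ∀ b c : H4 k, Ψ (j b) (1 ⊗ₜ c) = 1 ⊗ₜ (b * c) := by
      intro b
      have hb : b ∈ Algebra.adjoin k {H4.G k, H4.X k} := by
        rw [H4.adjoin_eq_top]; exact Algebra.mem_top
      induction hb using Algebra.adjoin_induction with
      | mem x hx => intro c; rcases hx with (rfl | rfl) <;> simp [hΨG, hΨX]
      | algebraMap r => intro c; simp [Algebra.algebraMap_eq_smul_one]
      | add x y _ _ hx hy => intro c; simp [hx, hy, add_mul, TensorProduct.tmul_add]
      | mul x y _ _ hx hy => intro c; simp [hx, hy, mul_assoc]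
    -- Acting on `1 ⊗ 1` inverts the multiplication map on the left: `i(a) j(b)` sends `1 ⊗ 1` to `a
    -- ⊗ b`, since algebra maps `σ`, `τ` fix `1`.
    have hinv : (LinearMap.applyₗ (1 ⊗ₜ 1 : H8 k ⊗[k] H4 k) ∘ₗ Ψ.toLinearMap) ∘ₗ
        (mulHom i j : H8 k ⊗[k] H4 k →ₗ[k] E) = LinearMap.id := by
      ext a b
      simp [hΨ, key]
    exact Function.LeftInverse.injective (g := fun e => Ψ e (1 ⊗ₜ 1)) (LinearMap.congr_fun hinv)
  -- The range contains `1`, and the commutation rules move `G` and `X` past `i(a)`, so it is stable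
  -- under left multiplication by generators.
  · have htop : LinearMap.range (mulHom i j : H8 k ⊗[k] H4 k →ₗ[k] E) = ⊤ := by
      refine Submodule.eq_top_of_mul_mem hgen _ ⟨1 ⊗ₜ 1, by simp⟩ ?_
      have hi (a : H8 k) : ∀ w ∈ LinearMap.range (mulHom i j : H8 k ⊗[k] H4 k →ₗ[k] E),
          i a * w ∈ LinearMap.range (mulHom i j : H8 k ⊗[k] H4 k →ₗ[k] E) := by
        rintro _ ⟨t, rfl⟩
        refine ⟨TensorProduct.map (LinearMap.mulLeft k a) LinearMap.id t, ?_⟩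
        induction t with
        | zero => simp
        | add x y hx hy => simp only [map_add, mul_add, hx, hy]
        | tmul x y => simp [mul_assoc]
      have hj (y : H4 k) (ρ : H8 k →ₐ[k] H8 k) (hy : ∀ a, j y * i a = i (ρ a) * j y) :
          ∀ w ∈ LinearMap.range (mulHom i j : H8 k ⊗[k] H4 k →ₗ[k] E),
          j y * w ∈ LinearMap.range (mulHom i j : H8 k ⊗[k] H4 k →ₗ[k] E) := by
        rintro _ ⟨t, rfl⟩
        refine ⟨actR ρ y t, ?_⟩
        induction t with
        | zero => simp
        | add x y hx hy => simp only [map_add, mul_add, hx, hy]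
        | tmul x y => simp [← mul_assoc, hy]
      rintro x (rfl | rfl | rfl | rfl | rfl)
      · exact hi _
      · exact hi _
      · exact hi _
      · exact hj _ σ hG
      · exact hj _ τ hX
    exact LinearMap.range_eq_top.mp htop

end Factorization

/-! ### The algebra `H_{32,1}` factorizes. -/

namespace H32A

variable {B : Type*} [Ring B] [Algebra k B]

/-- The values of a map on the generators. -/
def genMap {B : Type*} (a b c d e : B) : Gen → B
  | .g => a
  | .h => b
  | .z => c
  | .G => d
  | .X => e

/-- The algebra map out of `H32A` given by elements satisfying its relations. -/
def liftHom {a b c d e : B} (R8 : HopfGen.Rel8 k a b c) (R4 : HopfGen.Rel4 d e)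
    (RC : HopfGen.RelA a b c d e) : H32A k →ₐ[k] B := lift k (genMap a b c d e) R8 R4 RC

section

variable {a b c d e : B} (R8 : HopfGen.Rel8 k a b c) (R4 : HopfGen.Rel4 d e)
    (RC : HopfGen.RelA a b c d e)

@[simp] theorem liftHom_g : liftHom R8 R4 RC (g k) = a :=
  lift_gen k (genMap a b c d e) R8 R4 RC .g

@[simp] theorem liftHom_h : liftHom R8 R4 RC (h k) = b :=
  lift_gen k (genMap a b c d e) R8 R4 RC .h

@[simp] theorem liftHom_z : liftHom R8 R4 RC (z k) = c :=
  lift_gen k (genMap a b c d e) R8 R4 RC .z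

@[simp] theorem liftHom_G : liftHom R8 R4 RC (G k) = d :=
  lift_gen k (genMap a b c d e) R8 R4 RC .G

@[simp] theorem liftHom_X : liftHom R8 R4 RC (X k) = e :=
  lift_gen k (genMap a b c d e) R8 R4 RC .X

end

theorem adjoin_eq_top : Algebra.adjoin k {g k, h k, z k, G k, X k} = ⊤ := by
  have := HopfGen.adjoin_ringQuot (Rel k)
  refine top_le_iff.mp (this.symm.le.trans (Algebra.adjoin_mono ?_))
  rintro _ ⟨(_ | _ | _ | _ | _), rfl⟩
  · exact Or.inl rfl
  · exact Or.inr (Or.inl rfl)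
  · exact Or.inr (Or.inr (Or.inl rfl))
  · exact Or.inr (Or.inr (Or.inr (Or.inl rfl)))
  · exact Or.inr (Or.inr (Or.inr (Or.inr rfl)))

/-- The inclusion of `H8`. -/
def incl8 (k : Type*) [Field k] [CharZero k] : H8 k →ₐc[k] H32A k :=
  H8.liftBialgHom (a := g k) (b := h k) (c := z k) (rel8 k)
    (lift_gen k (comulGen k) (rel8 k).comul (rel4 k).comul (relC k).comul .g)
    (lift_gen k (comulGen k) (rel8 k).comul (rel4 k).comul (relC k).comul .h) (comul_z k)
    (lift_gen k (counitGen k) (rel8_counit k) (rel4_counit k) (relC_counit k) .g)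
    (lift_gen k (counitGen k) (rel8_counit k) (rel4_counit k) (relC_counit k) .h)
    (lift_gen k (counitGen k) (rel8_counit k) (rel4_counit k) (relC_counit k) .z)

/-- The inclusion of `H4`. -/
def incl4 (k : Type*) [Field k] [CharZero k] : H4 k →ₐc[k] H32A k :=
  H4.liftBialgHom (a := G k) (b := X k) (rel4 k)
    (lift_gen k (comulGen k) (rel8 k).comul (rel4 k).comul (relC k).comul .G)
    (lift_gen k (comulGen k) (rel8 k).comul (rel4 k).comul (relC k).comul .X)
    (lift_gen k (counitGen k) (rel8_counit k) (rel4_counit k) (relC_counit k) .G)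
    (lift_gen k (counitGen k) (rel8_counit k) (rel4_counit k) (relC_counit k) .X)

@[simp] theorem incl8_g : incl8 k (H8.g k) = g k := H8.liftHom_g _
@[simp] theorem incl8_h : incl8 k (H8.h k) = h k := H8.liftHom_h _
@[simp] theorem incl8_z : incl8 k (H8.z k) = z k := H8.liftHom_z _
@[simp] theorem incl4_G : incl4 k (H4.G k) = G k := H4.liftHom_G _
@[simp] theorem incl4_X : incl4 k (H4.X k) = X k := H4.liftHom_X _

/-- The automorphism of `H8` with which `X` acts. -/
def twist (k : Type*) [Field k] [CharZero k] : H8 k →ₐ[k] H8 k :=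
  H8.liftHom (a := H8.g k) (b := H8.h k) (c := -H8.z k) (by
    obtain ⟨gg, hh, gh, zz, gz, hz⟩ := H8.rel k
    constructor <;> simp [gg, hh, gh, zz, gz, hz])

@[simp] theorem twist_g : twist k (H8.g k) = H8.g k := H8.liftHom_g _
@[simp] theorem twist_h : twist k (H8.h k) = H8.h k := H8.liftHom_h _
@[simp] theorem twist_z : twist k (H8.z k) = -H8.z k := H8.liftHom_z _

/-- `G` is untwisted and `X` acts through the sign change of `z`; these twisted multiplications
satisfy the defining relations. -/
theorem bijective_mulHom : Function.Bijective (mulHom (incl8 k) (incl4 k)) := by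
  have RC : HopfGen.RelA (g k) (h k) (z k) (G k) (X k) := relC k
  have RL : HopfGen.RelA (actL k (H8.g k)) (actL k (H8.h k)) (actL k (H8.z k))
      (actR (AlgHom.id k _) (H4.G k)) (actR (twist k) (H4.X k)) := by
    constructor <;> ext a b <;> simp [TensorProduct.neg_tmul]
  refine Factorization.bijective_mulHom (σ := AlgHom.id k _) (τ := twist k)
    (by simpa using adjoin_eq_top)
    (comm_of_gen (by simp [RC.gG]) (by simp [RC.hG]) (by simp [RC.zG]))
    (comm_of_gen (by simp [RC.gX]) (by simp [RC.hX]) (by simp [RC.zX]))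
    (liftHom ((H8.rel k).map (actL k)) (rel4_actR (σ := AlgHom.id k _) (τ := twist k)
      (fun _ => rfl) (fun _ => rfl)) RL)
    (fun a => ?_) (by simp) (by simp)
  · exact DFunLike.congr_fun (H8.hom_ext (φ := AlgHom.comp _ (incl8 k : H8 k →ₐ[k] H32A k))
      (by simp) (by simp) (by simp)) a

end H32A

/-! ### The algebras `H_{32,2}` and `H_{32,3}` factorize. -/

namespace H32B

variable {q : k} {B : Type*} [Ring B] [Algebra k B]

/-- The values of a map on the generators. -/
def genMap {B : Type*} (a b c d e : B) : Gen → B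
  | .g => a
  | .h => b
  | .z => c
  | .G => d
  | .X => e

/-- The algebra map out of `H32B` given by elements satisfying its relations. -/
def liftHom {a b c d e : B} (R8 : HopfGen.Rel8 k a b c) (R4 : HopfGen.Rel4 d e)
    (RC : HopfGen.RelB k q a b c d e) : H32B k q →ₐ[k] B := lift k q (genMap a b c d e) R8 R4 RC

section

variable {a b c d e : B} (R8 : HopfGen.Rel8 k a b c) (R4 : HopfGen.Rel4 d e)
    (RC : HopfGen.RelB k q a b c d e)

@[simp] theorem liftHom_g : liftHom R8 R4 RC (g k q) = a :=
  lift_gen k q (genMap a b c d e) R8 R4 RC .g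

@[simp] theorem liftHom_h : liftHom R8 R4 RC (h k q) = b :=
  lift_gen k q (genMap a b c d e) R8 R4 RC .h

@[simp] theorem liftHom_z : liftHom R8 R4 RC (z k q) = c :=
  lift_gen k q (genMap a b c d e) R8 R4 RC .z

@[simp] theorem liftHom_G : liftHom R8 R4 RC (G k q) = d :=
  lift_gen k q (genMap a b c d e) R8 R4 RC .G

@[simp] theorem liftHom_X : liftHom R8 R4 RC (X k q) = e :=
  lift_gen k q (genMap a b c d e) R8 R4 RC .X

end

theorem adjoin_eq_top : Algebra.adjoin k {g k q, h k q, z k q, G k q, X k q} = ⊤ := by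
  have := HopfGen.adjoin_ringQuot (Rel k q)
  refine top_le_iff.mp (this.symm.le.trans (Algebra.adjoin_mono ?_))
  rintro _ ⟨(_ | _ | _ | _ | _), rfl⟩
  · exact Or.inl rfl
  · exact Or.inr (Or.inl rfl)
  · exact Or.inr (Or.inr (Or.inl rfl))
  · exact Or.inr (Or.inr (Or.inr (Or.inl rfl)))
  · exact Or.inr (Or.inr (Or.inr (Or.inr rfl)))

/-- The inclusion of `H8`. -/
def incl8 {k : Type*} [Field k] [CharZero k] (q : k) : H8 k →ₐc[k] H32B k q :=
  H8.liftBialgHom (a := g k q) (b := h k q) (c := z k q) (rel8 k q)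
    (lift_gen k q (comulGen k q) (rel8 k q).comul (rel4 k q).comul ((relC k q).comul (rel8 k q)) .g)
    (lift_gen k q (comulGen k q) (rel8 k q).comul (rel4 k q).comul ((relC k q).comul (rel8 k q)) .h)
    (comul_z k q)
    (lift_gen k q (counitGen k) (rel8_counit k) (rel4_counit k) (relC_counit k q) .g)
    (lift_gen k q (counitGen k) (rel8_counit k) (rel4_counit k) (relC_counit k q) .h)
    (lift_gen k q (counitGen k) (rel8_counit k) (rel4_counit k) (relC_counit k q) .z)

/-- The inclusion of `H4`. -/
def incl4 {k : Type*} [Field k] [CharZero k] (q : k) : H4 k →ₐc[k] H32B k q :=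
  H4.liftBialgHom (a := G k q) (b := X k q) (rel4 k q)
    (lift_gen k q (comulGen k q) (rel8 k q).comul (rel4 k q).comul ((relC k q).comul (rel8 k q)) .G)
    (lift_gen k q (comulGen k q) (rel8 k q).comul (rel4 k q).comul ((relC k q).comul (rel8 k q)) .X)
    (lift_gen k q (counitGen k) (rel8_counit k) (rel4_counit k) (relC_counit k q) .G)
    (lift_gen k q (counitGen k) (rel8_counit k) (rel4_counit k) (relC_counit k q) .X)

@[simp] theorem incl8_g : incl8 q (H8.g k) = g k q := H8.liftHom_g _
@[simp] theorem incl8_h : incl8 q (H8.h k) = h k q := H8.liftHom_h _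
@[simp] theorem incl8_z : incl8 q (H8.z k) = z k q := H8.liftHom_z _
@[simp] theorem incl4_G : incl4 q (H4.G k) = G k q := H4.liftHom_G _
@[simp] theorem incl4_X : incl4 q (H4.X k) = X k q := H4.liftHom_X _

/-- The automorphism of `H8` with which `G` acts. -/
def twistG (k : Type*) [Field k] [CharZero k] : H8 k →ₐ[k] H8 k :=
  H8.liftHom (a := H8.g k) (b := H8.h k) (c := H8.g k * (H8.h k * H8.z k)) (by
    obtain ⟨gg, hh, gh, zz, gz, hz⟩ := H8.rel k
    have gg2 : ∀ a, H8.g k * (H8.g k * a) = a := fun a => by rw [← mul_assoc, gg, one_mul]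
    have hh2 : ∀ a, H8.h k * (H8.h k * a) = a := fun a => by rw [← mul_assoc, hh, one_mul]
    have hg2 : ∀ a, H8.h k * (H8.g k * a) = H8.g k * (H8.h k * a) :=
      fun a => by rw [← mul_assoc, ← gh, mul_assoc]
    have zg2 : ∀ a, H8.z k * (H8.g k * a) = H8.h k * (H8.z k * a) :=
      fun a => by rw [← mul_assoc, ← hz, mul_assoc]
    have zh2 : ∀ a, H8.z k * (H8.h k * a) = H8.g k * (H8.z k * a) :=
      fun a => by rw [← mul_assoc, ← gz, mul_assoc]
    constructor <;> simp [gg, hh, ← gh, zz, ← gz, ← hz, mul_assoc, zg2, zh2, hg2, gg2, hh2])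

/-- The automorphism of `H8` with which `X` acts. -/
def twistX (hq : q ^ 2 = -1) : H8 k →ₐ[k] H8 k :=
  H8.liftHom (a := -H8.g k) (b := -H8.h k) (c := q • (H8.g k * H8.z k)) (by
    obtain ⟨gg, hh, gh, zz, gz, hz⟩ := H8.rel k
    have gg2 : ∀ a, H8.g k * (H8.g k * a) = a := fun a => by rw [← mul_assoc, gg, one_mul]
    have hh2 : ∀ a, H8.h k * (H8.h k * a) = a := fun a => by rw [← mul_assoc, hh, one_mul]
    have hg2 : ∀ a, H8.h k * (H8.g k * a) = H8.g k * (H8.h k * a) :=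
      fun a => by rw [← mul_assoc, ← gh, mul_assoc]
    have zg2 : ∀ a, H8.z k * (H8.g k * a) = H8.h k * (H8.z k * a) :=
      fun a => by rw [← mul_assoc, ← hz, mul_assoc]
    have zh2 : ∀ a, H8.z k * (H8.h k * a) = H8.g k * (H8.z k * a) :=
      fun a => by rw [← mul_assoc, ← gz, mul_assoc]
    -- The relation for `z²` is the only one that uses `q² = -1`: `(q g z)² = q² g h z²`, which must
    -- be `(1/2) (1 - g - h - g h)`.
    rw [pow_two] at hq
    constructor <;> simp [gg, hh, ← gh, zz, ← gz, ← hz, mul_assoc, zg2, hg2, gg2, smul_smul,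
      mul_add, mul_sub]
    rw [show q * (q * (2 : k)⁻¹) = -2⁻¹ by rw [← mul_assoc, hq]; ring]
    module)

@[simp] theorem twistG_g : twistG k (H8.g k) = H8.g k := H8.liftHom_g _
@[simp] theorem twistG_h : twistG k (H8.h k) = H8.h k := H8.liftHom_h _
@[simp] theorem twistG_z : twistG k (H8.z k) = H8.g k * (H8.h k * H8.z k) := H8.liftHom_z _
@[simp] theorem twistX_g (hq : q ^ 2 = -1) : twistX hq (H8.g k) = -H8.g k := H8.liftHom_g _
@[simp] theorem twistX_h (hq : q ^ 2 = -1) : twistX hq (H8.h k) = -H8.h k := H8.liftHom_h _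
@[simp] theorem twistX_z (hq : q ^ 2 = -1) : twistX hq (H8.z k) = q • (H8.g k * H8.z k) :=
  H8.liftHom_z _

theorem twistG_twistG (a : H8 k) : twistG k (twistG k a) = a := by
  refine DFunLike.congr_fun (H8.hom_ext (φ := (twistG k).comp (twistG k)) (ψ := AlgHom.id k _)
    (by simp) (by simp) ?_) a
  obtain ⟨gg, hh, gh, zz, gz, hz⟩ := H8.rel k
  simp only [AlgHom.comp_apply, twistG_z, map_mul, twistG_g, twistG_h, AlgHom.id_apply]
  rw [← mul_assoc (H8.h k) (H8.g k), ← gh, mul_assoc, ← mul_assoc (H8.g k), gg, one_mul,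
    ← mul_assoc, hh, one_mul]

theorem twistX_twistG (hq : q ^ 2 = -1) (a : H8 k) :
    twistX hq (twistG k a) = twistG k (twistX hq a) := by
  refine DFunLike.congr_fun (H8.hom_ext (φ := (twistX hq).comp (twistG k))
    (ψ := (twistG k).comp (twistX hq)) (by simp) (by simp) ?_) a
  have gh := (H8.rel k).gh
  simp [← mul_assoc, gh]

/-- The twists are those that the relations force on `H8` when `G` and `X` are moved to the right.
The condition on `q` is essential: otherwise `X = 0` by `HopfGen.RelB.sq_smul`. -/
theorem bijective_mulHom (hq : q ^ 2 = -1) : Function.Bijective (mulHom (incl8 q) (incl4 q)) := by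
  have R8 : HopfGen.Rel8 k (g k q) (h k q) (z k q) := rel8 k q
  have RC : HopfGen.RelB k q (g k q) (h k q) (z k q) (G k q) (X k q) := relC k q
  have hzG := RC.zG R8
  have hq' : q * q = -1 := by rw [← pow_two, hq]
  have RL : HopfGen.RelB k q (actL k (H8.g k)) (actL k (H8.h k)) (actL k (H8.z k))
      (actR (twistG k) (H4.G k)) (actR (twistX hq) (H4.X k)) := by
    obtain ⟨gg, hh, gh, zz, gz, hz⟩ := H8.rel k
    have gg2 : ∀ a, H8.g k * (H8.g k * a) = a := fun a => by rw [← mul_assoc, gg, one_mul]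
    have hh2 : ∀ a, H8.h k * (H8.h k * a) = a := fun a => by rw [← mul_assoc, hh, one_mul]
    have hg2 : ∀ a, H8.h k * (H8.g k * a) = H8.g k * (H8.h k * a) :=
      fun a => by rw [← mul_assoc, ← gh, mul_assoc]
    constructor <;> ext a b <;>
      simp [TensorProduct.neg_tmul, mul_assoc, gg2, hh2, hg2, TensorProduct.smul_tmul', smul_smul,
        hq']
  refine Factorization.bijective_mulHom (σ := twistG k) (τ := twistX hq)
    (by simpa using adjoin_eq_top)
    (comm_of_gen (by simp [RC.gG]) (by simp [RC.hG]) ?_)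
    (comm_of_gen (by simp [RC.gX]) (by simp [RC.hX]) ?_)
    (liftHom ((H8.rel k).map (actL k)) (rel4_actR twistG_twistG (twistX_twistG hq)) RL)
    (fun a => ?_) (by simp) (by simp)
  · obtain ⟨gg, hh, gh, zz, gz, hz⟩ := R8
    simp only [incl4_G, incl8_z, twistG_z, map_mul, incl8_g, incl8_h]
    rw [mul_assoc, mul_assoc, hzG, ← mul_assoc (h k q) (G k q), RC.hG, mul_assoc (G k q),
      ← mul_assoc (g k q) (G k q), RC.gG]
    simp only [← mul_assoc]
    rw [mul_assoc _ (g k q) (h k q), gh]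
    simp only [← mul_assoc]
    rw [mul_assoc _ (h k q) (h k q), hh, mul_one, mul_assoc _ (g k q) (g k q), gg, mul_one]
  -- The relation `z X = q X g z` is inverted: `q g z X = q² g X g z = -g X g z = X z`.
  · simp only [incl4_X, incl8_z, twistX_z, map_mul, map_smul, incl8_g]
    rw [smul_mul_assoc, mul_assoc, RC.zX, mul_smul_comm, smul_smul, hq', mul_assoc (X k q),
      ← mul_assoc (g k q), RC.gX, neg_mul, mul_assoc, ← mul_assoc (g k q), R8.gg]
    simp
  · exact DFunLike.congr_fun (H8.hom_ext (φ := AlgHom.comp _ (incl8 q : H8 k →ₐ[k] H32B k q))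
      (by simp) (by simp) (by simp)) a

end H32B

/-! ### The tensor product as a factorization. -/

namespace Factorization

/-- The inclusion of the first factor of a tensor product of Hopf algebras. -/
def inl (k A H : Type*) [Field k] [Ring A] [HopfAlgebra k A] [Ring H] [HopfAlgebra k H] :
    A →ₐc[k] A ⊗[k] H :=
  { inlHom k A H with
    map_one' := by simp [Algebra.TensorProduct.one_def]
    map_mul' := fun a b => by simp }

/-- The inclusion of the second factor of a tensor product of Hopf algebras. -/
def inr (k A H : Type*) [Field k] [Ring A] [HopfAlgebra k A] [Ring H] [HopfAlgebra k H] :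
    H →ₐc[k] A ⊗[k] H :=
  { inrHom k A H with
    map_one' := by simp [Algebra.TensorProduct.one_def]
    map_mul' := fun a b => by simp }

section

variable {A H : Type*} [Ring A] [HopfAlgebra k A] [Ring H] [HopfAlgebra k H]

@[simp] theorem inl_apply (a : A) : inl k A H a = a ⊗ₜ 1 := inlHom_apply a

@[simp] theorem inr_apply (h : H) : inr k A H h = 1 ⊗ₜ h := inrHom_apply h

theorem bijective_mulHom_inl_inr : Function.Bijective (mulHom (inl k A H) (inr k A H)) := by
  have : (mulHom (inl k A H) (inr k A H) : A ⊗[k] H →ₗ[k] A ⊗[k] H) = LinearMap.id := by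
    ext a h; simp
  have h2 : ⇑(mulHom (inl k A H) (inr k A H)) = id := funext (LinearMap.congr_fun this)
  rw [h2]
  exact Function.bijective_id

end

end Factorization

end

/-! ### Normal forms of `G a` and `X a` in a factorization through `H8` and `H4`. -/

namespace Factorization

variable {k : Type*} [Field k]

section

variable {A E V W : Type*} [Ring A] [HopfAlgebra k A] [Ring E] [HopfAlgebra k E]
  [AddCommMonoid V] [Module k V] [AddCommMonoid W] [Module k W]

theorem map_tmul_mul_map (i : A →ₐc[k] E) (u : E →ₗ[k] V) (v : E →ₗ[k] W) (x y : E)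
    (t : A ⊗[k] A) :
    TensorProduct.map u v ((x ⊗ₜ y) * TensorProduct.map (i : A →ₗ[k] E) (i : A →ₗ[k] E) t)
      = TensorProduct.map (u ∘ₗ LinearMap.mulLeft k x ∘ₗ (i : A →ₗ[k] E))
          (v ∘ₗ LinearMap.mulLeft k y ∘ₗ (i : A →ₗ[k] E)) t := by
  induction t with
  | zero => simp
  | add s t hs ht => simp only [map_add, mul_add, hs, ht]
  | tmul a b => simp

/-- `a ↦ a₁ φ(a₂)`. -/
def convR (φ : A →ₗ[k] k) : A →ₗ[k] A :=
  (TensorProduct.rid k A : A ⊗[k] k →ₗ[k] A) ∘ₗ TensorProduct.map LinearMap.id φ ∘ₗ comul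

/-- `a ↦ φ(a₁) σ(a₂)`. -/
def convL (φ : A →ₗ[k] k) (σ : A →ₗ[k] A) : A →ₗ[k] A :=
  (TensorProduct.lid k A : k ⊗[k] A →ₗ[k] A) ∘ₗ TensorProduct.map φ σ ∘ₗ comul

/-- The functional is recovered from its convolution operator, so identities between operators
descend to functionals. -/
theorem counit_convR (φ : A →ₗ[k] k) (a : A) : counit (R := k) (convR φ a) = φ a := by
  have key : ∀ t : A ⊗[k] A, counit (R := k) (TensorProduct.rid k A
      (TensorProduct.map LinearMap.id φ t)) = φ (TensorProduct.lid k A (counit.rTensor A t)) := by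
    intro t
    induction t with
    | zero => simp
    | add x y hx hy => simp only [map_add, hx, hy]
    | tmul x y => simp [mul_comm]
  change counit (R := k) (TensorProduct.rid k A (TensorProduct.map LinearMap.id φ (comul a))) = _
  rw [key]
  simp

end

variable [CharZero k] {E : Type*} [Ring E] [HopfAlgebra k E]
  {i : H8 k →ₐc[k] E} {j : H4 k →ₐc[k] E}

/-- The coefficient of a basis element of `H4` in an element of `H8 ⊗ H4`. -/
def coeffL (c : H4 k →ₗ[k] k) : H8 k ⊗[k] H4 k →ₗ[k] H8 k :=
  (TensorProduct.rid k (H8 k) : H8 k ⊗[k] k →ₗ[k] H8 k) ∘ₗ TensorProduct.map LinearMap.id c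

@[simp] theorem coeffL_tmul (c : H4 k →ₗ[k] k) (a : H8 k) (b : H4 k) :
    coeffL c (a ⊗ₜ b) = c b • a := rfl

/-- `E` is free over `H8` with basis `1`, `G`, `X`, `G X`. -/
theorem eq_of_sum_eq (hm : Function.Bijective (mulHom i j)) {a b c d a' b' c' d' : H8 k}
    (h : i a + i b * j (H4.G k) + i c * j (H4.X k) + i d * j (H4.G k * H4.X k)
      = i a' + i b' * j (H4.G k) + i c' * j (H4.X k) + i d' * j (H4.G k * H4.X k)) :
    a = a' ∧ b = b' ∧ c = c' ∧ d = d' := by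
  have key (a b c d : H8 k) : (mulEquiv hm).symm (i a + i b * j (H4.G k) + i c * j (H4.X k)
      + i d * j (H4.G k * H4.X k)) = a ⊗ₜ 1 + b ⊗ₜ H4.G k + c ⊗ₜ H4.X k
        + d ⊗ₜ (H4.G k * H4.X k) := by
    have : i a = i a * j 1 := by simp
    rw [this]
    simp only [map_add, mulEquiv_symm_mul]
  have h2 := congrArg (mulEquiv hm).symm h
  rw [key, key] at h2
  refine ⟨?_, ?_, ?_, ?_⟩
  · simpa using congrArg (coeffL (H4.coeffOne k)) h2
  · simpa using congrArg (coeffL (H4.coeffG k)) h2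
  · simpa using congrArg (coeffL (H4.coeffX k)) h2
  · simpa using congrArg (coeffL (H4.coeffGX k)) h2

section

variable {V W : Type*} [AddCommMonoid V] [Module k V] [AddCommMonoid W] [Module k W]

/-- `a ↦ j(x) i(a)`. -/
def leftMul (i : H8 k →ₐc[k] E) (j : H4 k →ₐc[k] E) (x : H4 k) : H8 k →ₗ[k] E :=
  LinearMap.mulLeft k (j x) ∘ₗ (i : H8 k →ₗ[k] E)

@[simp] theorem leftMul_apply (x : H4 k) (a : H8 k) : leftMul i j x a = j x * i a := rfl

theorem map_comul_G_mul (u : E →ₗ[k] V) (v : E →ₗ[k] W) (a : H8 k) :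
    TensorProduct.map u v (comul (j (H4.G k) * i a))
      = TensorProduct.map (u ∘ₗ leftMul i j (H4.G k)) (v ∘ₗ leftMul i j (H4.G k)) (comul a) := by
  rw [Bialgebra.comul_mul, ← CoalgHomClass.map_comp_comul_apply i,
    ← CoalgHomClass.map_comp_comul_apply j, H4.comul_G]
  exact map_tmul_mul_map i u v _ _ _

/-- This is `Δ(X a) = ∑ X a₁ ⊗ G a₂ + ∑ a₁ ⊗ X a₂`, in a form to which the two projections can be
applied. -/
theorem map_comul_X_mul (u : E →ₗ[k] V) (v : E →ₗ[k] W) (a : H8 k) :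
    TensorProduct.map u v (comul (j (H4.X k) * i a))
      = TensorProduct.map (u ∘ₗ leftMul i j (H4.X k)) (v ∘ₗ leftMul i j (H4.G k)) (comul a)
        + TensorProduct.map (u ∘ₗ (i : H8 k →ₗ[k] E)) (v ∘ₗ leftMul i j (H4.X k)) (comul a) := by
  rw [Bialgebra.comul_mul, ← CoalgHomClass.map_comp_comul_apply i,
    ← CoalgHomClass.map_comp_comul_apply j, H4.comul_X, map_add, add_mul, map_add]
  congr 1
  · exact map_tmul_mul_map i u v _ _ _
  · refine (map_tmul_mul_map i u v (j 1) _ _).trans ?_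
    congr 2
    ext; simp

end

section

variable (hm : Function.Bijective (mulHom i j))

/-- `a ↦ x ▷ a`. -/
def actMap (x : H4 k) : H8 k →ₗ[k] H8 k := (projL hm : E →ₗ[k] H8 k) ∘ₗ leftMul i j x

/-- `a ↦ x ◁ a`. -/
def coactMap (x : H4 k) : H8 k →ₗ[k] H4 k := (projR hm : E →ₗ[k] H4 k) ∘ₗ leftMul i j x

theorem actMap_apply (x : H4 k) (a : H8 k) : actMap hm x a = projL hm (j x * i a) := rfl

theorem coactMap_apply (x : H4 k) (a : H8 k) : coactMap hm x a = projR hm (j x * i a) := rfl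

theorem actMap_G_G (a : H8 k) : actMap hm (H4.G k) (actMap hm (H4.G k) a) = a := by
  rw [actMap_apply, actMap_apply, ← projL_mul_eq, ← mul_assoc, ← map_mul, (H4.rel k).GG]
  simp

theorem map_actMap_coactMap_G (a : H8 k) :
    TensorProduct.map (actMap hm (H4.G k)) (coactMap hm (H4.G k)) (comul a)
      = (mulEquiv hm).symm (j (H4.G k) * i a) := by
  rw [← map_projL_projR_comul]
  exact (map_comul_G_mul _ _ a).symm

/-- The compatibility condition is `∑ (G ◁ a₁) ⊗ (G ▷ a₂) = ∑ (G ◁ a₂) ⊗ (G ▷ a₁)`. Since `G ▷` is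
an involution, it can be cancelled from the second leg. -/
theorem coactMap_cocentral (a : H8 k) :
    TensorProduct.map (coactMap hm (H4.G k)) LinearMap.id (comul a)
      = TensorProduct.map (coactMap hm (H4.G k)) LinearMap.id
          (TensorProduct.comm k (H8 k) (H8 k) (comul a)) := by
  have h1 : TensorProduct.map (coactMap hm (H4.G k)) (actMap hm (H4.G k)) (comul a)
      = TensorProduct.comm k _ _
        (TensorProduct.map (actMap hm (H4.G k)) (coactMap hm (H4.G k)) (comul a)) := by
    rw [map_actMap_coactMap_G, ← map_projR_projL_comul]
    exact (map_comul_G_mul _ _ a).symm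
  rw [← TensorProduct.map_comm] at h1
  have h2 := congrArg (TensorProduct.map LinearMap.id (actMap hm (H4.G k))) h1
  rw [TensorProduct.map_map, TensorProduct.map_map] at h2
  have h3 : actMap hm (H4.G k) ∘ₗ actMap hm (H4.G k) = LinearMap.id :=
    LinearMap.ext (actMap_G_G hm)
  rwa [h3, LinearMap.id_comp] at h2

theorem comul_coactMap_G (a : H8 k) : comul (coactMap hm (H4.G k) a)
    = TensorProduct.map (coactMap hm (H4.G k)) (coactMap hm (H4.G k)) (comul a) := by
  rw [coactMap_apply, ← CoalgHomClass.map_comp_comul_apply (projR hm)]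
  exact map_comul_G_mul _ _ a

theorem counit_actMap_G (a : H8 k) :
    counit (R := k) (actMap hm (H4.G k) a) = counit (R := k) a := by
  rw [actMap_apply, CoalgHomClass.counit_comp_apply (projL hm), Bialgebra.counit_mul,
    CoalgHomClass.counit_comp_apply j, CoalgHomClass.counit_comp_apply i]
  simp

theorem counit_coactMap_G (a : H8 k) :
    counit (R := k) (coactMap hm (H4.G k) a) = counit (R := k) a := by
  rw [coactMap_apply, CoalgHomClass.counit_comp_apply (projR hm), Bialgebra.counit_mul,
    CoalgHomClass.counit_comp_apply j, CoalgHomClass.counit_comp_apply i]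
  simp

theorem eq_mul_of_symm_eq {e : E} {a : H8 k} {b : H4 k} (h : (mulEquiv hm).symm e = a ⊗ₜ b) :
    e = i a * j b := by
  rw [← (mulEquiv hm).apply_symm_apply e, h, mulEquiv_apply, mulHom_tmul]

/-- Normal form of `G a` for an element `a` with `a w = 1` such that `G a = (G ▷ a) (G ◁ a)` with
`G ◁ a` group-like. -/
theorem G_mul_eq_of_groupLike {a w : H8 k} (haw : a * w = 1) (hε : counit (R := k) a = 1)
    (hΔ : comul (coactMap hm (H4.G k) a)
      = coactMap hm (H4.G k) a ⊗ₜ[k] coactMap hm (H4.G k) a)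
    (ha : j (H4.G k) * i a = i (actMap hm (H4.G k) a) * j (coactMap hm (H4.G k) a)) :
    j (H4.G k) * i a = i (actMap hm (H4.G k) a) * j (H4.G k) := by
  rcases H4.eq_one_or_eq_G ((counit_coactMap_G hm a).trans hε) hΔ with h | h
  -- If `G ◁ a = 1`, then `G a` lies in the image of `H8`, and so does `G` because `a` has a right
  -- inverse. Projected to `H4`, that image consists of scalars.
  · exfalso
    rw [h, map_one, mul_one] at ha
    obtain ⟨b, h2⟩ : ∃ b, j (H4.G k) = i b := by
      refine ⟨actMap hm (H4.G k) a * w, ?_⟩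
      rw [map_mul, ← ha, mul_assoc, ← map_mul, haw, map_one, mul_one]
    have h3 := congrArg (H4.coeffG k ∘ projR hm) h2
    simp at h3
  · rw [h] at ha
    exact ha

theorem G_mul_g : j (H4.G k) * i (H8.g k) = i (actMap hm (H4.G k) (H8.g k)) * j (H4.G k) := by
  refine G_mul_eq_of_groupLike hm (H8.rel k).gg H8.counit_g ?_ ?_
  · rw [comul_coactMap_G, H8.comul_g, TensorProduct.map_tmul]
  · refine eq_mul_of_symm_eq hm ?_
    rw [← map_actMap_coactMap_G, H8.comul_g, TensorProduct.map_tmul]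

theorem G_mul_h : j (H4.G k) * i (H8.h k) = i (actMap hm (H4.G k) (H8.h k)) * j (H4.G k) := by
  refine G_mul_eq_of_groupLike hm (H8.rel k).hh H8.counit_h ?_ ?_
  · rw [comul_coactMap_G, H8.comul_h, TensorProduct.map_tmul]
  · refine eq_mul_of_symm_eq hm ?_
    rw [← map_actMap_coactMap_G, H8.comul_h, TensorProduct.map_tmul]

/-- `z` is not group-like, but cocentrality forces `G ◁ z`, `G ◁ g z` and `G ◁ h z` to coincide. The
coefficients `1/2` of `Δ(z)` then add up so that `G ◁ z` is group-like. -/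
theorem G_mul_z : j (H4.G k) * i (H8.z k) = i (actMap hm (H4.G k) (H8.z k)) * j (H4.G k) := by
  have hc := coactMap_cocentral hm (H8.z k)
  rw [H8.comul_z_eq] at hc
  -- The functional picks `g z` in the second leg, which occurs there only after the flip, with
  -- coefficient proportional to `(G ◁ z) - (G ◁ h z)`.
  have e1 : coactMap hm (H4.G k) (H8.h k * H8.z k) = coactMap hm (H4.G k) (H8.z k) := by
    have := congrArg ((TensorProduct.rid k (H4 k) : H4 k ⊗[k] k →ₗ[k] H4 k) ∘
      TensorProduct.map LinearMap.id (H8.coeffGZ k)) hc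
    simp at this
    exact (sub_eq_zero.mp ((smul_eq_zero.mp this.symm).resolve_left (by norm_num))).symm
  have e2 : coactMap hm (H4.G k) (H8.g k * H8.z k) = coactMap hm (H4.G k) (H8.z k) := by
    have := congrArg ((TensorProduct.rid k (H4 k) : H4 k ⊗[k] k →ₗ[k] H4 k) ∘
      TensorProduct.map LinearMap.id (H8.coeffHZ k)) hc
    simp at this
    exact (sub_eq_zero.mp this).symm
  refine G_mul_eq_of_groupLike hm H8.z_mul_inv H8.counit_z ?_ ?_
  · rw [comul_coactMap_G, H8.comul_z_eq]
    simp only [map_smul, map_add, map_sub, TensorProduct.map_tmul, e1, e2]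
    module
  · refine eq_mul_of_symm_eq hm ?_
    rw [← map_actMap_coactMap_G, H8.comul_z_eq]
    simp only [map_smul, map_add, map_sub, TensorProduct.map_tmul, e1]
    module

/-- The elements `a` with `G a` in `H8 G` form a subalgebra that contains the generators. -/
theorem G_mul (a : H8 k) : j (H4.G k) * i a = i (actMap hm (H4.G k) a) * j (H4.G k) := by
  have uniq (a b : H8 k) (h : j (H4.G k) * i a = i b * j (H4.G k)) : actMap hm (H4.G k) a = b := by
    rw [actMap_apply, h]; simp
  suffices ∃ b, j (H4.G k) * i a = i b * j (H4.G k) by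
    obtain ⟨b, hb⟩ := this
    rw [uniq a b hb, hb]
  have ha : a ∈ Algebra.adjoin k {H8.g k, H8.h k, H8.z k} := by
    rw [H8.adjoin_eq_top]; exact Algebra.mem_top
  induction ha using Algebra.adjoin_induction with
  | mem x hx =>
    rcases hx with (rfl | rfl | rfl)
    · exact ⟨_, G_mul_g hm⟩
    · exact ⟨_, G_mul_h hm⟩
    · exact ⟨_, G_mul_z hm⟩
  | algebraMap r =>
    refine ⟨algebraMap k _ r, ?_⟩
    rw [AlgHomClass.commutes]
    exact (Algebra.commutes r _).symm
  | add x y _ _ hx hy =>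
    obtain ⟨b, hb⟩ := hx
    obtain ⟨c, hc⟩ := hy
    exact ⟨b + c, by simp only [map_add, mul_add, add_mul, hb, hc]⟩
  | mul x y _ _ hx hy =>
    obtain ⟨b, hb⟩ := hx
    obtain ⟨c, hc⟩ := hy
    exact ⟨b * c, by rw [map_mul, ← mul_assoc, hb, mul_assoc, hc, ← mul_assoc, map_mul]⟩

theorem actMap_G_mul (a b : H8 k) :
    actMap hm (H4.G k) (a * b) = actMap hm (H4.G k) a * actMap hm (H4.G k) b := by
  rw [actMap_apply, map_mul i, ← mul_assoc, G_mul hm, mul_assoc, G_mul hm, ← mul_assoc, ← map_mul i,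
    projL_mul, H4.counit_G, one_smul]

theorem coactMap_G (a : H8 k) : coactMap hm (H4.G k) a = counit (R := k) a • H4.G k := by
  rw [coactMap_apply, G_mul hm, projR_mul, counit_actMap_G]

/-- The coefficient of `X` in `X ◁ a`. -/
def chi : H8 k →ₗ[k] k := H4.coeffX k ∘ₗ coactMap hm (H4.X k)

/-- The coefficient of `1` in `X ◁ a`. -/
def psi : H8 k →ₗ[k] k := H4.coeffOne k ∘ₗ coactMap hm (H4.X k)

/-- Because `G ◁ a = ε(a) G`, projecting `Δ(X a)` to `H4` shows that `X ◁ a` is `(1, G)`-primitive.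
-/
theorem coactMap_X (a : H8 k) :
    coactMap hm (H4.X k) a = chi hm a • H4.X k + psi hm a • (1 - H4.G k) := by
  refine H4.eq_of_skewPrimitive ?_
  have key : ∀ t : H8 k ⊗[k] H8 k,
      TensorProduct.map (coactMap hm (H4.X k)) (coactMap hm (H4.G k)) t
        + TensorProduct.map ((projR hm : E →ₗ[k] H4 k) ∘ₗ (i : H8 k →ₗ[k] E))
          (coactMap hm (H4.X k)) t
      = coactMap hm (H4.X k) (TensorProduct.rid k _ (counit.lTensor (H8 k) t)) ⊗ₜ H4.G k
        + 1 ⊗ₜ coactMap hm (H4.X k) (TensorProduct.lid k _ (counit.rTensor (H8 k) t)) := by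
    intro t
    induction t with
    | zero => simp
    | add x y hx hy =>
      simp only [map_add, TensorProduct.add_tmul, TensorProduct.tmul_add]
      rw [add_add_add_comm, hx, hy, add_add_add_comm]
    | tmul x y => simp [coactMap_G, TensorProduct.smul_tmul']
  conv_lhs => rw [coactMap_apply, ← CoalgHomClass.map_comp_comul_apply (projR hm)]
  refine (map_comul_X_mul _ _ a).trans ((key _).trans ?_)
  simp

theorem symm_X_mul (a : H8 k) : (mulEquiv hm).symm (j (H4.X k) * i a)
    = convR (chi hm) a ⊗ₜ H4.X k + convR (psi hm) a ⊗ₜ (1 - H4.G k)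
      + actMap hm (H4.X k) a ⊗ₜ H4.G k := by
  have key : ∀ t : H8 k ⊗[k] H8 k,
      TensorProduct.map (actMap hm (H4.X k)) (coactMap hm (H4.G k)) t
        + TensorProduct.map ((projL hm : E →ₗ[k] H8 k) ∘ₗ (i : H8 k →ₗ[k] E))
          (coactMap hm (H4.X k)) t
      = (TensorProduct.rid k _ (TensorProduct.map LinearMap.id (chi hm) t)) ⊗ₜ H4.X k
        + (TensorProduct.rid k _ (TensorProduct.map LinearMap.id (psi hm) t)) ⊗ₜ (1 - H4.G k)
        + actMap hm (H4.X k) (TensorProduct.rid k _ (counit.lTensor (H8 k) t)) ⊗ₜ H4.G k := by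
    intro t
    induction t with
    | zero => simp
    | add x y hx hy =>
      simp only [map_add, TensorProduct.add_tmul]
      rw [add_add_add_comm, hx, hy]
      abel
    | tmul x y =>
      simp [coactMap_G, coactMap_X, TensorProduct.smul_tmul', TensorProduct.tmul_add, add_comm]
  rw [← map_projL_projR_comul]
  refine (map_comul_X_mul _ _ a).trans ((key _).trans ?_)
  simp [convR]

/-- A second expression for the element of `symm_X_mul`, from the comultiplication with legs
exchanged. Comparing the two expressions is the content of the compatibility condition for `X`. -/
theorem comm_symm_X_mul (a : H8 k) : (mulEquiv hm).symm (j (H4.X k) * i a)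
    = convL (chi hm) (actMap hm (H4.G k)) a ⊗ₜ H4.X k
      + convL (psi hm) (actMap hm (H4.G k)) a ⊗ₜ (1 - H4.G k)
      + actMap hm (H4.X k) a ⊗ₜ 1 := by
  have key : ∀ t : H8 k ⊗[k] H8 k,
      TensorProduct.map (coactMap hm (H4.X k)) (actMap hm (H4.G k)) t
        + TensorProduct.map ((projR hm : E →ₗ[k] H4 k) ∘ₗ (i : H8 k →ₗ[k] E))
          (actMap hm (H4.X k)) t
      = H4.X k ⊗ₜ (TensorProduct.lid k _ (TensorProduct.map (chi hm) (actMap hm (H4.G k)) t))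
        + (1 - H4.G k) ⊗ₜ
          (TensorProduct.lid k _ (TensorProduct.map (psi hm) (actMap hm (H4.G k)) t))
        + 1 ⊗ₜ actMap hm (H4.X k) (TensorProduct.lid k _ (counit.rTensor (H8 k) t)) := by
    intro t
    induction t with
    | zero => simp
    | add x y hx hy =>
      simp only [map_add, TensorProduct.tmul_add]
      rw [add_add_add_comm, hx, hy]
      abel
    | tmul x y =>
      simp [coactMap_X, TensorProduct.smul_tmul', TensorProduct.add_tmul]
  apply (TensorProduct.comm k (H8 k) (H4 k)).injective
  rw [← map_projR_projL_comul]
  refine (map_comul_X_mul _ _ a).trans ((key _).trans ?_)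
  simp [convL]

theorem convR_chi (a : H8 k) : convR (chi hm) a = convL (chi hm) (actMap hm (H4.G k)) a := by
  have h := (symm_X_mul hm a).symm.trans (comm_symm_X_mul hm a)
  simpa [TensorProduct.tmul_sub] using congrArg (coeffL (H4.coeffX k)) h

theorem X_mul (a : H8 k) : j (H4.X k) * i a = i (convR (psi hm) a)
    + i (-convL (psi hm) (actMap hm (H4.G k)) a) * j (H4.G k)
    + i (convR (chi hm) a) * j (H4.X k) := by
  have h := (symm_X_mul hm a).symm.trans (comm_symm_X_mul hm a)
  -- The coefficients of `G` in the two expressions give `X ▷ a = ∑ a₁ ψ(a₂) - ∑ ψ(a₁) (G ▷ a₂)`,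
  -- which eliminates `X ▷ a`.
  have hG := congrArg (coeffL (H4.coeffG k)) h
  simp [TensorProduct.tmul_sub] at hG
  have h2 := congrArg (mulEquiv hm) (symm_X_mul hm a)
  rw [CoalgEquiv.apply_symm_apply] at h2
  rw [h2, ← hG]
  simp only [map_add, TensorProduct.tmul_sub, map_sub, mulEquiv_apply, mulHom_tmul, map_one,
    map_neg, add_mul, neg_mul, mul_one]
  abel

end

end Factorization

/-! ### Determination of the character `χ` (`chi`) and of `ψ` (`psi`), and the four cases. -/

namespace Factorization

variable {k : Type*} [Field k] [CharZero k] {E : Type*} [Ring E] [HopfAlgebra k E]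
  {i : H8 k →ₐc[k] E} {j : H4 k →ₐc[k] E}

theorem convR_g (φ : H8 k →ₗ[k] k) : convR φ (H8.g k) = φ (H8.g k) • H8.g k := by
  simp [convR, H8.comul_g]

theorem convR_h (φ : H8 k →ₗ[k] k) : convR φ (H8.h k) = φ (H8.h k) • H8.h k := by
  simp [convR, H8.comul_h]

theorem convR_z (φ : H8 k →ₗ[k] k) : convR φ (H8.z k) = (1 / 2 : k) • (φ (H8.z k) • H8.z k
    + φ (H8.z k) • (H8.g k * H8.z k) + φ (H8.h k * H8.z k) • H8.z k
    - φ (H8.h k * H8.z k) • (H8.g k * H8.z k)) := by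
  simp only [convR, LinearMap.comp_apply, H8.comul_z_eq, map_smul, map_add, map_sub]
  simp

theorem convL_g (φ : H8 k →ₗ[k] k) (σ : H8 k →ₗ[k] H8 k) :
    convL φ σ (H8.g k) = φ (H8.g k) • σ (H8.g k) := by
  simp [convL, H8.comul_g]

theorem convL_h (φ : H8 k →ₗ[k] k) (σ : H8 k →ₗ[k] H8 k) :
    convL φ σ (H8.h k) = φ (H8.h k) • σ (H8.h k) := by
  simp [convL, H8.comul_h]

theorem convL_z (φ : H8 k →ₗ[k] k) (σ : H8 k →ₗ[k] H8 k) :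
    convL φ σ (H8.z k) = (1 / 2 : k) • (φ (H8.z k) • σ (H8.z k)
    + φ (H8.g k * H8.z k) • σ (H8.z k) + φ (H8.z k) • σ (H8.h k * H8.z k)
    - φ (H8.g k * H8.z k) • σ (H8.h k * H8.z k)) := by
  simp only [convL, LinearMap.comp_apply, H8.comul_z_eq, map_smul, map_add, map_sub]
  simp

variable (hm : Function.Bijective (mulHom i j))

theorem X_mul_one : convR (psi hm) 1 = 0 ∧ convR (chi hm) 1 = 1 := by
  have h := X_mul hm 1
  have h2 := eq_of_sum_eq hm (a := 0) (b := 0) (c := 1) (d := 0) (a' := convR (psi hm) 1)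
    (b' := -convL (psi hm) (actMap hm (H4.G k)) 1) (c' := convR (chi hm) 1) (d' := 0) (by
      rw [← h]; simp)
  exact ⟨h2.1.symm, h2.2.2.1.symm⟩

/-- Expand `(X a) b` by the normal forms and compare coefficients of `1` and `X` over `H8`. Under
the counit this yields `chi_mul` and `psi_mul`. -/
theorem X_mul_mul (a b : H8 k) :
    convR (psi hm) (a * b) = convR (chi hm) a * convR (psi hm) b + convR (psi hm) a * b ∧
      convR (chi hm) (a * b) = convR (chi hm) a * convR (chi hm) b := by
  have h := X_mul hm (a * b)
  have h2 : j (H4.X k) * i (a * b) = i (convR (chi hm) a * convR (psi hm) b + convR (psi hm) a * b)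
      + i (-convR (chi hm) a * convL (psi hm) (actMap hm (H4.G k)) b
        - convL (psi hm) (actMap hm (H4.G k)) a * actMap hm (H4.G k) b) * j (H4.G k)
      + i (convR (chi hm) a * convR (chi hm) b) * j (H4.X k) := by
    rw [map_mul i a b, ← mul_assoc, X_mul hm a, add_mul, add_mul, mul_assoc _ (j (H4.X k)),
      X_mul hm b, mul_assoc _ (j (H4.G k)), G_mul hm b]
    simp only [map_add, map_sub, map_neg, map_mul, mul_add, neg_mul, mul_neg, sub_mul, mul_assoc]
    abel
  have h3 := eq_of_sum_eq hm (d := 0) (d' := 0)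
    (by simpa only [map_zero, zero_mul, add_zero] using h.symm.trans h2)
  exact ⟨h3.1, h3.2.2.1⟩

/-- The coefficient of `X` in `X X a = 0`. -/
theorem X_mul_X_mul (a : H8 k) :
    convR (psi hm) (convR (chi hm) a) + convR (chi hm) (convR (psi hm) a) = 0 := by
  have hXX : j (H4.X k) * j (H4.X k) = 0 := by rw [← map_mul, (H4.rel k).XX, map_zero]
  have hGG : j (H4.G k) * j (H4.G k) = 1 := by rw [← map_mul, (H4.rel k).GG, map_one]
  have hXG : j (H4.X k) * j (H4.G k) = -j (H4.G k * H4.X k) := by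
    rw [← map_mul, (H4.rel k).XG, map_neg]
  have h0 : j (H4.X k) * (j (H4.X k) * i a) = 0 := by rw [← mul_assoc, hXX, zero_mul]
  set τ := convR (chi hm) with hτ
  set α := convR (psi hm) with hα
  set β := convL (psi hm) (actMap hm (H4.G k)) with hβ
  have hX : ∀ a, j (H4.X k) * i a = i (α a) + i (-β a) * j (H4.G k) + i (τ a) * j (H4.X k) :=
    X_mul hm
  -- The term `τ(τ(a)) X²` vanishes, and `X G = -G X` sends `X β(a) G` into the coefficients of `1`,
  -- `G` and `G X`, so `X` receives only `α τ` and `τ α`.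
  have h2 : j (H4.X k) * (j (H4.X k) * i a) = i (α (α a) + β (β a))
      + i (-β (α a) - α (β a)) * j (H4.G k) + i (α (τ a) + τ (α a)) * j (H4.X k)
      + i (τ (β a) - β (τ a)) * j (H4.G k * H4.X k) := by
    rw [hX a, mul_add, mul_add, ← mul_assoc, ← mul_assoc, hX (α a), hX (-β a), hX (τ a)]
    simp only [map_add, map_sub, map_neg, add_mul, neg_mul, sub_mul, mul_assoc, hGG, hXX, hXG,
      ← map_mul j]
    simp only [map_mul j, mul_neg, mul_zero, mul_one]
    abel
  exact (eq_of_sum_eq hm (a' := 0) (b' := 0) (c' := 0) (d' := 0)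
    (by rw [← h2, h0]; simp)).2.2.1

theorem chi_one : chi hm 1 = 1 := by
  rw [← counit_convR, (X_mul_one hm).2, Bialgebra.counit_one]

theorem chi_mul (a b : H8 k) : chi hm (a * b) = chi hm a * chi hm b := by
  rw [← counit_convR, (X_mul_mul hm a b).2, Bialgebra.counit_mul, counit_convR, counit_convR]

theorem psi_mul (a b : H8 k) :
    psi hm (a * b) = chi hm a * psi hm b + psi hm a * counit (R := k) b := by
  rw [← counit_convR (psi hm), (X_mul_mul hm a b).1, map_add, Bialgebra.counit_mul,
    Bialgebra.counit_mul, counit_convR, counit_convR, counit_convR]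

theorem psi_convR_add (a : H8 k) :
    psi hm (convR (chi hm) a) + chi hm (convR (psi hm) a) = 0 := by
  have := congrArg (counit (R := k)) (X_mul_X_mul hm a)
  rwa [map_add, counit_convR, counit_convR, map_zero] at this

theorem chi_g_mul_self : chi hm (H8.g k) * chi hm (H8.g k) = 1 := by
  rw [← chi_mul, (H8.rel k).gg, chi_one]

theorem chi_h_mul_self : chi hm (H8.h k) * chi hm (H8.h k) = 1 := by
  rw [← chi_mul, (H8.rel k).hh, chi_one]

/-- A character does not vanish on the invertible element `z`. -/
theorem chi_z_ne_zero : chi hm (H8.z k) ≠ 0 := by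
  intro h
  have := chi_mul hm (H8.z k) _ ▸ congrArg (chi hm) (H8.z_mul_inv (k := k))
  rw [h, chi_one] at this
  simp at this

theorem chi_h_eq : chi hm (H8.h k) = chi hm (H8.g k) := by
  have h := congrArg (chi hm) (H8.rel k).hz
  rw [chi_mul, chi_mul, mul_comm] at h
  exact mul_left_cancel₀ (chi_z_ne_zero hm) h

/-- With `c = χ(g) = χ(h)` and `c² = 1`, the relation for `z²` gives `(1 + 2 c - c²) / 2 = c`. -/
theorem chi_z_mul_self : chi hm (H8.z k) * chi hm (H8.z k) = chi hm (H8.g k) := by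
  have h1 := chi_g_mul_self hm
  rw [← chi_mul, (H8.rel k).zz, map_smul, map_sub, map_add, map_add, chi_mul, chi_one, chi_h_eq]
  simp only [smul_eq_mul]
  linear_combination (-1 / 2) * h1

/-- On a group-like element, `psi_convR_add` reads `2 χ(g) ψ(g) = 0`. -/
theorem psi_g : psi hm (H8.g k) = 0 := by
  have h := psi_convR_add hm (H8.g k)
  rw [convR_g, convR_g, map_smul, map_smul, smul_eq_mul, smul_eq_mul] at h
  have h1 := chi_g_mul_self hm
  linear_combination (chi hm (H8.g k) / 2) * h - psi hm (H8.g k) * h1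

theorem psi_h : psi hm (H8.h k) = 0 := by
  have h := psi_convR_add hm (H8.h k)
  rw [convR_h, convR_h, map_smul, map_smul, smul_eq_mul, smul_eq_mul] at h
  have h1 := chi_h_mul_self hm
  linear_combination (chi hm (H8.h k) / 2) * h - psi hm (H8.h k) * h1

/-- Each summand of `psi_convR_add` at `z` equals `χ(g) χ(z) ψ(z)`, because `ψ(g z) = χ(g) ψ(z)`,
likewise for `h z`, and `χ(g)² = 1`. -/
theorem psi_z : psi hm (H8.z k) = 0 := by
  have h := psi_convR_add hm (H8.z k)
  rw [convR_z, convR_z] at h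
  simp only [map_smul, map_add, map_sub, smul_eq_mul, psi_mul, chi_mul, psi_g, psi_h, zero_mul,
    add_zero, chi_h_eq] at h
  have h1 := chi_g_mul_self hm
  have h2 := chi_z_ne_zero hm
  have h3 : 2 * (chi hm (H8.g k) * chi hm (H8.z k)) * psi hm (H8.z k) = 0 := by
    linear_combination h + chi hm (H8.z k) * psi hm (H8.z k) * h1 
  have h4 : chi hm (H8.g k) ≠ 0 := fun h0 => by simp [h0] at h1
  simpa [h2, h4] using h3

theorem X_mul_g : j (H4.X k) * i (H8.g k) = chi hm (H8.g k) • (i (H8.g k) * j (H4.X k)) := by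
  rw [X_mul hm, convR_g, convR_g, convL_g, psi_g]
  simp

theorem X_mul_h : j (H4.X k) * i (H8.h k) = chi hm (H8.g k) • (i (H8.h k) * j (H4.X k)) := by
  rw [X_mul hm, convR_h, convR_h, convL_h, psi_h, chi_h_eq]
  simp

theorem X_mul_z : j (H4.X k) * i (H8.z k) = i (convR (chi hm) (H8.z k)) * j (H4.X k) := by
  rw [X_mul hm, convR_z (psi hm), convL_z, psi_mul, psi_mul, psi_z, psi_g, psi_h]
  simp

theorem convR_chi_z : convR (chi hm) (H8.z k) = (chi hm (H8.z k) / 2) •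
    ((1 + chi hm (H8.g k)) • H8.z k + (1 - chi hm (H8.g k)) • (H8.g k * H8.z k)) := by
  rw [convR_z, chi_mul, chi_h_eq]
  module

/-- At a group-like element, `convR_chi` is `χ(g) g = χ(g) (G ▷ g)`. -/
theorem actMap_G_g : actMap hm (H4.G k) (H8.g k) = H8.g k := by
  have h := convR_chi hm (H8.g k)
  rw [convR_g, convL_g] at h
  have h4 : chi hm (H8.g k) ≠ 0 := fun h0 => by simpa [h0] using chi_g_mul_self hm
  exact (smul_right_injective _ h4 h).symm

theorem actMap_G_h : actMap hm (H4.G k) (H8.h k) = H8.h k := by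
  have h := convR_chi hm (H8.h k)
  rw [convR_h, convL_h] at h
  have h4 : chi hm (H8.h k) ≠ 0 := fun h0 => by simpa [h0] using chi_h_mul_self hm
  exact (smul_right_injective _ h4 h).symm

/-- `convR_chi` at `z`, divided by `χ(z) / 2`. For `χ(g) = 1` it says `G ▷ z = z`; for `χ(g) = -1`
it says `g z = h (G ▷ z)`. -/
theorem smul_actMap_G_z : (1 + chi hm (H8.g k)) • H8.z k
      + (1 - chi hm (H8.g k)) • (H8.g k * H8.z k)
    = (1 + chi hm (H8.g k)) • actMap hm (H4.G k) (H8.z k)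
      + (1 - chi hm (H8.g k)) • (H8.h k * actMap hm (H4.G k) (H8.z k)) := by
  have h := convR_chi hm (H8.z k)
  rw [convR_chi_z, convL_z, actMap_G_mul, actMap_G_h, chi_mul] at h
  have h2 : chi hm (H8.z k) / 2 ≠ 0 := div_ne_zero (chi_z_ne_zero hm) two_ne_zero
  refine smul_right_injective _ h2 (h.trans ?_)
  simp only []
  module

theorem commute_of_chi (hg : chi hm (H8.g k) = 1) (hz : chi hm (H8.z k) = 1) (a : H8 k) (b : H4 k) :
    Commute (i a) (j b) := by
  have hG : ∀ a, j (H4.G k) * i a = i (AlgHom.id k (H8 k) a) * j (H4.G k) := by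
    refine comm_of_gen ?_ ?_ ?_
    · rw [G_mul hm, actMap_G_g]; rfl
    · rw [G_mul hm, actMap_G_h]; rfl
    · have h := smul_actMap_G_z hm
      rw [hg, sub_self, zero_smul, zero_smul, add_zero, add_zero] at h
      have h2 := smul_right_injective _ (by norm_num : (1 + 1 : k) ≠ 0) h
      rw [G_mul hm, ← h2]; rfl
  have hX : ∀ a, j (H4.X k) * i a = i (AlgHom.id k (H8 k) a) * j (H4.X k) := by
    refine comm_of_gen ?_ ?_ ?_
    · rw [X_mul_g hm, hg, one_smul]; rfl
    · rw [X_mul_h hm, hg, one_smul]; rfl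
    · rw [X_mul_z hm, convR_chi_z, hg, hz, sub_self, zero_smul, add_zero, smul_smul]
      norm_num
  have hb : b ∈ Algebra.adjoin k {H4.G k, H4.X k} := by
    rw [H4.adjoin_eq_top]; exact Algebra.mem_top
  induction hb using Algebra.adjoin_induction with
  | mem x hx =>
    rcases hx with (rfl | rfl)
    · exact (hG a).symm
    · exact (hX a).symm
  | algebraMap r => rw [AlgHomClass.commutes]; exact (Algebra.commutes r (i a)).symm
  | add x y _ _ hx hy => rw [map_add]; exact hx.add_right hy
  | mul x y _ _ hx hy => rw [map_mul]; exact hx.mul_right hy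

theorem relA_of_chi (hg : chi hm (H8.g k) = 1) (hz : chi hm (H8.z k) = -1) :
    HopfGen.RelA (i (H8.g k)) (i (H8.h k)) (i (H8.z k)) (j (H4.G k)) (j (H4.X k)) := by
  constructor
  · rw [G_mul hm, actMap_G_g]
  · rw [G_mul hm, actMap_G_h]
  · have h := smul_actMap_G_z hm
    rw [hg, sub_self, zero_smul, zero_smul, add_zero, add_zero] at h
    have h2 := smul_right_injective _ (by norm_num : (1 + 1 : k) ≠ 0) h
    rw [G_mul hm, ← h2]
  · rw [X_mul_g hm, hg, one_smul]
  · rw [X_mul_h hm, hg, one_smul]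
  · rw [X_mul_z hm, convR_chi_z, hg, hz, sub_self, zero_smul, add_zero, smul_smul]
    norm_num

theorem relB_of_chi {q : k} (hq : q ^ 2 = -1) (hg : chi hm (H8.g k) = -1)
    (hz : chi hm (H8.z k) = q) :
    HopfGen.RelB k q (i (H8.g k)) (i (H8.h k)) (i (H8.z k)) (j (H4.G k)) (j (H4.X k)) := by
  have R8 := (H8.rel k).map (i : H8 k →ₐ[k] E)
  simp only [BialgHom.coe_toAlgHom] at R8
  obtain ⟨gg, hh, gh, zz, gz, hz'⟩ := R8
  have hXz : j (H4.X k) * i (H8.z k) = q • (i (H8.g k) * (i (H8.z k) * j (H4.X k))) := by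
    rw [X_mul_z hm, convR_chi_z, hg, hz, add_neg_cancel, zero_smul, zero_add, smul_smul, map_smul,
      map_mul, smul_mul_assoc, mul_assoc]
    congr 1
    ring
  have hgX : i (H8.g k) * j (H4.X k) = -(j (H4.X k) * i (H8.g k)) := by
    rw [X_mul_g hm, hg]; simp
  constructor
  · rw [G_mul hm, actMap_G_g]
  · rw [G_mul hm, actMap_G_h]
  · have h := smul_actMap_G_z hm
    rw [hg, add_neg_cancel, zero_smul, zero_smul, zero_add, zero_add] at h
    have h2 : H8.g k * H8.z k = H8.h k * actMap hm (H4.G k) (H8.z k) :=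
      smul_right_injective _ (by norm_num : (1 - -1 : k) ≠ 0) h
    rw [G_mul hm (H8.h k), actMap_G_h, mul_assoc _ (j (H4.G k)), G_mul hm (H8.z k),
      ← mul_assoc (i (H8.h k)), ← map_mul, ← map_mul, ← h2]
  · exact hgX
  · rw [X_mul_h hm, hg]; simp
  -- The rule `X z = q g z X` is solved for `z X`: `q X g z = -q g X z = -q² z X = z X`.
  · rw [← neg_eq_iff_eq_neg] at hgX
    rw [← hgX, neg_mul, mul_assoc, hXz, mul_smul_comm, ← mul_assoc (i (H8.g k)) (i (H8.g k)), gg,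
      one_mul, smul_neg, smul_smul, ← pow_two, hq]
    simp

/-- The value of `χ(z)` selects the presentation whose relations hold in `E`. The resulting algebra
map respects both factorizations, so `nonempty_bialgEquiv` applies. -/
theorem nonempty_bialgEquiv_of_factorizesThrough (q : k) (hq : q ^ 2 = -1)
    (hE : FactorizesThrough k (H8 k) (H4 k) E) :
    Nonempty (E ≃ₐc[k] (H8 k ⊗[k] H4 k)) ∨ Nonempty (E ≃ₐc[k] H32A k) ∨
      Nonempty (E ≃ₐc[k] H32B k q) ∨ Nonempty (E ≃ₐc[k] H32B k (-q)) := by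
  rw [factorizesThrough_iff] at hE
  obtain ⟨i, j, hm⟩ := hE
  have R8 := (H8.rel k).map (i : H8 k →ₐ[k] E)
  have R4 := (H4.rel k).map (j : H4 k →ₐ[k] E)
  simp only [BialgHom.coe_toAlgHom] at R8 R4
  have hB {p : k} (hp : p ^ 2 = -1) (hg : chi hm (H8.g k) = -1) (hz : chi hm (H8.z k) = p) :
      Nonempty (E ≃ₐc[k] H32B k p) := by
    have R := relB_of_chi hm hp hg hz
    refine nonempty_bialgEquiv hm (H32B.bijective_mulHom hp)
      (H32B.liftHom R8 R4 R) (fun a => ?_) (fun b => ?_)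
    · exact DFunLike.congr_fun (H8.hom_ext (φ := (H32B.liftHom R8 R4 R).comp
        (H32B.incl8 p : H8 k →ₐ[k] H32B k p))
        (ψ := (i : H8 k →ₐ[k] E)) (by simp) (by simp) (by simp)) a
    · exact DFunLike.congr_fun (H4.hom_ext (φ := (H32B.liftHom R8 R4 R).comp
        (H32B.incl4 p : H4 k →ₐ[k] H32B k p))
        (ψ := (j : H4 k →ₐ[k] E)) (by simp) (by simp)) b
  have hzz := chi_z_mul_self hm
  rcases mul_self_eq_one_iff.mp (chi_g_mul_self hm) with hg | hg
  · rw [hg] at hzz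
    rcases mul_self_eq_one_iff.mp hzz with hz | hz
    · left
      refine nonempty_bialgEquiv hm bijective_mulHom_inl_inr
        (Algebra.TensorProduct.lift (i : H8 k →ₐ[k] E) (j : H4 k →ₐ[k] E)
          (commute_of_chi hm hg hz)) (fun a => ?_) (fun b => ?_)
      · rw [inl_apply]
        exact (Algebra.TensorProduct.lift_tmul _ _ _ _ _).trans (by simp)
      · rw [inr_apply]
        exact (Algebra.TensorProduct.lift_tmul _ _ _ _ _).trans (by simp)
    · right; left
      have R := relA_of_chi hm hg hz
      refine nonempty_bialgEquiv hm H32A.bijective_mulHom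
        (H32A.liftHom R8 R4 R) (fun a => ?_) (fun b => ?_)
      · exact DFunLike.congr_fun (H8.hom_ext (φ := (H32A.liftHom R8 R4 R).comp
          (H32A.incl8 k : H8 k →ₐ[k] H32A k))
          (ψ := (i : H8 k →ₐ[k] E)) (by simp) (by simp) (by simp)) a
      · exact DFunLike.congr_fun (H4.hom_ext (φ := (H32A.liftHom R8 R4 R).comp
          (H32A.incl4 k : H4 k →ₐ[k] H32A k))
          (ψ := (j : H4 k →ₐ[k] E)) (by simp) (by simp)) b
  · right; right
    -- Here `χ(z)² = -1 = q²`, so `χ(z)` is `q` or `-q`.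
    rw [hg, ← hq, pow_two] at hzz
    rcases mul_self_eq_mul_self_iff.mp hzz with hz | hz
    · exact Or.inl (hB hq hg hz)
    · exact Or.inr (hB (by rw [neg_sq, hq]) hg hz)

end Factorization

end

/-! ### The equivalence of the five conditions. -/

open Factorization in
theorem theorem5p1 {k : Type*} [Field k] [IsAlgClosed k] [CharZero k] (i : k) (hi : i ^ 2 = -1)
    {E : Type*} [Ring E] [HopfAlgebra k E] :
    List.TFAE [
      FactorizesThrough k (H8 k) (H4 k) E,
      FactorizesThrough k (H4 k) (H8 k) E,
      IsBicrossedProduct k (H8 k) (H4 k) E,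
      IsBicrossedProduct k (H4 k) (H8 k) E,
      Nonempty (E ≃ₐc[k] (H8 k ⊗[k] H4 k)) ∨ Nonempty (E ≃ₐc[k] H32A k) ∨
        Nonempty (E ≃ₐc[k] H32B k i) ∨ Nonempty (E ≃ₐc[k] H32B k (-i))] := by
  rw [isBicrossedProduct_iff, isBicrossedProduct_iff]
  tfae_have 1 → 2 := FactorizesThrough.swap H8.antipode_iterate H4.antipode_iterate
  tfae_have 2 → 1 := FactorizesThrough.swap H4.antipode_iterate H8.antipode_iterate
  tfae_have 3 ↔ 1 := Iff.rfl
  tfae_have 4 ↔ 2 := Iff.rfl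
  tfae_have 1 → 5 := nonempty_bialgEquiv_of_factorizesThrough i hi
  tfae_have 5 → 1 := by
    rintro (⟨⟨e⟩⟩ | ⟨⟨e⟩⟩ | ⟨⟨e⟩⟩ | ⟨⟨e⟩⟩)
    · exact (factorizesThrough bijective_mulHom_inl_inr).of_bialgEquiv e
    · exact (factorizesThrough H32A.bijective_mulHom).of_bialgEquiv e
    · exact (factorizesThrough (H32B.bijective_mulHom hi)).of_bialgEquiv e
    · exact (factorizesThrough (H32B.bijective_mulHom (by rw [neg_sq, hi]))).of_bialgEquiv e
  tfae_finish
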